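/- Let $S$ be a Sommerfeld surface with $M$ sheets and finite set $P=\{P_1,\dots,P_N\}\subset\mathbb R^2$ of affixes of branch points, with natural projection $\psi:S\to\mathbb R^2$: a Hausdorff space with a proper map $\psi$ which is an $M$-sheeted covering over $\mathbb R^2\setminus P$, completed over $P$ by finitely many points, each having arbitrarily small neighbourhoods that stay connected when the point is removed (as obtained by gluing $M$ cut planes). Points over $P$ are called branch points. Let $k\in\mathbb C$ with $\operatorname{Re}k>0$, $\operatorname{Im}k\ge0$. Let $u:S\to\mathbb C$ be continuous, a $C^2$ solution of $(\partial_{x_1}^2+\partial_{x_2}^2+k^2)u=0$ on the sheets away from the branch points, with $\iint(|\nabla u|^2+|u|^2)\,dx_1dx_2$ finite near the branch points. Let $A_0\in S$ with $\psi(A_0)\notin P$. Let $\gamma$ be a small loop around $A_0$: a closed $C^1$ contour that lies in a neighbourhood of $A_0$ contained in one sheet, projecting bijectively onto an open set which is star-shaped about $\psi(A_0)$ and disjoint from $P$; that does not pass through $A_0$; and whose projection has winding number $+1$ about $\psi(A_0)$. Let $\sigma$ be a path $A:[0,1]\to\mathbb C^2$, continuous, with $A(0)=\psi(A_0)\in\mathbb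 R^2\subset\mathbb C^2$. With $A(\tau)=(x_1,x_2)$, let $$A_1(\tau)=(\operatorname{Re}x_1-\operatorname{Im}x_2,\ \operatorname{Im}x_1+\operatorname{Re}x_2),\qquad A_2(\tau)=(\operatorname{Re}x_1+\operatorname{Im}x_2,\ \operatorname{Re}x_2-\operatorname{Im}x_1)$$ be its associated real points. Let $\Gamma(\tau)$, $\tau\in[0,1]$, be closed $C^1$ contours on $S$ avoiding the branch points, with parametrisations $t\in[0,1]\mapsto\Gamma(\tau,t)$ jointly continuous in $(\tau,t)$, such that $\Gamma(0)=\gamma$ and $A_1(\tau),A_2(\tau)\notin\psi(\Gamma(\tau))$ for all $\tau$. For $\mathbf r=(x_1,x_2)\in\mathbb C^2$ and $\mathbf r'=(x_1',x_2')\in\mathbb R^2$ let $$G(\mathbf r,\mathbf r')=-\tfrac i4H_0^{(1)}\!\left(k\sqrt{(x_1-x_1')^2+(x_2-x_2')^2}\right),$$ where at $\tau=0$, $\mathbf r=A(0)$, $\mathbf r'\in\psi(\Gamma(0))$ the square root is positive and $H_0^{(1)}$ has its main branch, and the branch is then continued continuously in $\tau$ and to nearby $\mathbf r,\mathbf r'$.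 Put $$I_\tau(\mathbf r)=\int_{\Gamma(\tau)}\left[\frac{\partial G}{\partial n'}(\mathbf r,\mathbf r')\,u(\mathbf r')-\frac{\partial u}{\partial n'}(\mathbf r')\,G(\mathbf r,\mathbf r')\right]dl',$$ where $n'$ is the unit normal pointing to the right of the oriented contour. Then this branch exists, i.e. there is a branch of $\log\sqrt{(x_1-x_1')^2+(x_2-x_2')^2}$ at $\mathbf r=A(\tau)$, $\mathbf r'=\psi(\Gamma(\tau,t))$ that is continuous in $(\tau,t)\in[0,1]^2$ and equals the real logarithm at $\tau=0$; it is unique, and for each $\tau$ it takes the same value at $t=0$ and $t=1$. Moreover, the functions $I_\tau$ define an analytic continuation of $u$ along $\sigma$ that satisfies the complex Helmholtz equation. That is, there is $\delta>0$ such that: 1. for every $\tau\in[0,1]$, $I_\tau$ is analytic on the ball $B(A(\tau),\delta)\subset\mathbb C^2$ and $(\partial_{x_1}^2+\partial_{x_2}^2+k^2)I_\tau=0$ there; 2. for real $x$ with $|x-\psi(A_0)|<\delta$, $I_0(x)$ is the value of $u$ over $x$ on the sheet of $A_0$; 3. there is $\eta>0$ such that $I_\tau=I_{\tau'}$ on $B(A(\tau),\delta)\cap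 B(A(\tau'),\delta)$ whenever $|\tau-\tau'|<\eta$; 4. if the path $\sigma$ is simple ($A$ injective), there is a single function $u_{\rm c}$ on the $\delta$-neighbourhood of $\sigma$, analytic and satisfying $(\partial_{x_1}^2+\partial_{x_2}^2+k^2)u_{\rm c}=0$ there, with $u_{\rm c}=I_\tau$ on $B(A(\tau),\delta)$ for every $\tau$. -/

import Mathlib

open Set Filter Topology MeasureTheory Metric

noncomputable section

namespace Sommerfeld

/-- The real Cartesian plane with coordinates `(x₁, x₂) = (x 0, x 1)`. -/
abbrev Plane := EuclideanSpace ℝ (Fin 2)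

/-- The space `ℂ²` with coordinates `(x₁, x₂) = (r 0, r 1)`. -/
abbrev C2 := EuclideanSpace ℂ (Fin 2)

/-- The inclusion `ℝ² ⊂ ℂ²`. -/
def toC2 (x : Plane) : C2 := !₂[(x 0 : ℂ), (x 1 : ℂ)]

/-! ### The Helmholtz operator, real (`𝕜 = ℝ`) and complex (`𝕜 = ℂ`) -/

/-- The partial derivative `∂f/∂xᵢ` over `𝕜`. -/
def pderiv (𝕜 : Type) [RCLike 𝕜] [NormedSpace 𝕜 ℂ] (i : Fin 2)
    (f : EuclideanSpace 𝕜 (Fin 2) → ℂ) (x : EuclideanSpace 𝕜 (Fin 2)) : ℂ :=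
  fderiv 𝕜 f x (EuclideanSpace.single i (1 : 𝕜))

/-- `(∂₁² + ∂₂² + k²) f`. -/
def helmholtz (𝕜 : Type) [RCLike 𝕜] [NormedSpace 𝕜 ℂ] (k : ℂ)
    (f : EuclideanSpace 𝕜 (Fin 2) → ℂ) (x : EuclideanSpace 𝕜 (Fin 2)) : ℂ :=
  pderiv 𝕜 0 (pderiv 𝕜 0 f) x + pderiv 𝕜 1 (pderiv 𝕜 1 f) x + k ^ 2 * f x

/-! ### Sommerfeld surfaces and functions on them -/

/-- `ψ : S → ℝ²` is the natural projection of a Sommerfeld surface with `M` sheets and branch points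
(possibly spurious ones) over the finite set `P`: away from `P` the surface consists locally of `M`
copies of the plane, and it is completed over `P` by finitely many points, each of which has
arbitrarily small neighbourhoods that remain connected when the point is removed.
Gluing `M` cut planes along their cuts gives exactly such a surface. -/
structure IsSommerfeldSurface {S : Type*} [TopologicalSpace S] (ψ : S → Plane)
    (P : Finset Plane) (M : ℕ) : Prop where
  hausdorff : T2Space S
  proper : IsProperMap ψ
  covering : IsCoveringMapOn ψ {x | x ∉ P}
  sheets : ∀ x, x ∉ P → (ψ ⁻¹' {x}).encard = M
  finite_fibre : ∀ x ∈ P, (ψ ⁻¹' {x}).Finite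
  punctured : ∀ q, ψ q ∈ P → ∀ V ∈ 𝓝 q, ∃ W ∈ 𝓝 q, W ⊆ V ∧ IsConnected (W \ {q})

/-- `s` is, near `ψ q`, the local inverse of `ψ` through `q`. Its germ at `ψ q` is unique when `q`
is not a branch point. -/
def IsLocalSection {S : Type*} [TopologicalSpace S] (ψ : S → Plane) (q : S) (s : Plane → S) :
    Prop :=
  s (ψ q) = q ∧ ContinuousAt s (ψ q) ∧ ∀ᶠ x in 𝓝 (ψ q), ψ (s x) = x

open Classical in
/-- The local inverse of `ψ` through `q`: it lifts a neighbourhood of `ψ q` to the sheet of `q`. -/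
def localSection {S : Type*} [TopologicalSpace S] (ψ : S → Plane) (q : S) : Plane → S :=
  if h : ∃ s, IsLocalSection ψ q s then h.choose else fun _ => q

/-- The function `u` on the surface, written in the Cartesian coordinates of the sheet of `q`. -/
def onSheet {S : Type*} [TopologicalSpace S] (ψ : S → Plane) (u : S → ℂ) (q : S) : Plane → ℂ :=
  fun x => u (localSection ψ q x)

/-- The energy density `|∇u|² + |u|²` at a point of the surface. -/
def energyDensity {S : Type*} [TopologicalSpace S] (ψ : S → Plane) (u : S → ℂ) (q : S) : ENNReal :=
  ‖pderiv ℝ 0 (onSheet ψ u q) (ψ q)‖ₑ ^ 2 + ‖pderiv ℝ 1 (onSheet ψ u q) (ψ q)‖ₑ ^ 2 + ‖u q‖ₑ ^ 2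

/-- `u` obeys the Helmholtz equation on the surface: it is continuous, it is a classical solution on
the sheets away from the branch points, and it satisfies the Meixner condition (the energy over all
sheets near a branch point is finite). -/
structure ObeysHelmholtz {S : Type*} [TopologicalSpace S] (ψ : S → Plane) (P : Finset Plane)
    (k : ℂ) (u : S → ℂ) : Prop where
  continuous : Continuous u
  smooth : ∀ q, ψ q ∉ P → ContDiffAt ℝ 2 (onSheet ψ u q) (ψ q)
  equation : ∀ q, ψ q ∉ P → helmholtz ℝ k (onSheet ψ u q) (ψ q) = 0
  meixner : ∀ p ∈ P, ∃ ε > 0,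
    ∫⁻ x in ball p ε, ∑' q : ψ ⁻¹' {x}, energyDensity ψ u q < ⊤

/-! ### Contours -/

/-- A closed smooth oriented contour on the surface, parametrised by `[0, 1]` and not passing
through branch points. -/
structure IsContour {S : Type*} [TopologicalSpace S] (ψ : S → Plane) (P : Finset Plane)
    (g : ℝ → S) : Prop where
  continuousOn : ContinuousOn g (Icc 0 1)
  closed : g 0 = g 1
  avoids : ∀ t ∈ Icc (0 : ℝ) 1, ψ (g t) ∉ P
  smooth : ContDiffOn ℝ 1 (fun t => ψ (g t)) (Icc 0 1)

/-- The velocity of a plane curve parametrised by `[0, 1]`. -/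
def velocity (c : ℝ → Plane) (t : ℝ) : Plane := derivWithin c (Icc 0 1) t

/-- `n' dl' / dt`, where `n'` is the unit normal pointing to the right of the oriented curve. -/
def rightNormal (c : ℝ → Plane) (t : ℝ) : Plane := !₂[velocity c t 1, -velocity c t 0]

/-- The total angle swept by the vector from `a` to the point of the curve `c`. -/
def sweptAngle (c : ℝ → Plane) (a : Plane) : ℝ :=
  ∫ t in (0 : ℝ)..1,
    ((c t 0 - a 0) * velocity c t 1 - (c t 1 - a 1) * velocity c t 0) / ‖c t - a‖ ^ 2

/-- `γ` is a small loop around `A₀`: it lies in a neighbourhood of `A₀` which is contained in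
one sheet and projects onto a region `D` that is star-shaped about `A₀` and free of branch points,
and it goes around `A₀` once, anticlockwise. -/
structure IsSmallLoop {S : Type*} [TopologicalSpace S] (ψ : S → Plane) (P : Finset Plane)
    (A₀ : S) (γ : ℝ → S) : Prop where
  contour : IsContour ψ P γ
  one_sheet : ∃ (D : Set Plane) (s : Plane → S), IsOpen D ∧ StarConvex ℝ (ψ A₀) D ∧ ψ A₀ ∈ D ∧
    (∀ x ∈ D, x ∉ P) ∧ ContinuousOn s D ∧ (∀ x ∈ D, ψ (s x) = x) ∧ s (ψ A₀) = A₀ ∧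
    ∀ t ∈ Icc (0 : ℝ) 1, γ t ∈ s '' D
  avoids : ∀ t ∈ Icc (0 : ℝ) 1, ψ (γ t) ≠ ψ A₀
  anticlockwise : sweptAngle (fun t => ψ (γ t)) (ψ A₀) = 2 * Real.pi

/-! ### Associated real points -/

/-- The first real point associated with a point of `ℂ²`. -/
def realPoint₁ (r : C2) : Plane := !₂[(r 0).re - (r 1).im, (r 0).im + (r 1).re]

/-- The second real point associated with a point of `ℂ²`. -/
def realPoint₂ (r : C2) : Plane := !₂[(r 0).re + (r 1).im, (r 1).re - (r 0).im]

/-! ### The Hankel function and the Green's function -/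

/-- The Bessel function `J₀`. -/
def besselJ0 (z : ℂ) : ℂ := ∑' m : ℕ, (-1) ^ m * (z / 2) ^ (2 * m) / ((m.factorial : ℂ) ^ 2)

/-- The Bessel function `Y₀` on the Riemann surface of the logarithm, at the point with
logarithm `ζ`:
`Y₀(z) = (2/π) (log (z/2) + γ) J₀(z) - (2/π) ∑ₘ (-1)ᵐ (1 + 1/2 + ⋯ + 1/m) (z/2)²ᵐ / (m!)²`,
where `log z = ζ` and `γ` is Euler's constant. -/
def besselY0 (ζ : ℂ) : ℂ :=
  2 / (Real.pi : ℂ) * (ζ - (Real.log 2 : ℂ) + (Real.eulerMascheroniConstant : ℂ)) *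
      besselJ0 (Complex.exp ζ) -
    2 / (Real.pi : ℂ) *
      ∑' m : ℕ, (-1) ^ m * (harmonic m : ℂ) * (Complex.exp ζ / 2) ^ (2 * m) /
        ((m.factorial : ℂ) ^ 2)

/-- The Hankel function `H₀⁽¹⁾ = J₀ + i Y₀` on the Riemann surface of the logarithm, at the point
with logarithm `ζ`. Its main branch at `z` is the value at `ζ = Complex.log z`. -/
def hankelH0 (ζ : ℂ) : ℂ := besselJ0 (Complex.exp ζ) + Complex.I * besselY0 ζ

/-- `(x₁ - x₁')² + (x₂ - x₂')²` for complex `r = (x₁, x₂)` and real `x = (x₁', x₂')`. -/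
def sqDist (r : C2) (x : Plane) : ℂ := (r 0 - (x 0 : ℂ)) ^ 2 + (r 1 - (x 1 : ℂ)) ^ 2

/-- The value `-(i/4) H₀⁽¹⁾(k r)` of the Green's function, as a function of the logarithm
`ℓ = log r` of the (branched) distance. -/
def greenOfLog (k ℓ : ℂ) : ℂ := -(Complex.I / 4) * hankelH0 (Complex.log k + ℓ)

/-- `ℓ τ t` is a branch of the logarithm of the distance between `A τ` and `Γ τ t` which is
continuous in `(τ, t)` and is the usual real logarithm at `τ = 0`. It fixes the branches of the
square root and of the Hankel function: the usual ones at `τ = 0`, and then by continuity. -/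
structure IsLogDistBranch {S : Type*} (ψ : S → Plane) (A : ℝ → C2)
    (Γ : ℝ → ℝ → S) (ℓ : ℝ → ℝ → ℂ) : Prop where
  continuousOn : ContinuousOn (fun p : ℝ × ℝ => ℓ p.1 p.2) (Icc 0 1 ×ˢ Icc 0 1)
  exp_eq : ∀ τ ∈ Icc (0 : ℝ) 1, ∀ t ∈ Icc (0 : ℝ) 1,
    Complex.exp (2 * ℓ τ t) = sqDist (A τ) (ψ (Γ τ t))
  initial : ∀ t ∈ Icc (0 : ℝ) 1, ℓ 0 t = (Real.log ‖(A 0 - toC2 (ψ (Γ 0 t)))‖ : ℂ)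

/-- The branch `G(r, x)` of the Green's function for `r` near `r₀` and `x` near `x₀`, where `ℓ₀`
is the given logarithm of the distance between `r₀` and `x₀`. -/
def greenBranch (k : ℂ) (r₀ : C2) (x₀ : Plane) (ℓ₀ : ℂ) (r : C2) (x : Plane) : ℂ :=
  greenOfLog k (ℓ₀ + 1 / 2 * Complex.log (sqDist r x / sqDist r₀ x₀))

/-- The Green's integral `∫_{Γ(τ)} [∂G/∂n' (r, r') u(r') - ∂u/∂n' (r') G(r, r')] dl'`. -/
def greenIntegral {S : Type*} [TopologicalSpace S] (ψ : S → Plane) (k : ℂ) (u : S → ℂ)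
    (A : ℝ → C2) (Γ : ℝ → ℝ → S) (ℓ : ℝ → ℝ → ℂ) (τ : ℝ) (r : C2) : ℂ :=
  ∫ t in (0 : ℝ)..1,
    (fderiv ℝ (greenBranch k (A τ) (ψ (Γ τ t)) (ℓ τ t) r) (ψ (Γ τ t))
        (rightNormal (fun t' => ψ (Γ τ t')) t) * u (Γ τ t) -
      fderiv ℝ (onSheet ψ u (Γ τ t)) (ψ (Γ τ t)) (rightNormal (fun t' => ψ (Γ τ t')) t) *
        greenBranch k (A τ) (ψ (Γ τ t)) (ℓ τ t) r (ψ (Γ τ t)))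

/-- `f` is an analytic solution of the complex Helmholtz equation on the open set `V`. -/
def IsAnalyticSolution (k : ℂ) (f : C2 → ℂ) (V : Set C2) : Prop :=
  AnalyticOnNhd ℂ f V ∧ ∀ r ∈ V, helmholtz ℂ k f r = 0

end Sommerfeld

end

/-! Green's integral represents `u` inside a small loop, and it keeps its meaning for complex `r` as
long as the singularities of `G(r, ·)` stay off the contour. These are the real zeros of `(x₁ -
x₁')² + (x₂ - x₂')²`. The expression factors into two complex linear forms, each with exactly one
real zero, and the zeros are the associated real points (`eq_realPoint_of_sqDist_eq_zero`). So the
squared distance does not vanish on the parameter square and has a continuous logarithm there with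
the prescribed start (`exists_isLogDistBranch`). This logarithm carries all the multivaluedness: in
the variable `ζ = log z` the Hankel function is entire and Bessel's equation reads `H'' = -exp (2ζ)
H`.

For fixed `τ` the integrand is analytic in `r` with values in the Banach algebra of continuous
functions of `t`. Integration is a continuous functional on it, so the integral is analytic and
inherits the Helmholtz equation (`IsUniform.isAnalyticSolution`).

Since `G` and `u` solve the same equation, the form `(∂G/∂n U - ∂U/∂n G) dl` is closed. Contours
with close parameters are joined by short segments along which sheets and branches agree, so their
integrals are equal (`IsUniform.greenIntegral_congr`); compactness of the parameter square makes the
constants uniform (`exists_isUniform`). At `τ = 0` the branch is the real one and the loop contracts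
to a small circle about `x`, where the logarithmic singularity produces `u(x)`
(`exists_radius_representation`). On a simple path, points with distant parameters are a positive
distance apart, so small enough balls meet only when the comparison applies, and the pieces glue
(`exists_separation`, `exists_glued`). -/

noncomputable section

namespace Sommerfeld

/-! ### Power series in `exp (2ζ)` -/

/-- The sum of the power series with coefficients `c` at `exp (2ζ)`. -/
def expSeries (c : ℕ → ℂ) (ζ : ℂ) : ℂ := ∑' m, c m * Complex.exp (2 * ζ) ^ m

/-- The power series with coefficients `c` converges absolutely everywhere. -/
def EntireCoeff (c : ℕ → ℂ) : Prop := ∀ R : ℝ, 0 ≤ R → Summable fun m => ‖c m‖ * R ^ m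

/-- Differentiation in `ζ` multiplies the `m`-th coefficient by `2m`. Since `m ≤ 2 ^ m`, the factor
is absorbed by passing to the radius `2R`. -/
theorem EntireCoeff.natCast_mul {c : ℕ → ℂ} (hc : EntireCoeff c) :
    EntireCoeff fun m => 2 * m * c m := by
  intro R hR
  refine Summable.of_nonneg_of_le (fun m => by positivity) (fun m => ?_)
    ((hc (2 * R) (by positivity)).mul_left 2)
  have h : (m : ℝ) ≤ 2 ^ m := by exact_mod_cast m.lt_two_pow_self.le
  simp only [norm_mul, Complex.norm_ofNat, RCLike.norm_natCast, mul_pow]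
  have := mul_le_mul_of_nonneg_left h (show 0 ≤ 2 * ‖c m‖ * R ^ m by positivity)
  linarith

theorem EntireCoeff.summable {c : ℕ → ℂ} (hc : EntireCoeff c) (w : ℂ) :
    Summable fun m => c m * w ^ m :=
  Summable.of_norm (by simpa using hc ‖w‖ (norm_nonneg _))

theorem hasDerivAt_expSeries {c : ℕ → ℂ} (hc : EntireCoeff c) (ζ : ℂ) :
    HasDerivAt (expSeries c) (expSeries (fun m => 2 * m * c m) ζ) ζ := by
  have h2 := hc.natCast_mul
  -- On the unit ball about `ζ` the modulus `exp (2 Re z)` of `exp (2z)` stays below this constant,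
  -- so the differentiated series is uniformly dominated.
  set R : ℝ := Real.exp (2 * (ζ.re + 1))
  have key := hasDerivAt_tsum_of_isPreconnected (t := ball ζ 1) (y₀ := ζ) (y := ζ)
    (g := fun m z => c m * Complex.exp (2 * z) ^ m)
    (g' := fun m z => 2 * m * c m * Complex.exp (2 * z) ^ m)
    (h2 R (Real.exp_pos _).le) isOpen_ball (convex_ball ζ 1).isPreconnected ?_ ?_
    (mem_ball_self one_pos) (hc.summable _) (mem_ball_self one_pos)
  · exact key
  · intro m y _
    have h : HasDerivAt (fun z => Complex.exp (2 * z)) (Complex.exp (2 * y) * 2) y := by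
      simpa using ((hasDerivAt_id y).const_mul (2 : ℂ)).cexp
    refine ((h.fun_pow m).const_mul (c m)).congr_deriv ?_
    rcases m with _ | m
    · simp
    · simp only [Nat.add_sub_cancel, pow_succ]; ring
  · intro m y hy
    rw [norm_mul, norm_pow, Complex.norm_exp]
    gcongr
    have h : (y - ζ).re < 1 :=
      (Complex.re_le_norm _).trans_lt (by simpa [dist_eq_norm] using hy)
    simp only [Complex.sub_re] at h
    simp only [R, Complex.mul_re, Complex.re_ofNat, Complex.im_ofNat, zero_mul, sub_zero]
    gcongr
    linarith

/-! ### The Hankel function -/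

/-- The coefficients of `J₀`. -/
def coeffJ (m : ℕ) : ℂ := (-1) ^ m / 4 ^ m / (m.factorial : ℂ) ^ 2

/-- The coefficients of the entire part of `Y₀`. -/
def coeffY (m : ℕ) : ℂ := coeffJ m * (harmonic m : ℂ)

theorem entireCoeff_coeffJ : EntireCoeff coeffJ := by
  intro R hR
  refine Summable.of_nonneg_of_le (fun m => by positivity) (fun m => ?_)
    (Real.summable_pow_div_factorial R)
  have h1 : (1 : ℝ) ≤ 4 ^ m := one_le_pow₀ (by norm_num)
  have h2 : (1 : ℝ) ≤ m.factorial := by exact_mod_cast m.factorial_pos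
  simp only [coeffJ, norm_div, norm_pow, norm_neg, norm_one, one_pow, Complex.norm_ofNat,
    RCLike.norm_natCast]
  rw [div_div, div_mul_eq_mul_div, one_mul]
  gcongr
  nlinarith

theorem harmonic_le_natCast (m : ℕ) : harmonic m ≤ m := by
  induction m with
  | zero => simp
  | succ m ih =>
    rw [harmonic_succ]
    have : ((m : ℚ) + 1)⁻¹ ≤ 1 := inv_le_one_of_one_le₀ (by simp)
    push_cast
    linarith

theorem entireCoeff_coeffY : EntireCoeff coeffY := by
  intro R hR
  refine Summable.of_nonneg_of_le (fun m => by positivity) (fun m => ?_)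
    (entireCoeff_coeffJ.natCast_mul R hR)
  gcongr
  rw [coeffY, mul_comm (coeffJ m), norm_mul, norm_mul]
  gcongr
  have h0 : (0 : ℚ) ≤ harmonic m := Finset.sum_nonneg fun i _ => by positivity
  have h : (harmonic m : ℝ) ≤ m := by exact_mod_cast harmonic_le_natCast m
  have h0' : (0 : ℝ) ≤ (harmonic m : ℝ) := by exact_mod_cast h0
  have e : ‖(harmonic m : ℂ)‖ = (harmonic m : ℝ) := by
    rw [← Complex.ofReal_ratCast, Complex.norm_of_nonneg h0']
  rw [e]
  simp only [norm_mul, Complex.norm_ofNat, RCLike.norm_natCast]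
  linarith [Nat.cast_nonneg (α := ℝ) m]

/-- As `d/dζ` acts on coefficients by `2m`, this recursion is Bessel's equation `J'' = -exp (2ζ) J`.
-/
theorem coeffJ_succ (m : ℕ) : (2 * ((m : ℂ) + 1)) ^ 2 * coeffJ (m + 1) = -coeffJ m := by
  have h : (m : ℂ) + 1 ≠ 0 := Nat.cast_add_one_ne_zero m
  have h' : (m.factorial : ℂ) ≠ 0 := by exact_mod_cast m.factorial_ne_zero
  simp only [coeffJ, Nat.factorial_succ, pow_succ]
  push_cast
  field_simp
  ring

theorem besselJ0_exp (ζ : ℂ) : besselJ0 (Complex.exp ζ) = expSeries coeffJ ζ := by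
  refine tsum_congr fun m => ?_
  have h' : (m.factorial : ℂ) ≠ 0 := by exact_mod_cast m.factorial_ne_zero
  rw [two_mul ζ, Complex.exp_add, coeffJ, pow_mul, div_pow, div_pow, ← sq]
  norm_num
  field_simp

/-- The logarithm of half the argument plus Euler's constant. -/
def shiftedLog (ζ : ℂ) : ℂ := ζ - (Real.log 2 : ℂ) + (Real.eulerMascheroniConstant : ℂ)

theorem besselY0_eq (ζ : ℂ) : besselY0 ζ =
    2 / (Real.pi : ℂ) * (shiftedLog ζ * expSeries coeffJ ζ - expSeries coeffY ζ) := by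
  have : ∑' m : ℕ, (-1) ^ m * (harmonic m : ℂ) * (Complex.exp ζ / 2) ^ (2 * m) /
        ((m.factorial : ℂ) ^ 2) = expSeries coeffY ζ := by
    refine tsum_congr fun m => ?_
    have h' : (m.factorial : ℂ) ≠ 0 := by exact_mod_cast m.factorial_ne_zero
    rw [two_mul ζ, Complex.exp_add, coeffY, coeffJ, pow_mul, div_pow, div_pow, ← sq]
    norm_num
    field_simp
  rw [besselY0, this, besselJ0_exp, shiftedLog]
  ring

/-- The derivative of `hankelH0`. -/
def hankelDeriv (ζ : ℂ) : ℂ :=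
  expSeries (fun m => 2 * m * coeffJ m) ζ + Complex.I * (2 / (Real.pi : ℂ) *
    (expSeries coeffJ ζ + shiftedLog ζ * expSeries (fun m => 2 * m * coeffJ m) ζ -
      expSeries (fun m => 2 * m * coeffY m) ζ))

theorem hasDerivAt_shiftedLog (ζ : ℂ) : HasDerivAt shiftedLog 1 ζ :=
  ((hasDerivAt_id ζ).sub_const _).add_const _

theorem hankelH0_eq : hankelH0 = fun ζ => expSeries coeffJ ζ + Complex.I * (2 / (Real.pi : ℂ) *
    (shiftedLog ζ * expSeries coeffJ ζ - expSeries coeffY ζ)) := by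
  funext ζ
  rw [hankelH0, besselY0_eq, besselJ0_exp]

theorem hasDerivAt_hankelH0 (ζ : ℂ) : HasDerivAt hankelH0 (hankelDeriv ζ) ζ := by
  have hJ := hasDerivAt_expSeries entireCoeff_coeffJ ζ
  have hY := hasDerivAt_expSeries entireCoeff_coeffY ζ
  rw [hankelH0_eq]
  refine (hJ.add (((((hasDerivAt_shiftedLog ζ).mul hJ).sub hY).const_mul _).const_mul
    _)).congr_deriv ?_
  simp only [hankelDeriv]
  ring

theorem expSeries_two_two_coeffJ (ζ : ℂ) :
    expSeries (fun m => 2 * m * (2 * m * coeffJ m)) ζ =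
      -Complex.exp (2 * ζ) * expSeries coeffJ ζ := by
  have h := entireCoeff_coeffJ.natCast_mul.natCast_mul.summable (Complex.exp (2 * ζ))
  rw [expSeries, h.tsum_eq_zero_add, expSeries, ← tsum_mul_left]
  simp only [CharP.cast_eq_zero, mul_zero, zero_mul, pow_zero, zero_add]
  refine tsum_congr fun m => ?_
  have := coeffJ_succ m
  push_cast
  linear_combination Complex.exp (2 * ζ) ^ (m + 1) * this

/-- The increment `1/(m+1)` of the harmonic number adds the term `2J'`. The second derivative of
`shiftedLog * J` has the same extra term, and the two cancel in `hankelH0`. -/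
theorem expSeries_two_two_coeffY (ζ : ℂ) :
    expSeries (fun m => 2 * m * (2 * m * coeffY m)) ζ =
      -Complex.exp (2 * ζ) * expSeries coeffY ζ + 2 * expSeries (fun m => 2 * m * coeffJ m) ζ := by
  have h := entireCoeff_coeffY.natCast_mul.natCast_mul.summable (Complex.exp (2 * ζ))
  have h1 := entireCoeff_coeffJ.natCast_mul.summable (Complex.exp (2 * ζ))
  have h2 := entireCoeff_coeffY.summable (Complex.exp (2 * ζ))
  have h1' := (summable_nat_add_iff 1).2 h1
  rw [expSeries, h.tsum_eq_zero_add, expSeries, expSeries, h1.tsum_eq_zero_add]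
  simp only [CharP.cast_eq_zero, mul_zero, zero_mul, pow_zero, zero_add]
  rw [← tsum_mul_left, ← tsum_mul_left, ← (h2.mul_left _).tsum_add (h1'.mul_left 2)]
  refine tsum_congr fun m => ?_
  have := coeffJ_succ m
  have hm : (m : ℂ) + 1 ≠ 0 := Nat.cast_add_one_ne_zero m
  simp only [coeffY, harmonic_succ]
  push_cast
  rw [show -Complex.exp (2 * ζ) * (coeffJ m * (harmonic m : ℂ) * Complex.exp (2 * ζ) ^ m) =
    -coeffJ m * ((harmonic m : ℂ) * Complex.exp (2 * ζ) ^ (m + 1)) by ring, ← this]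
  field_simp

/-- Bessel's equation in the logarithmic variable. -/
theorem hasDerivAt_hankelDeriv (ζ : ℂ) :
    HasDerivAt hankelDeriv (-Complex.exp (2 * ζ) * hankelH0 ζ) ζ := by
  have hJ := hasDerivAt_expSeries entireCoeff_coeffJ ζ
  have hJ' := hasDerivAt_expSeries entireCoeff_coeffJ.natCast_mul ζ
  have hY' := hasDerivAt_expSeries entireCoeff_coeffY.natCast_mul ζ
  rw [expSeries_two_two_coeffJ] at hJ'
  rw [expSeries_two_two_coeffY] at hY'
  unfold hankelDeriv
  refine (hJ'.add ((((hJ.add ((hasDerivAt_shiftedLog ζ).mul hJ')).sub hY').const_mul _).const_mul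
    _)).congr_deriv ?_
  rw [hankelH0_eq]
  ring

/-! ### The Green's function in the logarithmic variable -/

/-- The derivative of `greenOfLog`. -/
def greenDeriv (k ℓ : ℂ) : ℂ := -(Complex.I / 4) * hankelDeriv (Complex.log k + ℓ)

theorem hasDerivAt_greenOfLog (k ℓ : ℂ) : HasDerivAt (greenOfLog k) (greenDeriv k ℓ) ℓ :=
  ((hasDerivAt_hankelH0 _).comp_const_add _ _).const_mul _

theorem hasDerivAt_greenDeriv {k : ℂ} (hk : k ≠ 0) (ℓ : ℂ) :
    HasDerivAt (greenDeriv k) (-k ^ 2 * Complex.exp (2 * ℓ) * greenOfLog k ℓ) ℓ := by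
  refine (((hasDerivAt_hankelDeriv _).comp_const_add _ _).const_mul _).congr_deriv ?_
  rw [greenOfLog, mul_add, Complex.exp_add, two_mul (Complex.log k), Complex.exp_add,
    Complex.exp_log hk]
  ring

theorem differentiable_greenOfLog (k : ℂ) : Differentiable ℂ (greenOfLog k) :=
  fun ℓ => (hasDerivAt_greenOfLog k ℓ).differentiableAt

theorem differentiable_greenDeriv {k : ℂ} (hk : k ≠ 0) : Differentiable ℂ (greenDeriv k) :=
  fun ℓ => (hasDerivAt_greenDeriv hk ℓ).differentiableAt

/-- Controls the Green's function near its source, where `Re ζ → -∞`: apart from the constant term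
the series is of the order of the squared distance, which outweighs a logarithmic factor. -/
theorem norm_expSeries_sub_le {c : ℕ → ℂ} (hc : EntireCoeff c) :
    ∃ C, ∀ ζ : ℂ, ‖Complex.exp (2 * ζ)‖ ≤ 1 →
      ‖expSeries c ζ - c 0‖ ≤ C * ‖Complex.exp (2 * ζ)‖ := by
  have h1 : Summable fun m => ‖c (m + 1)‖ := by
    simpa using (summable_nat_add_iff 1).2 (hc 1 zero_le_one)
  refine ⟨∑' m, ‖c (m + 1)‖, fun ζ hζ => ?_⟩
  set w := Complex.exp (2 * ζ)
  have hb : ∀ m, ‖c (m + 1) * w ^ m‖ ≤ ‖c (m + 1)‖ := fun m => by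
    rw [norm_mul, norm_pow]
    exact mul_le_of_le_one_right (norm_nonneg _) (pow_le_one₀ (norm_nonneg _) hζ)
  have e : expSeries c ζ - c 0 = (∑' m, c (m + 1) * w ^ m) * w := by
    rw [expSeries, (hc.summable _).tsum_eq_zero_add, ← tsum_mul_right]
    simp only [pow_zero, mul_one, add_sub_cancel_left, pow_succ, mul_assoc]
    rfl
  rw [e, norm_mul]
  gcongr
  exact tsum_of_norm_bounded h1.hasSum hb

theorem norm_exp_two_mul_add_log (z : ℂ) {ρ : ℝ} (hρ : 0 < ρ) :
    ‖Complex.exp (2 * (z + (Real.log ρ : ℂ)))‖ = Real.exp (2 * z.re) * ρ * ρ := by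
  rw [mul_add, Complex.exp_add, norm_mul, two_mul (Real.log ρ : ℂ), Complex.exp_add,
    ← Complex.ofReal_exp, Real.exp_log hρ, Complex.norm_exp, norm_mul,
    Complex.norm_of_nonneg hρ.le]
  simp [mul_assoc]

theorem tendsto_ofReal_nhdsGT_zero : Tendsto (fun ρ : ℝ => (ρ : ℂ)) (𝓝[>] 0) (𝓝 0) := by
  simpa using (Complex.continuous_ofReal.tendsto 0).mono_left nhdsWithin_le_nhds

theorem tendsto_expSeries_sub_div (z : ℂ) {c : ℕ → ℂ} (hc : EntireCoeff c) :
    Tendsto (fun ρ : ℝ => (expSeries c (z + (Real.log ρ : ℂ)) - c 0) / ρ) (𝓝[>] 0) (𝓝 0) := by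
  obtain ⟨C, hC⟩ := norm_expSeries_sub_le hc
  have hid : Tendsto (fun ρ : ℝ => ρ) (𝓝[>] 0) (𝓝 0) := nhdsWithin_le_nhds
  have h0 : Tendsto (fun ρ : ℝ => Real.exp (2 * z.re) * ρ * ρ) (𝓝[>] 0) (𝓝 0) := by
    simpa using (hid.const_mul (Real.exp (2 * z.re))).mul hid
  have h1 : Tendsto (fun ρ : ℝ => C * Real.exp (2 * z.re) * ρ) (𝓝[>] 0) (𝓝 0) := by
    simpa using hid.const_mul (C * Real.exp (2 * z.re))
  refine squeeze_zero_norm' ?_ h1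
  filter_upwards [h0.eventually_le_const one_pos, self_mem_nhdsWithin] with ρ h hρ
  have hρ : 0 < ρ := hρ
  rw [norm_div, Complex.norm_of_nonneg hρ.le, div_le_iff₀ hρ]
  have := hC (z + (Real.log ρ : ℂ)) (by rwa [norm_exp_two_mul_add_log z hρ])
  rw [norm_exp_two_mul_add_log z hρ] at this
  linarith

theorem tendsto_expSeries_log (z : ℂ) {c : ℕ → ℂ} (hc : EntireCoeff c) :
    Tendsto (fun ρ : ℝ => expSeries c (z + (Real.log ρ : ℂ))) (𝓝[>] 0) (𝓝 (c 0)) := by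
  have h := ((tendsto_expSeries_sub_div z hc).mul tendsto_ofReal_nhdsGT_zero).add_const (c 0)
  rw [zero_mul, zero_add] at h
  refine h.congr' ?_
  filter_upwards [self_mem_nhdsWithin] with ρ hρ
  have hρ : (ρ : ℂ) ≠ 0 := by exact_mod_cast (ne_of_gt hρ)
  field_simp
  ring

theorem tendsto_mul_shiftedLog (z : ℂ) :
    Tendsto (fun ρ : ℝ => (ρ : ℂ) * shiftedLog (z + (Real.log ρ : ℂ))) (𝓝[>] 0) (𝓝 0) := by
  have h1 : Tendsto (fun ρ : ℝ => ((Real.log ρ * ρ : ℝ) : ℂ)) (𝓝[>] 0) (𝓝 0) := by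
    have h : Tendsto (fun ρ : ℝ => Real.log ρ * ρ) (𝓝[>] 0) (𝓝 0) := by
      simpa using tendsto_log_mul_rpow_nhdsGT_zero one_pos
    exact (Complex.continuous_ofReal.tendsto' 0 0 (by simp)).comp h
  have h2 := h1.add (tendsto_ofReal_nhdsGT_zero.mul_const (shiftedLog z))
  rw [zero_mul, zero_add] at h2
  refine h2.congr fun ρ => ?_
  simp only [shiftedLog, Complex.ofReal_mul]
  ring

theorem tendsto_mul_greenOfLog (k : ℂ) :
    Tendsto (fun ρ : ℝ => (ρ : ℂ) * greenOfLog k (Real.log ρ : ℂ)) (𝓝[>] 0) (𝓝 0) := by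
  have hJ := tendsto_expSeries_log (Complex.log k) entireCoeff_coeffJ
  have hY := tendsto_expSeries_log (Complex.log k) entireCoeff_coeffY
  have hρ := tendsto_ofReal_nhdsGT_zero
  have h := ((hρ.mul hJ).add ((((tendsto_mul_shiftedLog (Complex.log k)).mul hJ).sub
    (hρ.mul hY)).const_mul (Complex.I * (2 / (Real.pi : ℂ))))).const_mul (-(Complex.I / 4))
  simp only [zero_mul, sub_zero, mul_zero, add_zero] at h
  refine h.congr fun ρ => ?_
  rw [greenOfLog, hankelH0_eq]
  ring

/-- Here `d/dℓ = ρ d/dρ`, so the limit is the strength of the logarithmic singularity; the only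
surviving contribution is `-(i/4) · i · (2/π) · J₀(0)`. The logarithm times the differentiated
series is split as `(ρ log) (series / ρ)`, where both factors tend to zero. -/
theorem tendsto_greenDeriv (k : ℂ) :
    Tendsto (fun ρ : ℝ => greenDeriv k (Real.log ρ : ℂ)) (𝓝[>] 0)
      (𝓝 (1 / (2 * (Real.pi : ℂ)))) := by
  have hJ := tendsto_expSeries_log (Complex.log k) entireCoeff_coeffJ
  have hJ' := tendsto_expSeries_log (Complex.log k) entireCoeff_coeffJ.natCast_mul
  have hJ'' := tendsto_expSeries_sub_div (Complex.log k) entireCoeff_coeffJ.natCast_mul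
  have hY' := tendsto_expSeries_log (Complex.log k) entireCoeff_coeffY.natCast_mul
  have h := (hJ'.add (((hJ.add ((tendsto_mul_shiftedLog (Complex.log k)).mul hJ'')).sub
    hY').const_mul (Complex.I * (2 / (Real.pi : ℂ))))).const_mul (-(Complex.I / 4))
  have e : -(Complex.I / 4) * (2 * ((0 : ℕ) : ℂ) * coeffJ 0 + Complex.I * (2 / (Real.pi : ℂ)) *
      (coeffJ 0 + 0 * 0 - 2 * ((0 : ℕ) : ℂ) * coeffY 0)) = 1 / (2 * (Real.pi : ℂ)) := by
    have hpi : (Real.pi : ℂ) ≠ 0 := by exact_mod_cast Real.pi_ne_zero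
    simp [coeffJ]
    field_simp
    linear_combination (-4 : ℂ) * Complex.I_sq
  rw [e] at h
  refine h.congr' ?_
  filter_upwards [self_mem_nhdsWithin] with ρ hρ
  have hρ : (ρ : ℂ) ≠ 0 := by exact_mod_cast (ne_of_gt hρ)
  simp only [greenDeriv, hankelDeriv, CharP.cast_eq_zero, mul_zero, zero_mul, sub_zero]
  field_simp

/-! ### The Green's function as a function of the difference of its arguments -/

/-- `v₁² + v₂²`. -/
def sqNorm (v : C2) : ℂ := v 0 ^ 2 + v 1 ^ 2

/-- The coordinate functionals of `ℂ²`. -/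
def coord (i : Fin 2) : C2 →L[ℂ] ℂ := EuclideanSpace.proj i

@[simp] theorem coord_apply (i : Fin 2) (v : C2) : coord i v = v i := rfl

/-- The bilinear form `v₁ w₁ + v₂ w₂` as a functional of `w`. -/
def dotL (v : C2) : C2 →L[ℂ] ℂ :=
  v 0 • coord 0 + v 1 • coord 1

theorem dotL_apply (v w : C2) : dotL v w = v 0 * w 0 + v 1 * w 1 := by simp [dotL]

/-- The inclusion `ℝ² ⊂ ℂ²` as a real-linear map. -/
def toC2L : Plane →L[ℝ] C2 :=
  LinearMap.toContinuousLinearMap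
    { toFun := toC2
      map_add' := fun x y => by ext i; fin_cases i <;> simp [toC2]
      map_smul' := fun c x => by ext i; fin_cases i <;> simp [toC2] }

@[simp] theorem toC2L_apply (x : Plane) : toC2L x = toC2 x := rfl

theorem toC2_single (i : Fin 2) :
    toC2 (EuclideanSpace.single i 1) = EuclideanSpace.single i 1 := by
  ext j; fin_cases i <;> fin_cases j <;> simp [toC2]

theorem sqDist_eq (r : C2) (x : Plane) : sqDist r x = sqNorm (r - toC2 x) := by
  simp [sqDist, sqNorm, toC2]

/-- A logarithm of the distance, as a function of the difference vector. -/
def logDist (ℓ₀ Q₀ : ℂ) (v : C2) : ℂ := ℓ₀ + 1 / 2 * Complex.log (sqNorm v / Q₀)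

/-- The branch of the Green's function with a given logarithm of the distance. -/
def kern (k ℓ₀ Q₀ : ℂ) (v : C2) : ℂ := greenOfLog k (logDist ℓ₀ Q₀ v)

theorem greenBranch_eq (k : ℂ) (r₀ : C2) (x₀ : Plane) (ℓ₀ : ℂ) (r : C2) (x : Plane) :
    greenBranch k r₀ x₀ ℓ₀ r x = kern k ℓ₀ (sqDist r₀ x₀) (r - toC2 x) := by
  rw [greenBranch, kern, logDist, sqDist_eq r x]

theorem hasFDerivAt_sqNorm (v : C2) : HasFDerivAt sqNorm (2 • dotL v) v := by
  have h (i : Fin 2) : HasFDerivAt (fun w : C2 => w i ^ 2)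
      ((2 * v i) • coord i) v := by
    simpa using (coord i).hasFDerivAt.pow 2
  refine ((h 0).add (h 1)).congr_fderiv ?_
  ext w
  simp [dotL_apply]
  ring

variable {k ℓ₀ Q₀ : ℂ} {v : C2}

theorem sqNorm_ne_zero (hv : sqNorm v / Q₀ ∈ Complex.slitPlane) : sqNorm v ≠ 0 ∧ Q₀ ≠ 0 :=
  div_ne_zero_iff.1 (Complex.slitPlane_ne_zero hv)

theorem hasFDerivAt_logDist (hv : sqNorm v / Q₀ ∈ Complex.slitPlane) :
    HasFDerivAt (logDist ℓ₀ Q₀) ((1 / sqNorm v) • dotL v) v := by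
  obtain ⟨h1, h2⟩ := sqNorm_ne_zero hv
  have h := ((((hasFDerivAt_sqNorm v).mul_const Q₀⁻¹).clog
    (by simpa [div_eq_mul_inv] using hv)).const_mul (1 / 2)).const_add ℓ₀
  simp only [← div_eq_mul_inv] at h
  refine h.congr_fderiv ?_
  ext w
  simp [dotL_apply]
  field_simp

theorem hasFDerivAt_kern (hv : sqNorm v / Q₀ ∈ Complex.slitPlane) :
    HasFDerivAt (kern k ℓ₀ Q₀) ((greenDeriv k (logDist ℓ₀ Q₀ v) / sqNorm v) • dotL v) v := by
  refine ((hasDerivAt_greenOfLog k _).comp_hasFDerivAt v (hasFDerivAt_logDist hv)).congr_fderiv ?_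
  rw [smul_smul, mul_one_div]

theorem continuous_sqNorm : Continuous sqNorm := by unfold sqNorm; fun_prop

theorem eventually_slitPlane (hv : sqNorm v / Q₀ ∈ Complex.slitPlane) :
    ∀ᶠ w in 𝓝 v, sqNorm w / Q₀ ∈ Complex.slitPlane :=
  (continuous_sqNorm.div_const Q₀).continuousAt.eventually
    (Complex.isOpen_slitPlane.mem_nhds hv)

theorem analyticAt_apply (i : Fin 2) (v : C2) : AnalyticAt ℂ (fun w : C2 => w i) v :=
  (coord i).analyticAt v

theorem analyticAt_kern (hv : sqNorm v / Q₀ ∈ Complex.slitPlane) :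
    AnalyticAt ℂ (kern k ℓ₀ Q₀) v := by
  have hs : AnalyticAt ℂ sqNorm v :=
    ((analyticAt_apply 0 v).pow 2).add ((analyticAt_apply 1 v).pow 2)
  have hl : AnalyticAt ℂ (logDist ℓ₀ Q₀) v :=
    analyticAt_const.add (analyticAt_const.mul (hs.div_const.clog hv))
  exact ((differentiable_greenOfLog k).analyticAt _).comp hl

theorem exp_logDist (h0 : Complex.exp (2 * ℓ₀) = Q₀)
    (hv : sqNorm v / Q₀ ∈ Complex.slitPlane) :
    Complex.exp (2 * logDist ℓ₀ Q₀ v) = sqNorm v := by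
  obtain ⟨h1, h2⟩ := sqNorm_ne_zero hv
  rw [logDist, mul_add, Complex.exp_add, h0, ← mul_assoc, mul_one_div_cancel two_ne_zero, one_mul,
    Complex.exp_log (div_ne_zero h1 h2)]
  field_simp

theorem pderiv_kern (i : Fin 2) (hv : sqNorm v / Q₀ ∈ Complex.slitPlane) :
    pderiv ℂ i (kern k ℓ₀ Q₀) v = greenDeriv k (logDist ℓ₀ Q₀ v) * (v i / sqNorm v) := by
  rw [pderiv, (hasFDerivAt_kern hv).fderiv]
  fin_cases i <;> simp [dotL_apply] <;> ring

theorem pderiv_pderiv_kern (hk : k ≠ 0) (h0 : Complex.exp (2 * ℓ₀) = Q₀) (i : Fin 2)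
    (hv : sqNorm v / Q₀ ∈ Complex.slitPlane) :
    pderiv ℂ i (pderiv ℂ i (kern k ℓ₀ Q₀)) v =
      -k ^ 2 * sqNorm v * kern k ℓ₀ Q₀ v * (v i / sqNorm v) ^ 2 +
        greenDeriv k (logDist ℓ₀ Q₀ v) * (1 / sqNorm v - 2 * (v i / sqNorm v) ^ 2) := by
  obtain ⟨h1, h2⟩ := sqNorm_ne_zero hv
  have e : pderiv ℂ i (kern k ℓ₀ Q₀) =ᶠ[𝓝 v]
      fun w => greenDeriv k (logDist ℓ₀ Q₀ w) * (w i * (sqNorm w)⁻¹) := by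
    filter_upwards [eventually_slitPlane hv] with w hw
    rw [pderiv_kern i hw, div_eq_mul_inv]
  have hp : HasFDerivAt (fun w : C2 => w i)
      (coord i) v :=
    (coord i).hasFDerivAt
  have hinv := (hasDerivAt_inv h1).comp_hasFDerivAt v (hasFDerivAt_sqNorm v)
  have hg := (hasDerivAt_greenDeriv hk _).comp_hasFDerivAt v
    (hasFDerivAt_logDist (ℓ₀ := ℓ₀) hv)
  have h := hg.mul (hp.mul hinv)
  rw [exp_logDist h0 hv] at h
  rw [pderiv, e.fderiv_eq]
  erw [h.fderiv]
  have hd : dotL v (EuclideanSpace.single i 1) = v i := by fin_cases i <;> simp [dotL_apply]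
  simp [hd, kern]
  field_simp
  ring

/-- In the sum over `i` the squares `vᵢ²` add up to `sqNorm v`. The `greenDeriv` terms then cancel,
because the logarithm of the distance is harmonic in two dimensions, and Bessel's equation leaves
`-k² G`. -/
theorem helmholtz_kern (hk : k ≠ 0) (h0 : Complex.exp (2 * ℓ₀) = Q₀)
    (hv : sqNorm v / Q₀ ∈ Complex.slitPlane) : helmholtz ℂ k (kern k ℓ₀ Q₀) v = 0 := by
  obtain ⟨h1, h2⟩ := sqNorm_ne_zero hv
  rw [helmholtz, pderiv_pderiv_kern hk h0 0 hv, pderiv_pderiv_kern hk h0 1 hv]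
  have e : v 0 ^ 2 + v 1 ^ 2 = sqNorm v := rfl
  field_simp
  linear_combination (-k ^ 2 * kern k ℓ₀ Q₀ v * sqNorm v -
    2 * greenDeriv k (logDist ℓ₀ Q₀ v)) * e

/-! ### Directional derivatives commute with the Helmholtz operator -/

theorem fderiv_fderiv_apply_comm {f : C2 → ℂ} (hf : AnalyticAt ℂ f v) (m n : C2) :
    fderiv ℂ (fun w => fderiv ℂ f w m) v n = fderiv ℂ (fun w => fderiv ℂ f w n) v m := by
  have hd : DifferentiableAt ℂ (fderiv ℂ f) v := hf.fderiv.differentiableAt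
  have h (m n : C2) : fderiv ℂ (fun w => fderiv ℂ f w m) v n = fderiv ℂ (fderiv ℂ f) v n m := by
    rw [fderiv_clm_apply hd (differentiableAt_const m)]
    simp
  rw [h, h, (hf.contDiffAt (n := 2)).isSymmSndFDerivAt (by simp) n m]

theorem _root_.AnalyticAt.fderiv_apply {f : C2 → ℂ} (hf : AnalyticAt ℂ f v) (n : C2) :
    AnalyticAt ℂ (fun w => fderiv ℂ f w n) v :=
  (ContinuousLinearMap.apply ℂ ℂ n).analyticAt _ |>.comp hf.fderiv

theorem pderiv_pderiv_fderiv {f : C2 → ℂ} (hf : AnalyticAt ℂ f v) (i : Fin 2) (n : C2) :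
    pderiv ℂ i (pderiv ℂ i fun w => fderiv ℂ f w n) v =
      fderiv ℂ (pderiv ℂ i (pderiv ℂ i f)) v n := by
  have e1 : pderiv ℂ i (fun w => fderiv ℂ f w n) =ᶠ[𝓝 v]
      fun w => fderiv ℂ (pderiv ℂ i f) w n := by
    filter_upwards [hf.eventually_analyticAt] with w hw
    exact fderiv_fderiv_apply_comm hw n _
  rw [pderiv, e1.fderiv_eq]
  exact fderiv_fderiv_apply_comm (hf.fderiv_apply _) n _

/-- Needed for the part `∂G/∂n'` of the integrand: an operator with constant coefficients commutes
with directional derivatives. -/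
theorem helmholtz_fderiv_eq_zero {f : C2 → ℂ} (hf : AnalyticAt ℂ f v)
    (h : ∀ᶠ w in 𝓝 v, helmholtz ℂ k f w = 0) (n : C2) :
    helmholtz ℂ k (fun w => fderiv ℂ f w n) v = 0 := by
  have hz : fderiv ℂ (helmholtz ℂ k f) v n = 0 := by
    rw [Filter.EventuallyEq.fderiv_eq (f₁ := helmholtz ℂ k f) (f := fun _ => (0 : ℂ)) h]
    simp
  have hd (i : Fin 2) : DifferentiableAt ℂ (pderiv ℂ i (pderiv ℂ i f)) v :=
    ((hf.fderiv_apply _).fderiv_apply _).differentiableAt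
  unfold helmholtz at hz ⊢
  rw [pderiv_pderiv_fderiv hf, pderiv_pderiv_fderiv hf, ← hz]
  erw [(((hd 0).hasFDerivAt.add (hd 1).hasFDerivAt).add
    (hf.differentiableAt.hasFDerivAt.const_mul (k ^ 2))).fderiv]
  simp

/-! ### Restriction to real points -/

theorem hasFDerivAt_sub_toC2 {f : C2 → ℂ} {r : C2} {x : Plane}
    (hf : DifferentiableAt ℂ f (r - toC2 x)) :
    HasFDerivAt (fun y => f (r - toC2 y))
      (-((fderiv ℂ f (r - toC2 x)).restrictScalars ℝ ∘L toC2L)) x := by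
  have h1 : HasFDerivAt (fun y => r - toC2 y) (-toC2L) x := toC2L.hasFDerivAt.const_sub r
  refine ((hf.hasFDerivAt.restrictScalars ℝ).comp x h1).congr_fderiv ?_
  ext w
  simp

theorem continuous_sub_toC2 (r : C2) : Continuous fun x => r - toC2 x :=
  continuous_const.sub toC2L.continuous

theorem pderiv_sub_toC2 {f : C2 → ℂ} {r : C2} {x : Plane} (i : Fin 2)
    (hf : DifferentiableAt ℂ f (r - toC2 x)) :
    pderiv ℝ i (fun y => f (r - toC2 y)) x = -pderiv ℂ i f (r - toC2 x) := by
  rw [pderiv, (hasFDerivAt_sub_toC2 hf).fderiv]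
  simp [pderiv, toC2_single]

/-- Each derivative in the source variable contributes a sign, and two signs cancel. Hence `G`
solves the real Helmholtz equation in `r'`, which is what makes Green's form closed. -/
theorem helmholtz_sub_toC2 {f : C2 → ℂ} {r : C2} {x : Plane}
    (hf : AnalyticAt ℂ f (r - toC2 x)) :
    helmholtz ℝ k (fun y => f (r - toC2 y)) x = helmholtz ℂ k f (r - toC2 x) := by
  have h2 (i : Fin 2) : pderiv ℝ i (pderiv ℝ i fun y => f (r - toC2 y)) x =
      pderiv ℂ i (pderiv ℂ i f) (r - toC2 x) := by
    have e : pderiv ℝ i (fun y => f (r - toC2 y)) =ᶠ[𝓝 x]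
        fun y => -pderiv ℂ i f (r - toC2 y) := by
      filter_upwards [(continuous_sub_toC2 r).continuousAt.eventually
        hf.eventually_analyticAt] with y hy
      exact pderiv_sub_toC2 i hy.differentiableAt
    rw [pderiv, e.fderiv_eq, fderiv_fun_neg]
    have := pderiv_sub_toC2 i (hf.fderiv_apply (EuclideanSpace.single i 1)).differentiableAt
    simp only [pderiv] at this ⊢
    simp only [_root_.neg_apply, this, neg_neg]
    rfl
  simp only [helmholtz, h2]

theorem contDiffAt_sub_toC2 {f : C2 → ℂ} {r : C2} {x : Plane}
    (hf : AnalyticAt ℂ f (r - toC2 x)) : ContDiffAt ℝ 2 (fun y => f (r - toC2 y)) x :=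
  ((hf.contDiffAt (n := 2)).restrict_scalars ℝ).comp x
    (contDiffAt_const.sub toC2L.contDiff.contDiffAt)

/-! ### Superposition operators on spaces of continuous functions -/

section Superposition

variable {X : Type*} [TopologicalSpace X] [CompactSpace X]

theorem _root_.AnalyticAt.iteratedDeriv_apply {Φ : ℂ → ℂ} {z : ℂ} (h : AnalyticAt ℂ Φ z) (n : ℕ) :
    AnalyticAt ℂ (iteratedDeriv n Φ) z := by
  rw [iteratedDeriv_eq_iterate]
  exact h.iterated_deriv n

/-- Composition with a holomorphic function is analytic on the algebra of continuous functions. -/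
theorem exists_analyticAt_superposition {Φ : ℂ → ℂ} (f₀ : C(X, ℂ))
    (hΦ : ∀ x, AnalyticAt ℂ Φ (f₀ x)) :
    ∃ N : C(X, ℂ) → C(X, ℂ), AnalyticAt ℂ N f₀ ∧ ∀ᶠ f in 𝓝 f₀, ∀ x, N f x = Φ (f x) := by
  -- Compactness of the range gives one radius around all values of `f₀`.
  obtain ⟨δ, hδ, hK⟩ := (isCompact_range f₀.continuous).exists_cthickening_subset_open
    (isOpen_analyticAt ℂ Φ) (range_subset_iff.2 hΦ)
  have hcomp : IsCompact (cthickening δ (range f₀)) := (isCompact_range f₀.continuous).cthickening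
  obtain ⟨C, hC⟩ := hcomp.exists_bound_of_continuousOn
    (fun z hz => (hK hz).continuousAt.continuousWithinAt)
  have hball : ∀ x, closedBall (f₀ x) δ ⊆ cthickening δ (range f₀) := fun x =>
    closedBall_subset_cthickening (mem_range_self x) δ
  have hd : ∀ x, DifferentiableOn ℂ Φ (closedBall (f₀ x) δ) := fun x z hz =>
    (hK (hball x hz)).differentiableAt.differentiableWithinAt
  -- The Taylor coefficients of `Φ` at `f₀ x`, as functions of `x`. Cauchy's estimate makes `∑ a n *
  -- (f - f₀) ^ n` converge in the Banach algebra, and evaluation at `x` identifies its sum with `Φ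
  -- (f x)`.
  let a : ℕ → C(X, ℂ) := fun n =>
    { toFun := fun x => (n.factorial : ℂ)⁻¹ * iteratedDeriv n Φ (f₀ x)
      continuous_toFun := continuous_const.mul (continuous_iff_continuousAt.2 fun x =>
        ContinuousAt.comp (g := iteratedDeriv n Φ) ((hΦ x).iteratedDeriv_apply n).continuousAt
          f₀.continuous.continuousAt) }
  have hC0 : ∀ x, 0 ≤ C := fun x =>
    (norm_nonneg _).trans (hC (f₀ x) (hball x (mem_closedBall_self hδ.le)))
  -- The absolute value covers empty `X`, for which `C` may be negative.
  have ha : ∀ n, ‖a n‖ ≤ |C| / δ ^ n := fun n => by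
    refine (ContinuousMap.norm_le _ (by positivity)).2 fun x => ?_
    have h := Complex.norm_iteratedDeriv_le_of_forall_mem_sphere_norm_le n hδ
      ((hd x).diffContOnCl_ball subset_rfl)
      fun z hz => hC z (hball x (sphere_subset_closedBall hz))
    simp only [a, ContinuousMap.coe_mk, norm_mul, norm_inv, RCLike.norm_natCast]
    rw [inv_mul_le_iff₀ (by positivity)]
    refine h.trans (le_of_eq ?_)
    rw [abs_of_nonneg (hC0 x)]
    ring
  let p : FormalMultilinearSeries ℂ C(X, ℂ) C(X, ℂ) := fun n =>
    (ContinuousLinearMap.mul ℂ C(X, ℂ) (a n)).compContinuousMultilinearMap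
      (ContinuousMultilinearMap.mkPiAlgebraFin ℂ n C(X, ℂ))
  have hrad : (δ.toNNReal : ENNReal) ≤ p.radius := by
    refine p.le_radius_of_bound (|C| * max 1 ‖(1 : C(X, ℂ))‖) fun n => ?_
    have h1 : ‖p n‖ ≤ |C| / δ ^ n * max 1 ‖(1 : C(X, ℂ))‖ :=
      (ContinuousLinearMap.norm_compContinuousMultilinearMap_le _ _).trans
        (mul_le_mul ((ContinuousLinearMap.opNorm_mul_apply_le ℂ _ _).trans (ha n))
          ContinuousMultilinearMap.norm_mkPiAlgebraFin_le (norm_nonneg _) (by positivity))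
    rw [Real.coe_toNNReal _ hδ.le]
    calc ‖p n‖ * δ ^ n ≤ |C| / δ ^ n * max 1 ‖(1 : C(X, ℂ))‖ * δ ^ n := by gcongr
      _ = _ := by field_simp
  have hpos : 0 < p.radius := lt_of_lt_of_le (by simpa using hδ) hrad
  refine ⟨fun f => p.sum (f - f₀), ?_, ?_⟩
  · have := (p.hasFPowerSeriesOnBall hpos).comp_sub f₀
    rw [zero_add] at this
    exact this.analyticAt
  · filter_upwards [ball_mem_nhds f₀ hδ] with f hf x
    have hf' : f - f₀ ∈ Metric.eball (0 : C(X, ℂ)) p.radius := by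
      refine Metric.eball_subset_eball hrad ?_
      rw [Metric.mem_eball, edist_zero_right, enorm_eq_nnnorm]
      rw [mem_ball, dist_eq_norm] at hf
      exact_mod_cast (NNReal.coe_lt_coe.1 (by simpa [Real.coe_toNNReal _ hδ.le] using hf) :
        ‖f - f₀‖₊ < δ.toNNReal)
    have h1 := (p.hasSum hf').mapL (ContinuousMap.evalCLM ℂ x)
    have hfx : f x ∈ ball (f₀ x) δ := by
      rw [mem_ball, dist_eq_norm] at hf ⊢
      exact ((f - f₀).norm_coe_le_norm x).trans_lt hf
    have h2 := Complex.hasSum_taylorSeries_on_ball ((hd x).mono ball_subset_closedBall) hfx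
    refine h1.unique (h2.congr_fun ?_)
    intro n
    simp [p, a, ContinuousMultilinearMap.mkPiAlgebraFin_apply]
    ring

end Superposition

/-! ### Analytic families of continuous functions -/

section Family

variable {X : Type*} [TopologicalSpace X] [CompactSpace X] {r₀ : C2} {f g : C2 → X → ℂ} {k : ℂ}

/-- Near `r₀` the functions `f r` are continuous and depend analytically on `r` in the uniform
norm. -/
def AnalyticFamilyAt (f : C2 → X → ℂ) (r₀ : C2) : Prop :=
  ∃ F : C2 → C(X, ℂ), AnalyticAt ℂ F r₀ ∧ ∀ᶠ r in 𝓝 r₀, ∀ x, F r x = f r x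

theorem analyticFamilyAt_const {c : X → ℂ} (hc : Continuous c) (r₀ : C2) :
    AnalyticFamilyAt (fun _ => c) r₀ :=
  ⟨fun _ => ⟨c, hc⟩, analyticAt_const, Eventually.of_forall fun _ _ => rfl⟩

theorem analyticFamilyAt_coord (i : Fin 2) (r₀ : C2) :
    AnalyticFamilyAt (fun r (_ : X) => r i) r₀ :=
  ⟨fun r => r i • (1 : C(X, ℂ)), (analyticAt_apply i r₀).smul analyticAt_const,
    Eventually.of_forall fun _ _ => by simp⟩

namespace AnalyticFamilyAt

theorem add (hf : AnalyticFamilyAt f r₀) (hg : AnalyticFamilyAt g r₀) :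
    AnalyticFamilyAt (fun r x => f r x + g r x) r₀ := by
  obtain ⟨F, hF, hF'⟩ := hf
  obtain ⟨G, hG, hG'⟩ := hg
  refine ⟨F + G, hF.add hG, ?_⟩
  filter_upwards [hF', hG'] with r h1 h2 x
  simp [h1, h2]

theorem mul (hf : AnalyticFamilyAt f r₀) (hg : AnalyticFamilyAt g r₀) :
    AnalyticFamilyAt (fun r x => f r x * g r x) r₀ := by
  obtain ⟨F, hF, hF'⟩ := hf
  obtain ⟨G, hG, hG'⟩ := hg
  refine ⟨F * G, hF.mul hG, ?_⟩
  filter_upwards [hF', hG'] with r h1 h2 x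
  simp [h1, h2]

theorem sub (hf : AnalyticFamilyAt f r₀) (hg : AnalyticFamilyAt g r₀) :
    AnalyticFamilyAt (fun r x => f r x - g r x) r₀ := by
  obtain ⟨F, hF, hF'⟩ := hf
  obtain ⟨G, hG, hG'⟩ := hg
  refine ⟨F - G, hF.sub hG, ?_⟩
  filter_upwards [hF', hG'] with r h1 h2 x
  simp [h1, h2]

theorem comp {Φ : ℂ → ℂ} (hf : AnalyticFamilyAt f r₀) (hΦ : ∀ x, AnalyticAt ℂ Φ (f r₀ x)) :
    AnalyticFamilyAt (fun r x => Φ (f r x)) r₀ := by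
  obtain ⟨F, hF, hF'⟩ := hf
  obtain ⟨N, hN, hN'⟩ := exists_analyticAt_superposition (F r₀)
    fun x => by rw [hF'.self_of_nhds x]; exact hΦ x
  refine ⟨N ∘ F, hN.comp hF, ?_⟩
  filter_upwards [hF', hF.continuousAt.eventually hN'] with r h1 h2 x
  simp [h1, h2]

theorem congr (hf : AnalyticFamilyAt f r₀) (h : ∀ᶠ r in 𝓝 r₀, ∀ x, f r x = g r x) :
    AnalyticFamilyAt g r₀ := by
  obtain ⟨F, hF, hF'⟩ := hf
  refine ⟨F, hF, ?_⟩
  filter_upwards [hF', h] with r h1 h2 x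
  rw [h1, h2]

end AnalyticFamilyAt

/-- The Helmholtz operator on functions with values in a space of continuous functions commutes
with continuous functionals. -/
theorem helmholtz_clm_comp (L : C(X, ℂ) →L[ℂ] ℂ) {F : C2 → C(X, ℂ)} (hF : AnalyticAt ℂ F r₀) :
    helmholtz ℂ k (fun r => L (F r)) r₀ =
      L (fderiv ℂ (fun r => fderiv ℂ F r (EuclideanSpace.single 0 1)) r₀
          (EuclideanSpace.single 0 1) +
        fderiv ℂ (fun r => fderiv ℂ F r (EuclideanSpace.single 1 1)) r₀
          (EuclideanSpace.single 1 1) + k ^ 2 • F r₀) := by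
  have h1 {E : C2 → C(X, ℂ)} {r : C2} (hE : AnalyticAt ℂ E r) (n : C2) :
      fderiv ℂ (fun r => L (E r)) r n = L (fderiv ℂ E r n) := by
    have h := L.hasFDerivAt.comp r hE.differentiableAt.hasFDerivAt
    exact congrArg (fun T : C2 →L[ℂ] ℂ => T n) h.fderiv
  have h2 (n : C2) : fderiv ℂ (fun r => fderiv ℂ (fun r => L (F r)) r n) r₀ n =
      L (fderiv ℂ (fun r => fderiv ℂ F r n) r₀ n) := by
    have e : (fun r => fderiv ℂ (fun r => L (F r)) r n) =ᶠ[𝓝 r₀]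
        fun r => L (fderiv ℂ F r n) := by
      filter_upwards [hF.eventually_analyticAt] with r hr
      exact h1 hr n
    rw [e.fderiv_eq]
    exact h1 ((ContinuousLinearMap.apply ℂ _ n).analyticAt _ |>.comp hF.fderiv) n
  simp only [map_add, map_smul, ← h2, smul_eq_mul]
  rfl

end Family

/-- Integration over the unit interval. -/
def integralL : C(Icc (0 : ℝ) 1, ℂ) →L[ℂ] ℂ :=
  LinearMap.mkContinuous
    { toFun := fun f => ∫ t in (0 : ℝ)..1, f (projIcc 0 1 zero_le_one t)
      map_add' := fun f g => intervalIntegral.integral_add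
        ((f.continuous.comp continuous_projIcc).intervalIntegrable 0 1)
        ((g.continuous.comp continuous_projIcc).intervalIntegrable 0 1)
      map_smul' := fun c f => intervalIntegral.integral_smul c _ } 1 fun f => by
    rw [one_mul]
    simpa using intervalIntegral.norm_integral_le_of_norm_le_const (a := (0 : ℝ)) (b := 1)
      fun t _ => f.norm_coe_le_norm (projIcc 0 1 zero_le_one t)

theorem integralL_eq {F : C(Icc (0 : ℝ) 1, ℂ)} {f : ℝ → ℂ} (h : ∀ t, F t = f t) :
    integralL F = ∫ t in (0 : ℝ)..1, f t := by
  refine intervalIntegral.integral_congr fun t ht => ?_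
  rw [uIcc_of_le zero_le_one] at ht
  simp only [h, projIcc_of_mem zero_le_one ht]

variable {f : C2 → ℝ → ℂ} {r₀ : C2} {k : ℂ}

theorem AnalyticFamilyAt.analyticAt_integral
    (hf : AnalyticFamilyAt (fun r (t : Icc (0 : ℝ) 1) => f r t) r₀) :
    AnalyticAt ℂ (fun r => ∫ t in (0 : ℝ)..1, f r t) r₀ := by
  obtain ⟨F, hF, hF'⟩ := hf
  refine ((integralL.analyticAt _).comp hF).congr ?_
  filter_upwards [hF'] with r hr
  exact integralL_eq hr

theorem pderiv_congr {𝕜 : Type} [RCLike 𝕜] [NormedSpace 𝕜 ℂ]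
    {f g : EuclideanSpace 𝕜 (Fin 2) → ℂ} {x : EuclideanSpace 𝕜 (Fin 2)} (i : Fin 2)
    (h : f =ᶠ[𝓝 x] g) : pderiv 𝕜 i f =ᶠ[𝓝 x] pderiv 𝕜 i g := by
  filter_upwards [h.eventuallyEq_nhds] with y hy
  rw [pderiv, hy.fderiv_eq, pderiv]

theorem helmholtz_congr {𝕜 : Type} [RCLike 𝕜] [NormedSpace 𝕜 ℂ]
    {f g : EuclideanSpace 𝕜 (Fin 2) → ℂ} {x : EuclideanSpace 𝕜 (Fin 2)}
    (h : f =ᶠ[𝓝 x] g) : helmholtz 𝕜 k f x = helmholtz 𝕜 k g x := by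
  simp only [helmholtz, (pderiv_congr _ (pderiv_congr _ h)).eq_of_nhds, h.eq_of_nhds]

/-- The Helmholtz operator is applied to the map with values in continuous functions. Evaluation at
each `t` shows that the result is the zero function, so its integral vanishes. -/
theorem AnalyticFamilyAt.helmholtz_integral
    (hf : AnalyticFamilyAt (fun r (t : Icc (0 : ℝ) 1) => f r t) r₀)
    (h0 : ∀ t ∈ Icc (0 : ℝ) 1, helmholtz ℂ k (fun r => f r t) r₀ = 0) :
    helmholtz ℂ k (fun r => ∫ t in (0 : ℝ)..1, f r t) r₀ = 0 := by
  obtain ⟨F, hF, hF'⟩ := hf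
  have e : (fun r => ∫ t in (0 : ℝ)..1, f r t) =ᶠ[𝓝 r₀] fun r => integralL (F r) := by
    filter_upwards [hF'] with r hr
    exact (integralL_eq hr).symm
  rw [helmholtz_congr e, helmholtz_clm_comp _ hF]
  convert map_zero integralL
  ext t
  have h := helmholtz_clm_comp (k := k) (ContinuousMap.evalCLM ℂ t) hF
  have e' : (fun r => ContinuousMap.evalCLM ℂ t (F r)) =ᶠ[𝓝 r₀] fun r => f r t := by
    filter_upwards [hF'] with r hr
    exact hr t
  rw [helmholtz_congr e', h0 t t.2] at h
  exact h.symm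

/-! ### Sections of the projection of a Sommerfeld surface -/

section Sections

variable {S : Type*} [TopologicalSpace S] {ψ : S → Plane} {P : Finset Plane}

/-- Uniqueness of lifts, localised both in the base and in the domain by restriction to subtypes. It
serves the sheets of the surface as well as the branches of the logarithm. -/
theorem eqOn_of_lift {E B : Type*} [TopologicalSpace E] [TopologicalSpace B] {p : E → B} {T : Set B}
    (hp : IsCoveringMapOn p T) {A : Type*} [TopologicalSpace A]
    {V : Set A} (hV : IsPreconnected V) {g₁ g₂ : A → E} (h₁ : ContinuousOn g₁ V)
    (h₂ : ContinuousOn g₂ V) (he : ∀ a ∈ V, p (g₁ a) = p (g₂ a)) (hT : ∀ a ∈ V, p (g₁ a) ∈ T)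
    {a₀ : A} (ha₀ : a₀ ∈ V) (h₀ : g₁ a₀ = g₂ a₀) : EqOn g₁ g₂ V := by
  have := isPreconnected_iff_preconnectedSpace.1 hV
  let G₁ : V → p ⁻¹' T := fun a => ⟨g₁ a, hT a a.2⟩
  let G₂ : V → p ⁻¹' T := fun a => ⟨g₂ a, by
    have := hT a a.2
    rwa [he a a.2] at this⟩
  have h := hp.isCoveringMap_restrictPreimage.eq_of_comp_eq (g₁ := G₁) (g₂ := G₂)
    (h₁.domRestrict.subtype_mk _) (h₂.domRestrict.subtype_mk _)
    (funext fun a => Subtype.ext (he a a.2)) ⟨a₀, ha₀⟩ (Subtype.ext h₀)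
  exact fun a ha => congrArg Subtype.val (congrFun h ⟨a, ha⟩)

/-- `s` is a continuous section of `ψ` over `V`, which contains no branch points. -/
structure IsSection (ψ : S → Plane) (P : Finset Plane) (s : Plane → S) (V : Set Plane) : Prop where
  continuousOn : ContinuousOn s V
  proj_eq : ∀ x ∈ V, ψ (s x) = x
  avoids : ∀ x ∈ V, x ∉ P

theorem IsSection.mono {s : Plane → S} {V W : Set Plane} (h : IsSection ψ P s V) (hW : W ⊆ V) :
    IsSection ψ P s W :=
  ⟨h.continuousOn.mono hW, fun x hx => h.proj_eq x (hW hx), fun x hx => h.avoids x (hW hx)⟩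

theorem IsSection.eqOn (hψ : IsCoveringMapOn ψ {x | x ∉ P}) {s s' : Plane → S} {V : Set Plane}
    (h : IsSection ψ P s V) (h' : IsSection ψ P s' V) (hV : IsPreconnected V) {x₀ : Plane}
    (hx₀ : x₀ ∈ V) (he : s x₀ = s' x₀) : EqOn s s' V :=
  eqOn_of_lift hψ hV h.continuousOn h'.continuousOn
    (fun x hx => by rw [h.proj_eq x hx, h'.proj_eq x hx])
    (fun x hx => by rw [h.proj_eq x hx]; exact h.avoids x hx) hx₀ he

theorem exists_isSection (hψ : IsCoveringMapOn ψ {x | x ∉ P}) {q₀ : S} (hq : ψ q₀ ∉ P) :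
    ∃ (V : Set Plane) (s : Plane → S), IsOpen V ∧ ψ q₀ ∈ V ∧ IsSection ψ P s V ∧
      ∀ᶠ q in 𝓝 q₀, s (ψ q) = q := by
  obtain ⟨e, he, rfl⟩ := hψ.isLocalHomeomorphOn q₀ hq
  refine ⟨e.target ∩ {x | x ∉ P}, e.symm,
    e.open_target.inter P.finite_toSet.isClosed.isOpen_compl, ⟨e.map_source he, hq⟩,
    ⟨e.symm.continuousOn.mono inter_subset_left, fun x hx => e.right_inv hx.1, fun x hx => hx.2⟩,
    ?_⟩
  filter_upwards [e.open_source.mem_nhds he] with q hq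
  exact e.left_inv hq

/-- `localSection` rests on an arbitrary choice, but its germ does not: near `s x` the projection
has a left inverse, so two continuous local lifts through `s x` coincide. -/
theorem IsSection.localSection_eventuallyEq (hψ : IsCoveringMapOn ψ {x | x ∉ P}) {s : Plane → S}
    {V : Set Plane} (h : IsSection ψ P s V) (hV : IsOpen V) {x : Plane} (hx : x ∈ V) :
    localSection ψ (s x) =ᶠ[𝓝 x] s := by
  have hc : ContinuousAt s x := h.continuousOn.continuousAt (hV.mem_nhds hx)
  have hψs : ψ (s x) = x := h.proj_eq x hx
  have hex : ∃ s', IsLocalSection ψ (s x) s' := by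
    refine ⟨s, ?_, ?_, ?_⟩ <;> rw [hψs]
    · exact hc
    · filter_upwards [hV.mem_nhds hx] using h.proj_eq
  obtain ⟨h1, h2, h3⟩ : IsLocalSection ψ (s x) (localSection ψ (s x)) := by
    rw [localSection, dif_pos hex]
    exact hex.choose_spec
  rw [hψs] at h1 h2 h3
  obtain ⟨W, σ, -, -, -, hσ⟩ := exists_isSection hψ (q₀ := s x)
    (by rw [hψs]; exact h.avoids x hx)
  have hσ' := hσ
  rw [← h1] at hσ'
  filter_upwards [h2.eventually hσ', hc.eventually hσ, h3, hV.mem_nhds hx] with y hy1 hy2 hy3 hy4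
  rw [← hy1, ← hy2, hy3, h.proj_eq y hy4]

theorem IsSection.onSheet_eventuallyEq (hψ : IsCoveringMapOn ψ {x | x ∉ P}) {s : Plane → S}
    {V : Set Plane} (h : IsSection ψ P s V) (hV : IsOpen V) {x : Plane} (hx : x ∈ V) (u : S → ℂ) :
    onSheet ψ u (s x) =ᶠ[𝓝 x] u ∘ s := by
  filter_upwards [h.localSection_eventuallyEq hψ hV hx] with y hy
  simp [onSheet, hy]

theorem IsSection.contDiffAt (hψ : IsCoveringMapOn ψ {x | x ∉ P}) {s : Plane → S}
    {V : Set Plane} (h : IsSection ψ P s V) (hV : IsOpen V) {k : ℂ} {u : S → ℂ}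
    (hu : ObeysHelmholtz ψ P k u) {x : Plane} (hx : x ∈ V) :
    ContDiffAt ℝ 2 (u ∘ s) x ∧ helmholtz ℝ k (u ∘ s) x = 0 := by
  have e := h.onSheet_eventuallyEq hψ hV hx u
  have hP : ψ (s x) ∉ P := by rw [h.proj_eq x hx]; exact h.avoids x hx
  have h1 := hu.smooth _ hP
  have h2 := hu.equation _ hP
  rw [h.proj_eq x hx] at h1 h2
  exact ⟨h1.congr_of_eventuallyEq e.symm, by rw [← helmholtz_congr e, h2]⟩

/-- Over a compact set of regular points the sections have a uniform radius. -/
theorem exists_uniform_isSection (hψ : IsCoveringMapOn ψ {x | x ∉ P}) {K : Set S}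
    (hK : IsCompact K) (hKP : ∀ q ∈ K, ψ q ∉ P) :
    ∃ ρ > 0, ∃ s : S → Plane → S, ∀ q ∈ K, IsSection ψ P (s q) (ball (ψ q) ρ) ∧ s q (ψ q) = q := by
  suffices ∃ ρ > 0, ∀ q ∈ K, ∃ s : Plane → S, IsSection ψ P s (ball (ψ q) ρ) ∧ s (ψ q) = q by
    obtain ⟨ρ, hρ, h⟩ := this
    choose! s hs using h
    exact ⟨ρ, hρ, s, hs⟩
  refine hK.induction_on (p := fun K => ∃ ρ > 0, ∀ q ∈ K, ∃ s : Plane → S,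
    IsSection ψ P s (ball (ψ q) ρ) ∧ s (ψ q) = q) ⟨1, one_pos, by simp⟩ ?_ ?_ ?_
  · rintro K₁ K₂ h ⟨ρ, hρ, h'⟩
    exact ⟨ρ, hρ, fun q hq => h' q (h hq)⟩
  · rintro K₁ K₂ ⟨ρ₁, hρ₁, h₁⟩ ⟨ρ₂, hρ₂, h₂⟩
    refine ⟨min ρ₁ ρ₂, lt_min hρ₁ hρ₂, ?_⟩
    rintro q (hq | hq)
    · obtain ⟨s, hs, hs'⟩ := h₁ q hq
      exact ⟨s, hs.mono (ball_subset_ball (min_le_left _ _)), hs'⟩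
    · obtain ⟨s, hs, hs'⟩ := h₂ q hq
      exact ⟨s, hs.mono (ball_subset_ball (min_le_right _ _)), hs'⟩
  · intro q₀ hq₀
    obtain ⟨V, s, hV, hqV, hs, he⟩ := exists_isSection hψ (hKP q₀ hq₀)
    obtain ⟨ε, hε, hεV⟩ := Metric.isOpen_iff.1 hV _ hqV
    have hc : ContinuousAt ψ q₀ := hψ.continuousAt (hKP q₀ hq₀)
    -- If `ψ q` is within `ε / 2` of `ψ q₀`, the ball of radius `ε / 2` about `ψ q` still lies in
    -- the domain of the section through `q₀`, which then serves `q` too.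
    refine ⟨{q | s (ψ q) = q ∧ ψ q ∈ ball (ψ q₀) (ε / 2)}, mem_nhdsWithin_of_mem_nhds
      (he.and (hc.eventually (ball_mem_nhds _ (half_pos hε)))), ε / 2, half_pos hε, ?_⟩
    rintro q ⟨hq1, hq2⟩
    refine ⟨s, hs.mono (Subset.trans ?_ hεV), hq1⟩
    refine ball_subset_ball' ?_
    have := mem_ball.1 hq2
    linarith

end Sections

/-! ### The closed form of Green's second identity -/

/-- Rotation of the plane by a right angle, clockwise. -/
def rotL : Plane →L[ℝ] Plane :=
  LinearMap.toContinuousLinearMap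
    { toFun := fun v => !₂[v 1, -v 0]
      map_add' := fun x y => by ext i; fin_cases i <;> simp [add_comm]
      map_smul' := fun c x => by ext i; fin_cases i <;> simp }

theorem rotL_apply (v : Plane) : rotL v = !₂[v 1, -v 0] := rfl

/-- The form `(∂G/∂n U - ∂U/∂n G) dl`. -/
def greenForm (G U : Plane → ℂ) (x : Plane) : Plane →L[ℝ] ℂ :=
  U x • (fderiv ℝ G x ∘L rotL) - G x • (fderiv ℝ U x ∘L rotL)

theorem greenForm_apply (G U : Plane → ℂ) (x v : Plane) :
    greenForm G U x v = fderiv ℝ G x (rotL v) * U x - fderiv ℝ U x (rotL v) * G x := by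
  simp [greenForm]
  ring

theorem greenForm_congr {G G' U U' : Plane → ℂ} {x : Plane} (hG : G =ᶠ[𝓝 x] G')
    (hU : U =ᶠ[𝓝 x] U') : greenForm G U x = greenForm G' U' x := by
  rw [greenForm, greenForm, hG.fderiv_eq, hU.fderiv_eq, hG.eq_of_nhds, hU.eq_of_nhds]

variable {G U : Plane → ℂ} {x : Plane} {k : ℂ}

theorem differentiableAt_fderiv (hG : ContDiffAt ℝ 2 G x) : DifferentiableAt ℝ (fderiv ℝ G) x :=
  (hG.fderiv_right (m := 1) (by norm_num)).differentiableAt (by norm_num)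

theorem differentiableAt_greenForm (hG : ContDiffAt ℝ 2 G x) (hU : ContDiffAt ℝ 2 U x) :
    DifferentiableAt ℝ (greenForm G U) x := by
  have h1 := differentiableAt_fderiv hG
  have h2 := differentiableAt_fderiv hU
  have h3 : DifferentiableAt ℝ G x := hG.differentiableAt (by norm_num)
  have h4 : DifferentiableAt ℝ U x := hU.differentiableAt (by norm_num)
  unfold greenForm
  exact (h4.smul (h1.clm_comp (differentiableAt_const _))).sub
    (h3.smul (h2.clm_comp (differentiableAt_const _)))

theorem fderiv_greenForm_apply (hG : ContDiffAt ℝ 2 G x) (hU : ContDiffAt ℝ 2 U x)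
    (v w : Plane) : fderiv ℝ (greenForm G U) x v w =
      fderiv ℝ G x (rotL w) * fderiv ℝ U x v + U x * fderiv ℝ (fderiv ℝ G) x v (rotL w) -
        (fderiv ℝ U x (rotL w) * fderiv ℝ G x v + G x * fderiv ℝ (fderiv ℝ U) x v (rotL w)) := by
  have h1 := (differentiableAt_fderiv hG).hasFDerivAt
  have h2 := (differentiableAt_fderiv hU).hasFDerivAt
  have h3 := (hG.differentiableAt (by norm_num)).hasFDerivAt
  have h4 := (hU.differentiableAt (by norm_num)).hasFDerivAt
  have h := ((differentiableAt_greenForm hG hU).hasFDerivAt.clm_apply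
    (hasFDerivAt_const w x)).fderiv
  have h' := (((h1.clm_apply (hasFDerivAt_const (rotL w) x)).mul h4).sub
    ((h2.clm_apply (hasFDerivAt_const (rotL w) x)).mul h3)).fderiv
  have e : (fun y => greenForm G U y w) = (fun y => fderiv ℝ G y (rotL w)) * U -
      (fun y => fderiv ℝ U y (rotL w)) * G := funext fun y => greenForm_apply G U y w
  rw [e, h'] at h
  have h := congrArg (fun T : Plane →L[ℝ] ℂ => T v) h
  simp at h
  rw [← h]

theorem plane_eq (v : Plane) :
    v = v 0 • EuclideanSpace.single 0 1 + v 1 • EuclideanSpace.single 1 1 := by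
  ext i; fin_cases i <;> simp

theorem rotL_eq (v : Plane) :
    rotL v = v 1 • EuclideanSpace.single 0 1 + (-v 0) • EuclideanSpace.single 1 1 := by
  ext i; fin_cases i <;> simp [rotL_apply]

theorem pderiv_pderiv_eq (hG : ContDiffAt ℝ 2 G x) (i : Fin 2) :
    pderiv ℝ i (pderiv ℝ i G) x =
      fderiv ℝ (fderiv ℝ G) x (EuclideanSpace.single i 1) (EuclideanSpace.single i 1) := by
  have h := ((differentiableAt_fderiv hG).hasFDerivAt.clm_apply
    (hasFDerivAt_const (EuclideanSpace.single i (1 : ℝ)) x)).fderiv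
  have h := congrArg (fun T : Plane →L[ℝ] ℂ => T (EuclideanSpace.single i (1 : ℝ))) h
  simp at h
  exact h

/-- Green's second identity in closed form. Products of first derivatives and mixed second
derivatives are symmetric in `v` and `w`; the antisymmetric rest is `(v₀w₁ - v₁w₀)(U ΔG - G ΔU)`,
zero because both functions have the same `k`. -/
theorem fderiv_greenForm_symm (hG : ContDiffAt ℝ 2 G x) (hU : ContDiffAt ℝ 2 U x)
    (hG0 : helmholtz ℝ k G x = 0) (hU0 : helmholtz ℝ k U x = 0) (v w : Plane) :
    fderiv ℝ (greenForm G U) x v w = fderiv ℝ (greenForm G U) x w v := by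
  rw [fderiv_greenForm_apply hG hU, fderiv_greenForm_apply hG hU, rotL_eq v, rotL_eq w]
  rw [helmholtz, pderiv_pderiv_eq hG, pderiv_pderiv_eq hG] at hG0
  rw [helmholtz, pderiv_pderiv_eq hU, pderiv_pderiv_eq hU] at hU0
  generalize hv0 : v 0 = v0
  generalize hv1 : v 1 = v1
  generalize hw0 : w 0 = w0
  generalize hw1 : w 1 = w1
  rw [plane_eq v, plane_eq w, hv0, hv1, hw0, hw1]
  simp only [map_add, map_smul, add_apply, smul_apply, Complex.real_smul]
  push_cast
  linear_combination ((v0 : ℂ) * w1 - v1 * w0) * (U x * hG0 - G x * hU0)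

variable {V : Set Plane}

theorem exists_primitive_greenForm (hV : IsOpen V) (hVc : Convex ℝ V)
    (hG : ∀ x ∈ V, ContDiffAt ℝ 2 G x ∧ helmholtz ℝ k G x = 0)
    (hU : ∀ x ∈ V, ContDiffAt ℝ 2 U x ∧ helmholtz ℝ k U x = 0) :
    ∃ f, ∀ x ∈ V, HasFDerivAt f (greenForm G U x) x :=
  hVc.exists_forall_hasFDerivAt_of_fderiv_symmetric hV
    (fun x hx => (differentiableAt_greenForm (hG x hx).1 (hU x hx).1).differentiableWithinAt)
    fun x hx v w => fderiv_greenForm_symm (hG x hx).1 (hU x hx).1 (hG x hx).2 (hU x hx).2 v w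

/-! ### Homotopy invariance -/

/-- Two closed curves are joined by segments, along which a family of forms has local primitives.
The form may change along the curves, but it is locally constant. -/
structure IsSegmentHomotopy (ω : ℝ → Plane → Plane →L[ℝ] ℂ) (c₀ c₁ : ℝ → Plane) : Prop where
  smooth₀ : ContDiffOn ℝ 1 c₀ (Icc 0 1)
  smooth₁ : ContDiffOn ℝ 1 c₁ (Icc 0 1)
  closed₀ : c₀ 0 = c₀ 1
  closed₁ : c₁ 0 = c₁ 1
  exact : ∀ t ∈ Icc (0 : ℝ) 1, ∃ V, IsOpen V ∧ Convex ℝ V ∧ c₀ t ∈ V ∧ c₁ t ∈ V ∧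
    ContinuousOn (ω t) V ∧ (∃ f, ∀ x ∈ V, HasFDerivAt f (ω t x) x) ∧
    ∀ᶠ t' in 𝓝[Icc 0 1] t, EqOn (ω t') (ω t) V
  eqOn : EqOn (ω 0) (ω 1) (segment ℝ (c₀ 0) (c₁ 0))

/-- The integral of the form over the segment that joins the points with parameter `t`. -/
def segmentIntegral (ω : ℝ → Plane → Plane →L[ℝ] ℂ) (c₀ c₁ : ℝ → Plane) (t : ℝ) : ℂ :=
  ∫ s in (0 : ℝ)..1, ω t (AffineMap.lineMap (c₀ t) (c₁ t) s) (c₁ t - c₀ t)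

theorem integral_lineMap_eq_sub {η : Plane → Plane →L[ℝ] ℂ} {f : Plane → ℂ} (hVc : Convex ℝ V)
    (hη : ContinuousOn η V) (hf : ∀ x ∈ V, HasFDerivAt f (η x) x) {a b : Plane} (ha : a ∈ V)
    (hb : b ∈ V) :
    ∫ s in (0 : ℝ)..1, η (AffineMap.lineMap a b s) (b - a) = f b - f a := by
  have hm : ∀ s ∈ Icc (0 : ℝ) 1, (AffineMap.lineMap a b s : Plane) ∈ V := fun s hs =>
    hVc.lineMap_mem ha hb hs
  have hd : ∀ s ∈ uIcc (0 : ℝ) 1, HasDerivAt (fun s => f (AffineMap.lineMap a b s))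
      (η (AffineMap.lineMap a b s) (b - a)) s := fun s hs => by
    rw [uIcc_of_le zero_le_one] at hs
    exact (hf _ (hm s hs)).comp_hasDerivAt s AffineMap.hasDerivAt_lineMap
  have hc : ContinuousOn (fun s => η (AffineMap.lineMap a b s) (b - a)) (Icc (0 : ℝ) 1) :=
    (hη.comp AffineMap.lineMap_continuous.continuousOn hm).clm_apply continuousOn_const
  rw [intervalIntegral.integral_eq_sub_of_hasDerivAt hd (hc.intervalIntegrable_of_Icc zero_le_one)]
  simp

theorem uniqueDiffWithinAt_Icc {t : ℝ} (ht : t ∈ Icc (0 : ℝ) 1) :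
    UniqueDiffWithinAt ℝ (Icc (0 : ℝ) 1) t := uniqueDiffOn_Icc_zero_one t ht

theorem hasDerivWithinAt_velocity {c : ℝ → Plane} (hc : ContDiffOn ℝ 1 c (Icc 0 1)) {t : ℝ}
    (ht : t ∈ Icc (0 : ℝ) 1) : HasDerivWithinAt c (velocity c t) (Icc 0 1) t :=
  ((hc.differentiableOn (by norm_num)) t ht).hasDerivWithinAt

theorem continuousOn_velocity {c : ℝ → Plane} (hc : ContDiffOn ℝ 1 c (Icc 0 1)) :
    ContinuousOn (velocity c) (Icc 0 1) :=
  hc.continuousOn_derivWithin uniqueDiffOn_Icc_zero_one le_rfl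

namespace IsSegmentHomotopy

variable {ω : ℝ → Plane → Plane →L[ℝ] ℂ} {c₀ c₁ : ℝ → Plane}

/-- Near `t` the segment integral is `f (c₁ t') - f (c₀ t')` for a local primitive `f`; no primitive
along the entire curve is required. -/
theorem hasDerivWithinAt_segmentIntegral (h : IsSegmentHomotopy ω c₀ c₁) {t : ℝ}
    (ht : t ∈ Icc (0 : ℝ) 1) : HasDerivWithinAt (segmentIntegral ω c₀ c₁)
      (ω t (c₁ t) (velocity c₁ t) - ω t (c₀ t) (velocity c₀ t)) (Icc 0 1) t := by
  obtain ⟨V, hV, hVc, h0, h1, hω, ⟨f, hf⟩, he⟩ := h.exact t ht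
  have d0 := (hf _ h0).comp_hasDerivWithinAt t (hasDerivWithinAt_velocity h.smooth₀ ht)
  have d1 := (hf _ h1).comp_hasDerivWithinAt t (hasDerivWithinAt_velocity h.smooth₁ ht)
  have e : segmentIntegral ω c₀ c₁ =ᶠ[𝓝[Icc 0 1] t] (f ∘ c₁) - (f ∘ c₀) := by
    filter_upwards [he, (h.smooth₀.continuousOn t ht).eventually (hV.mem_nhds h0),
      (h.smooth₁.continuousOn t ht).eventually (hV.mem_nhds h1)] with t' h2 h3 h4
    rw [segmentIntegral, Pi.sub_apply, Function.comp, Function.comp,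
      ← integral_lineMap_eq_sub hVc hω hf h3 h4]
    refine intervalIntegral.integral_congr fun s hs => ?_
    rw [uIcc_of_le zero_le_one] at hs
    simp only [h2 (hVc.lineMap_mem h3 h4 hs)]
  exact (d1.sub d0).congr_of_eventuallyEq e (e.eq_of_nhdsWithin ht)

theorem continuousOn_integrand (h : IsSegmentHomotopy ω c₀ c₁) :
    ContinuousOn (fun t => ω t (c₀ t) (velocity c₀ t)) (Icc 0 1) ∧
      ContinuousOn (fun t => ω t (c₁ t) (velocity c₁ t)) (Icc 0 1) := by
  have key {c : ℝ → Plane} (hc : ContDiffOn ℝ 1 c (Icc 0 1)) {t : ℝ} (ht : t ∈ Icc (0 : ℝ) 1)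
      {V : Set Plane} (hV : IsOpen V) (hct : c t ∈ V) (hω : ContinuousOn (ω t) V)
      (he : ∀ᶠ t' in 𝓝[Icc 0 1] t, EqOn (ω t') (ω t) V) :
      ContinuousWithinAt (fun t => ω t (c t) (velocity c t)) (Icc 0 1) t := by
    have h1 : ContinuousWithinAt (fun t' => ω t (c t') (velocity c t')) (Icc 0 1) t :=
      ((hω.continuousAt (hV.mem_nhds hct)).comp_continuousWithinAt
        (hc.continuousOn t ht)).clm_apply (continuousOn_velocity hc t ht)
    refine h1.congr_of_eventuallyEq ?_ rfl
    filter_upwards [he, (hc.continuousOn t ht).eventually (hV.mem_nhds hct)] with t' h2 h3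
    rw [h2 h3]
  constructor <;> intro t ht <;> obtain ⟨V, hV, -, h0, h1, hω, -, he⟩ := h.exact t ht
  · exact key h.smooth₀ ht hV h0 hω he
  · exact key h.smooth₁ ht hV h1 hω he

/-- The two integrals differ by the change of the segment integral over `[0, 1]`, and this is zero
because everything closes up. No derivative in the homotopy parameter enters, which suits contours
that are merely continuous in `τ`. -/
theorem integral_eq (h : IsSegmentHomotopy ω c₀ c₁) :
    ∫ t in (0 : ℝ)..1, ω t (c₀ t) (velocity c₀ t) =
      ∫ t in (0 : ℝ)..1, ω t (c₁ t) (velocity c₁ t) := by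
  obtain ⟨hc0, hc1⟩ := h.continuousOn_integrand
  have hi := (hc1.sub hc0).intervalIntegrable_of_Icc (μ := volume) zero_le_one
  have hd := fun t ht => h.hasDerivWithinAt_segmentIntegral (t := t) ht
  have key := intervalIntegral.integral_eq_sub_of_hasDeriv_right_of_le zero_le_one
    (fun t ht => (hd t ht).continuousWithinAt)
    (fun t ht => ((hd t (Ioo_subset_Icc_self ht)).hasDerivAt
      (Icc_mem_nhds ht.1 ht.2)).hasDerivWithinAt) hi
  have he : segmentIntegral ω c₀ c₁ 1 = segmentIntegral ω c₀ c₁ 0 := by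
    rw [segmentIntegral, segmentIntegral, ← h.closed₀, ← h.closed₁]
    refine intervalIntegral.integral_congr fun s hs => ?_
    rw [uIcc_of_le zero_le_one] at hs
    have := h.eqOn ((convex_segment _ _).lineMap_mem (left_mem_segment ℝ _ _)
      (right_mem_segment ℝ _ _) hs)
    simp only [this]
  rw [he, sub_self, intervalIntegral.integral_sub (hc1.intervalIntegrable_of_Icc zero_le_one)
    (hc0.intervalIntegrable_of_Icc zero_le_one)] at key
  exact (sub_eq_zero.1 key).symm

end IsSegmentHomotopy

/-! ### The principal branch of the Green's function at real points -/

/-- The Green's function with real source `x`, on its main branch. -/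
def realGreen (k : ℂ) (x y : Plane) : ℂ := greenOfLog k (Real.log ‖y - x‖ : ℂ)

theorem sqNorm_toC2_sub (x y : Plane) : sqNorm (toC2 x - toC2 y) = ((‖y - x‖ ^ 2 : ℝ) : ℂ) := by
  rw [EuclideanSpace.norm_sq_eq]
  simp [sqNorm, toC2]
  ring

theorem half_log_sq {s : ℝ} (hs : 0 < s) :
    1 / 2 * Complex.log ((s ^ 2 : ℝ) : ℂ) = (Real.log s : ℂ) := by
  rw [← Complex.ofReal_log (by positivity), Real.log_pow]
  push_cast
  ring

theorem logDist_toC2_sub {x y : Plane} (h : y ≠ x) :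
    logDist 0 1 (toC2 x - toC2 y) = (Real.log ‖y - x‖ : ℂ) := by
  rw [logDist, div_one, sqNorm_toC2_sub, half_log_sq (norm_pos_iff.2 (sub_ne_zero.2 h)), zero_add]

theorem realGreen_eventuallyEq (k : ℂ) {x y : Plane} (h : y ≠ x) :
    realGreen k x =ᶠ[𝓝 y] fun y => kern k 0 1 (toC2 x - toC2 y) := by
  filter_upwards [isOpen_ne.mem_nhds h] with z hz
  rw [kern, logDist_toC2_sub hz, realGreen]

theorem sqNorm_mem_slitPlane {x y : Plane} (h : y ≠ x) :
    sqNorm (toC2 x - toC2 y) / 1 ∈ Complex.slitPlane := by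
  rw [div_one, sqNorm_toC2_sub, Complex.ofReal_mem_slitPlane]
  have := norm_pos_iff.2 (sub_ne_zero.2 h)
  positivity

theorem contDiffAt_realGreen {k : ℂ} (hk : k ≠ 0) {x y : Plane} (h : y ≠ x) :
    ContDiffAt ℝ 2 (realGreen k x) y ∧ helmholtz ℝ k (realGreen k x) y = 0 := by
  have ha := analyticAt_kern (k := k) (ℓ₀ := 0) (sqNorm_mem_slitPlane h)
  refine ⟨(contDiffAt_sub_toC2 ha).congr_of_eventuallyEq (realGreen_eventuallyEq k h), ?_⟩
  rw [helmholtz_congr (realGreen_eventuallyEq k h), helmholtz_sub_toC2 ha,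
    helmholtz_kern hk (by simp) (sqNorm_mem_slitPlane h)]

theorem fderiv_realGreen (k : ℂ) {x y : Plane} (h : y ≠ x) (w : Plane) :
    fderiv ℝ (realGreen k x) y w = greenDeriv k (Real.log ‖y - x‖ : ℂ) / ((‖y - x‖ ^ 2 : ℝ) : ℂ) *
      (((y 0 - x 0) * w 0 + (y 1 - x 1) * w 1 : ℝ) : ℂ) := by
  have hd := hasFDerivAt_kern (k := k) (ℓ₀ := 0) (sqNorm_mem_slitPlane h)
  rw [(realGreen_eventuallyEq k h).fderiv_eq, (hasFDerivAt_sub_toC2 hd.differentiableAt).fderiv]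
  rw [hd.fderiv, logDist_toC2_sub h, sqNorm_toC2_sub]
  simp [dotL_apply, toC2]
  ring

/-! ### Homotopies of closed curves with a fixed form -/

variable {G U : Plane → ℂ} {k : ℂ} {O : Set Plane} {c₀ c₁ : ℝ → Plane}

theorem continuousOn_greenForm (hG : ∀ x ∈ O, ContDiffAt ℝ 2 G x)
    (hU : ∀ x ∈ O, ContDiffAt ℝ 2 U x) : ContinuousOn (greenForm G U) O := fun x hx =>
  (differentiableAt_greenForm (hG x hx) (hU x hx)).continuousAt.continuousWithinAt

theorem integral_greenForm_eq (hO : IsOpen O)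
    (hG : ∀ x ∈ O, ContDiffAt ℝ 2 G x ∧ helmholtz ℝ k G x = 0)
    (hU : ∀ x ∈ O, ContDiffAt ℝ 2 U x ∧ helmholtz ℝ k U x = 0)
    (h₀ : ContDiffOn ℝ 1 c₀ (Icc 0 1)) (h₁ : ContDiffOn ℝ 1 c₁ (Icc 0 1)) (hc₀ : c₀ 0 = c₀ 1)
    (hc₁ : c₁ 0 = c₁ 1) (h : ∀ t ∈ Icc (0 : ℝ) 1, segment ℝ (c₀ t) (c₁ t) ⊆ O) :
    ∫ t in (0 : ℝ)..1, greenForm G U (c₀ t) (velocity c₀ t) =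
      ∫ t in (0 : ℝ)..1, greenForm G U (c₁ t) (velocity c₁ t) := by
  refine IsSegmentHomotopy.integral_eq (ω := fun _ => greenForm G U)
    ⟨h₀, h₁, hc₀, hc₁, fun t ht => ?_, fun _ _ => rfl⟩
  have hs : IsCompact (segment ℝ (c₀ t) (c₁ t)) := by
    rw [segment_eq_image_lineMap]
    exact isCompact_Icc.image AffineMap.lineMap_continuous
  obtain ⟨δ, hδ, hδO⟩ := hs.exists_thickening_subset_open hO (h t ht)
  have hsub := self_subset_thickening hδ (segment ℝ (c₀ t) (c₁ t))
  refine ⟨thickening δ (segment ℝ (c₀ t) (c₁ t)), isOpen_thickening,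
    (convex_segment _ _).thickening δ, hsub (left_mem_segment ℝ _ _),
    hsub (right_mem_segment ℝ _ _), ?_, ?_, Eventually.of_forall fun _ _ _ => rfl⟩
  · exact continuousOn_greenForm (fun x hx => (hG x (hδO hx)).1) (fun x hx => (hU x (hδO hx)).1)
  · exact exists_primitive_greenForm isOpen_thickening ((convex_segment _ _).thickening δ)
      (fun x hx => hG x (hδO hx)) (fun x hx => hU x (hδO hx))

/-! ### Polar coordinates along a curve -/

theorem exists_log_of_curve {z z' : ℝ → ℂ} (hz : ∀ t ∈ Icc (0 : ℝ) 1, z t ≠ 0)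
    (hd : ∀ t ∈ Icc (0 : ℝ) 1, HasDerivWithinAt z (z' t) (Icc 0 1) t)
    (hc : ContinuousOn z' (Icc 0 1)) :
    ∃ L : ℝ → ℂ, ContDiff ℝ 1 L ∧ L 1 - L 0 = ∫ t in (0 : ℝ)..1, z' t / z t ∧
      ∀ t ∈ Icc (0 : ℝ) 1, Complex.exp (L t) = z t ∧ HasDerivAt L (z' t / z t) t := by
  have hq : ContinuousOn (fun t => z' t / z t) (Icc 0 1) :=
    hc.div (fun t ht => (hd t ht).continuousWithinAt) hz
  -- Extended constantly beyond `[0, 1]`, the integrand has a `C¹` primitive on the whole line, with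
  -- two-sided derivatives at the end points.
  let w : ℝ → ℂ := fun t => (Icc (0 : ℝ) 1).domRestrict (fun t => z' t / z t)
    (projIcc 0 1 zero_le_one t)
  have hw : Continuous w := hq.domRestrict.comp continuous_projIcc
  have hwe : ∀ t ∈ Icc (0 : ℝ) 1, w t = z' t / z t := fun t ht => by
    simp [w, projIcc_of_mem zero_le_one ht]
  let L : ℝ → ℂ := fun t => Complex.log (z 0) + ∫ s in (0 : ℝ)..t, w s
  have hL : ∀ t, HasDerivAt L (w t) t := fun t =>
    (intervalIntegral.integral_hasDerivAt_right (hw.intervalIntegrable _ _)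
      (hw.stronglyMeasurableAtFilter _ _) hw.continuousAt).const_add _
  have h0 : (0 : ℝ) ∈ Icc (0 : ℝ) 1 := ⟨le_rfl, zero_le_one⟩
  refine ⟨L, ?_, ?_, fun t ht => ⟨?_, by rw [← hwe t ht]; exact hL t⟩⟩
  · refine contDiff_one_iff_deriv.2 ⟨fun t => (hL t).differentiableAt, ?_⟩
    rwa [show deriv L = w from funext fun t => (hL t).deriv]
  · simp only [L, intervalIntegral.integral_same, add_zero, add_sub_cancel_left]
    refine intervalIntegral.integral_congr fun t ht => ?_
    rw [uIcc_of_le zero_le_one] at ht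
    exact hwe t ht
  · have hconst := constant_of_has_deriv_right_zero (f := fun t => Complex.exp (-L t) * z t)
      (a := 0) (b := 1) (fun t ht => ((hL t).neg.cexp.continuousAt.continuousWithinAt).mul
        (hd t ht).continuousWithinAt) (fun t ht => ?_) t ht
    · have hL0 : L 0 = Complex.log (z 0) := by simp [L]
      rw [hL0, Complex.exp_neg, Complex.exp_neg, Complex.exp_log (hz 0 h0),
        inv_mul_cancel₀ (hz 0 h0)] at hconst
      field_simp [Complex.exp_ne_zero] at hconst
      exact hconst.symm
    · have ht' : t ∈ Icc (0 : ℝ) 1 := Ico_subset_Icc_self ht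
      have h1 : HasDerivWithinAt z (z' t) (Ici t) t :=
        ((hd t ht').mono_of_mem_nhdsWithin (Icc_mem_nhdsGE_of_mem ht))
      refine ((hL t).neg.cexp.hasDerivWithinAt.mul h1).congr_deriv ?_
      rw [hwe t ht']
      field_simp [hz t ht']
      ring

/-- The unit vector at angle `φ`. -/
def unitVec (φ : ℝ) : Plane :=
  Real.cos φ • EuclideanSpace.single 0 1 + Real.sin φ • EuclideanSpace.single 1 1

@[simp] theorem unitVec_zero (φ : ℝ) : unitVec φ 0 = Real.cos φ := by simp [unitVec]

@[simp] theorem unitVec_one (φ : ℝ) : unitVec φ 1 = Real.sin φ := by simp [unitVec]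

theorem norm_unitVec (φ : ℝ) : ‖unitVec φ‖ = 1 := by
  simp [EuclideanSpace.norm_eq]

theorem contDiff_unitVec : ContDiff ℝ 1 unitVec := by
  unfold unitVec
  fun_prop

/-- The derivative of `unitVec`. -/
def unitVec' (φ : ℝ) : Plane :=
  (-Real.sin φ) • EuclideanSpace.single 0 1 + Real.cos φ • EuclideanSpace.single 1 1

theorem hasDerivAt_unitVec (φ : ℝ) : HasDerivAt unitVec (unitVec' φ) φ :=
  ((Real.hasDerivAt_cos φ).smul_const _).add ((Real.hasDerivAt_sin φ).smul_const _)

theorem rotL_unitVec' (φ : ℝ) : rotL (unitVec' φ) = unitVec φ := by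
  ext i; fin_cases i <;> simp [rotL_apply, unitVec']

/-- The angle is the imaginary part of a logarithm along the curve, obtained by integrating `z' /
z`; the imaginary part of this integral is the swept angle. -/
theorem exists_angle {c : ℝ → Plane} {a : Plane} (hc : ContDiffOn ℝ 1 c (Icc 0 1))
    (ha : ∀ t ∈ Icc (0 : ℝ) 1, c t ≠ a) :
    ∃ θ : ℝ → ℝ, ContDiff ℝ 1 θ ∧ θ 1 - θ 0 = sweptAngle c a ∧
      ∀ t ∈ Icc (0 : ℝ) 1, c t = a + ‖c t - a‖ • unitVec (θ t) := by
  let ι : Plane →L[ℝ] ℂ := Complex.ofRealCLM ∘L EuclideanSpace.proj 0 +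
    Complex.I • (Complex.ofRealCLM ∘L EuclideanSpace.proj 1)
  have hι : ∀ v : Plane, ι v = v 0 + Complex.I * v 1 := fun v => rfl
  have hre : ∀ v : Plane, (ι v).re = v 0 := fun v => by simp [hι]
  have him : ∀ v : Plane, (ι v).im = v 1 := fun v => by simp [hι]
  have hnorm : ∀ v : Plane, ‖ι v‖ = ‖v‖ := fun v => by
    rw [Complex.norm_eq_sqrt_sq_add_sq, hre, him, EuclideanSpace.norm_eq]
    simp
  have hd : ∀ t ∈ Icc (0 : ℝ) 1, HasDerivWithinAt (fun t => ι (c t - a)) (ι (velocity c t))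
      (Icc 0 1) t := fun t ht =>
    ι.hasFDerivAt.comp_hasDerivWithinAt t ((hasDerivWithinAt_velocity hc ht).sub_const a)
  have hz : ∀ t ∈ Icc (0 : ℝ) 1, ι (c t - a) ≠ 0 := fun t ht => by
    rw [← norm_ne_zero_iff, hnorm, norm_ne_zero_iff]
    exact sub_ne_zero.2 (ha t ht)
  have hcont : ContinuousOn (fun t => ι (velocity c t)) (Icc 0 1) :=
    ι.continuous.comp_continuousOn (continuousOn_velocity hc)
  obtain ⟨L, hL, hL1, hLt⟩ := exists_log_of_curve hz hd hcont
  refine ⟨fun t => (L t).im, Complex.imCLM.contDiff.comp hL, ?_, fun t ht => ?_⟩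
  · have hint : IntervalIntegrable (fun t => ι (velocity c t) / ι (c t - a)) volume 0 1 :=
      (hcont.div (fun t ht => (hd t ht).continuousWithinAt) hz).intervalIntegrable_of_Icc
        zero_le_one
    have h := Complex.imCLM.intervalIntegral_comp_comm hint
    rw [← hL1] at h
    simp only [Complex.imCLM_apply, Complex.sub_im] at h
    rw [← h, sweptAngle]
    refine intervalIntegral.integral_congr fun t ht => ?_
    simp only [Complex.div_im, him, hre, ← Complex.sq_norm, hnorm]
    simp only [PiLp.sub_apply]
    ring
  · obtain ⟨he, -⟩ := hLt t ht
    have hn : ‖c t - a‖ = Real.exp (L t).re := by rw [← hnorm, ← he, Complex.norm_exp]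
    have h1 : c t 0 - a 0 = Real.exp (L t).re * Real.cos (L t).im := by
      rw [← Complex.exp_re, he, hre]; rfl
    have h2 : c t 1 - a 1 = Real.exp (L t).re * Real.sin (L t).im := by
      rw [← Complex.exp_im, he, him]; rfl
    rw [hn]
    ext i
    fin_cases i <;> simp [← h1, ← h2]

/-! ### Green's representation formula -/

section Representation

variable {U : Plane → ℂ} {k : ℂ} {θ : ℝ → ℝ}

theorem contDiff_circle (hθ : ContDiff ℝ 1 θ) (x : Plane) (ρ : ℝ) :
    ContDiff ℝ 1 fun t => x + ρ • unitVec (θ t) :=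
  contDiff_const.add ((contDiff_unitVec.comp hθ).const_smul ρ)

theorem velocity_circle (hθ : ContDiff ℝ 1 θ) (x : Plane) (ρ : ℝ) {t : ℝ}
    (ht : t ∈ Icc (0 : ℝ) 1) :
    velocity (fun t => x + ρ • unitVec (θ t)) t = (ρ * deriv θ t) • unitVec' (θ t) := by
  have hd : HasDerivAt θ (deriv θ t) t := (hθ.differentiable (by norm_num) t).hasDerivAt
  have h := (((hasDerivAt_unitVec (θ t)).scomp t hd).const_smul ρ).const_add x
  rw [velocity]
  refine (h.hasDerivWithinAt.derivWithin (uniqueDiffWithinAt_Icc ht)).trans ?_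
  rw [smul_smul]

/-- On a circle about the source `G` is constant, the rotated tangent points along the radius, and
`ρ ∂G/∂ρ` is `greenDeriv`. -/
theorem greenForm_circle (k : ℂ) (U : Plane → ℂ) (x : Plane) {ρ : ℝ} (hρ : 0 < ρ) (φ w : ℝ) :
    greenForm (realGreen k x) U (x + ρ • unitVec φ) ((ρ * w) • unitVec' φ) =
      w * (greenDeriv k (Real.log ρ : ℂ) * U (x + ρ • unitVec φ) -
        ρ * greenOfLog k (Real.log ρ : ℂ) * fderiv ℝ U (x + ρ • unitVec φ) (unitVec φ)) := by
  have hn : ‖x + ρ • unitVec φ - x‖ = ρ := by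
    rw [add_sub_cancel_left, norm_smul, norm_unitVec, mul_one, Real.norm_of_nonneg hρ.le]
  have hne : x + ρ • unitVec φ ≠ x := fun h => by
    rw [h, sub_self, norm_zero] at hn
    exact hρ.ne hn
  have hρ' : (ρ : ℂ) ≠ 0 := by exact_mod_cast hρ.ne'
  rw [greenForm_apply, map_smul, rotL_unitVec', fderiv_realGreen k hne, realGreen, hn, map_smul]
  have e : (x + ρ • unitVec φ) 0 - x 0 = ρ * Real.cos φ := by simp
  have e' : (x + ρ • unitVec φ) 1 - x 1 = ρ * Real.sin φ := by simp
  have e2 : ρ * Real.cos φ * (((ρ * w) • unitVec φ) 0) + ρ * Real.sin φ *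
      (((ρ * w) • unitVec φ) 1) = ρ ^ 2 * w := by
    simp
    linear_combination ρ ^ 2 * w * Real.cos_sq_add_sin_sq φ
  rw [e, e', e2, Complex.real_smul]
  push_cast
  field_simp

theorem tendsto_integral_circle {x : Plane} (hU : ∀ᶠ y in 𝓝 x, ContDiffAt ℝ 2 U y)
    (hk : k ≠ 0) (hθ : ContDiff ℝ 1 θ) :
    Tendsto (fun ρ : ℝ => ∫ t in (0 : ℝ)..1, greenForm (realGreen k x) U (x + ρ • unitVec (θ t))
        (velocity (fun t => x + ρ • unitVec (θ t)) t)) (𝓝[>] 0)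
      (𝓝 (1 / (2 * (Real.pi : ℂ)) * U x * (θ 1 - θ 0))) := by
  obtain ⟨ε, hε, hball⟩ := Metric.eventually_nhds_iff_ball.1 hU
  have hUx := hU.self_of_nhds
  have hUc : ContinuousAt U x := hUx.continuousAt
  have hU'c : ContinuousAt (fderiv ℝ U) x := (differentiableAt_fderiv hUx).continuousAt
  have hθ' : Continuous (deriv θ) := hθ.continuous_deriv (by norm_num)
  have hid : Tendsto (fun ρ : ℝ => ρ) (𝓝[>] 0) (𝓝 0) := nhdsWithin_le_nhds
  have hnorm : ∀ (ρ : ℝ) t, ‖ρ • unitVec (θ t)‖ = |ρ| := fun ρ t => by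
    rw [norm_smul, norm_unitVec, mul_one, Real.norm_eq_abs]
  have hpt : ∀ t, Tendsto (fun ρ : ℝ => x + ρ • unitVec (θ t)) (𝓝[>] 0) (𝓝 x) := fun t => by
    simpa using (hid.smul_const (unitVec (θ t))).const_add x
  have hlim : ∫ t in (0 : ℝ)..1, ((deriv θ t : ℝ) : ℂ) * (1 / (2 * (Real.pi : ℂ)) * U x) =
      1 / (2 * (Real.pi : ℂ)) * U x * (θ 1 - θ 0) := by
    rw [intervalIntegral.integral_mul_const, intervalIntegral.integral_ofReal,
      intervalIntegral.integral_deriv_eq_sub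
        (fun t _ => hθ.differentiable (by norm_num) t) (hθ'.intervalIntegrable 0 1)]
    push_cast
    ring
  rw [← hlim]
  obtain ⟨δ, hδ, hδU⟩ := Metric.eventually_nhds_iff_ball.1
    ((hUc.norm.eventually_lt_const (lt_add_one _)).and
      (hU'c.norm.eventually_lt_const (lt_add_one _)))
  -- As `greenDeriv → 1/(2π)` and `ρ G → 0`, while `U` and its gradient are continuous at `x`, each
  -- factor is eventually bounded by the norm of its limit plus one (by `1` for `ρ G`), up to the
  -- factor `θ'`.
  refine intervalIntegral.tendsto_integral_filter_of_dominated_convergence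
    (fun t => ‖deriv θ t‖ * ((‖1 / (2 * (Real.pi : ℂ))‖ + 1) * (‖U x‖ + 1) +
      1 * (‖fderiv ℝ U x‖ + 1))) ?_ ?_ ?_ ?_
  · filter_upwards [self_mem_nhdsWithin, hid.eventually_lt_const hε] with ρ hρ hρε
    have hρ : 0 < ρ := hρ
    have hc : ContinuousOn (fun t => greenForm (realGreen k x) U (x + ρ • unitVec (θ t))
        (velocity (fun t => x + ρ • unitVec (θ t)) t)) (Icc 0 1) := by
      refine ContinuousOn.clm_apply ?_
        (continuousOn_velocity (contDiff_circle hθ x ρ).contDiffOn)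
      refine ContinuousOn.comp (t := ball x ε \ {x}) (continuousOn_greenForm
        (fun y hy => (contDiffAt_realGreen hk hy.2).1) fun y hy => hball y hy.1)
        (contDiff_circle hθ x ρ).continuous.continuousOn fun t _ => ?_
      have h1 := hnorm ρ t
      rw [abs_of_pos hρ] at h1
      refine ⟨by simpa [dist_eq_norm, h1] using hρε, fun h => ?_⟩
      rw [add_eq_left.1 h, norm_zero] at h1
      exact hρ.ne h1
    rw [uIoc_of_le zero_le_one]
    exact (hc.mono Ioc_subset_Icc_self).aestronglyMeasurable measurableSet_Ioc
  · filter_upwards [self_mem_nhdsWithin, hid.eventually_lt_const hδ,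
      (tendsto_greenDeriv k).norm.eventually_lt_const (lt_add_one _),
      (tendsto_mul_greenOfLog k).norm.eventually_lt_const
        (show ‖(0 : ℂ)‖ < 1 by simp)] with ρ hρ hρδ h1 h2
    have hρ : 0 < ρ := hρ
    refine Eventually.of_forall fun t ht => ?_
    rw [uIoc_of_le zero_le_one] at ht
    rw [velocity_circle hθ x ρ (Ioc_subset_Icc_self ht), greenForm_circle k U x hρ]
    obtain ⟨h3, h4⟩ := hδU (x + ρ • unitVec (θ t)) (by
      rw [mem_ball, dist_eq_norm, add_sub_cancel_left, hnorm, abs_of_pos hρ]; exact hρδ)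
    rw [norm_mul, Complex.norm_real]
    gcongr
    refine (norm_sub_le _ _).trans ?_
    rw [norm_mul, norm_mul _ (fderiv ℝ U _ _)]
    have h5 : ‖fderiv ℝ U (x + ρ • unitVec (θ t)) (unitVec (θ t))‖ ≤ ‖fderiv ℝ U x‖ + 1 := by
      refine (ContinuousLinearMap.le_opNorm _ _).trans ?_
      rw [norm_unitVec, mul_one]
      exact h4.le
    gcongr
  · exact (Continuous.intervalIntegrable (by fun_prop) _ _)
  · refine Eventually.of_forall fun t ht => ?_
    rw [uIoc_of_le zero_le_one] at ht
    have h1 := (tendsto_greenDeriv k).mul (hUc.tendsto.comp (hpt t))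
    have h2 := (tendsto_mul_greenOfLog k).mul
      (((ContinuousLinearMap.apply ℝ ℂ (unitVec (θ t))).continuous.tendsto _).comp
        (hU'c.tendsto.comp (hpt t)))
    have h3 := (h1.sub h2).const_mul ((deriv θ t : ℝ) : ℂ)
    rw [zero_mul, sub_zero] at h3
    refine h3.congr' ?_
    filter_upwards [self_mem_nhdsWithin] with ρ hρ
    rw [velocity_circle hθ x ρ (Ioc_subset_Icc_self ht), greenForm_circle k U x hρ]
    rfl

/-- The curve is contracted radially to a circle about `a`, which is then moved to a small circle
about `x`, whose radius tends to zero. Both circles use the angle function of the curve itself, so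
corresponding points are joined by segments avoiding `x`. -/
theorem exists_radius_representation {D : Set Plane} {a : Plane} {c : ℝ → Plane}
    (hD : IsOpen D) (hDa : StarConvex ℝ a D) (ha : a ∈ D) (hk : k ≠ 0)
    (hU : ∀ x ∈ D, ContDiffAt ℝ 2 U x ∧ helmholtz ℝ k U x = 0)
    (hc : ContDiffOn ℝ 1 c (Icc 0 1)) (hc01 : c 0 = c 1) (hcD : ∀ t ∈ Icc (0 : ℝ) 1, c t ∈ D)
    (hca : ∀ t ∈ Icc (0 : ℝ) 1, c t ≠ a) (hw : sweptAngle c a = 2 * Real.pi) :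
    ∃ ε > 0, ∀ x ∈ ball a ε,
      ∫ t in (0 : ℝ)..1, greenForm (realGreen k x) U (c t) (velocity c t) = U x := by
  obtain ⟨θ, hθ, hθ01, hcθ⟩ := exists_angle hc hca
  rw [hw] at hθ01
  obtain ⟨ε₁, hε₁, hε₁c⟩ : ∃ ε > 0, ∀ t ∈ Icc (0 : ℝ) 1, ε ≤ ‖c t - a‖ := by
    obtain ⟨t₀, ht₀, hmin⟩ := isCompact_Icc.exists_isMinOn (nonempty_Icc.2 zero_le_one)
      ((hc.continuousOn.sub continuousOn_const).norm)
    exact ⟨_, norm_pos_iff.2 (sub_ne_zero.2 (hca t₀ ht₀)), fun t ht => hmin ht⟩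
  obtain ⟨ε₂, hε₂, hε₂D⟩ := Metric.nhds_basis_closedBall.mem_iff.1 (hD.mem_nhds ha)
  obtain ⟨ε, hε, h1, h2⟩ : ∃ ε > 0, ε ≤ ε₁ ∧ ε ≤ ε₂ :=
    ⟨min ε₁ ε₂, lt_min hε₁ hε₂, min_le_left _ _, min_le_right _ _⟩
  refine ⟨ε, hε, fun x hx => ?_⟩
  rw [mem_ball, dist_eq_norm] at hx
  set O : Set Plane := D \ {x}
  have hO : IsOpen O := hD.sdiff isClosed_singleton
  have hG : ∀ y ∈ O, ContDiffAt ℝ 2 (realGreen k x) y ∧ helmholtz ℝ k (realGreen k x) y = 0 :=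
    fun y hy => contDiffAt_realGreen hk hy.2
  have hUO : ∀ y ∈ O, ContDiffAt ℝ 2 U y ∧ helmholtz ℝ k U y = 0 := fun y hy => hU y hy.1
  have hper : unitVec (θ 0) = unitVec (θ 1) := by
    rw [show θ 1 = θ 0 + 2 * Real.pi by linarith]
    simp [unitVec]
  have step1 := integral_greenForm_eq hO hG hUO hc (contDiff_circle hθ a ε).contDiffOn hc01
    (by simp only [hper]) (fun t ht y hy => by
      have hR := hε₁c t ht
      have hct := hcθ t ht
      have hcirc : a + ε • unitVec (θ t) ∈ segment ℝ a (c t) := by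
        refine ⟨1 - ε / ‖c t - a‖, ε / ‖c t - a‖, ?_, by positivity, by ring, ?_⟩
        · rw [sub_nonneg, div_le_one (hε₁.trans_le hR)]
          exact h1.trans hR
        · have hR0 : ‖c t - a‖ ≠ 0 := (hε₁.trans_le hR).ne'
          nth_rewrite 3 [hct]
          rw [smul_add, smul_smul, div_mul_cancel₀ _ hR0, ← add_assoc, ← add_smul]
          simp
      refine ⟨hDa.segment_subset (hcD t ht) ((convex_segment _ _).segment_subset
        (right_mem_segment ℝ _ _) hcirc hy), fun hyx => ?_⟩
      -- Points of the radial segment are at distance at least `ε` from `a`, whereas `x` is nearer.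
      obtain ⟨α, β, hα, hβ, hαβ, rfl⟩ := hy
      have e : α • c t + β • (a + ε • unitVec (θ t)) - a =
          (α * ‖c t - a‖ + β * ε) • unitVec (θ t) := by
        nth_rewrite 1 [hct]
        rw [show β = 1 - α by linarith]
        module
      rw [mem_singleton_iff] at hyx
      rw [hyx] at e
      rw [e, norm_smul, norm_unitVec, mul_one, Real.norm_of_nonneg (by positivity)] at hx
      nlinarith)
  have step2 : ∀ ρ > 0, ‖x - a‖ + ρ ≤ ε → _ := fun ρ hρ hρε =>
    integral_greenForm_eq hO hG hUO (contDiff_circle hθ a ε).contDiffOn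
      (contDiff_circle hθ x ρ).contDiffOn (by simp only [hper]) (by simp only [hper])
      (fun t ht y hy => by
        have hy1 : y ∈ closedBall a ε := by
          refine (convex_closedBall a ε).segment_subset ?_ ?_ hy
          · rw [mem_closedBall, dist_eq_norm, add_sub_cancel_left, norm_smul, norm_unitVec,
              mul_one, Real.norm_of_nonneg hε.le]
          · rw [mem_closedBall, dist_eq_norm, add_sub_right_comm]
            refine (norm_add_le _ _).trans ?_
            rwa [norm_smul, norm_unitVec, mul_one, Real.norm_of_nonneg hρ.le]
        refine ⟨hε₂D (closedBall_subset_closedBall h2 hy1), fun hyx => ?_⟩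
        -- If the segment met `x`, taking norms would give `αε + βρ = α‖x - a‖ ≤ α(ε - ρ)`. This
        -- forces `β = 0` and then `‖x - a‖ = ε`, contrary to `ρ > 0`.
        obtain ⟨α, β, hα, hβ, hαβ, rfl⟩ := hy
        have e : (α * ε + β * ρ) • unitVec (θ t) = α • (x - a) := by
          have : α • (a + ε • unitVec (θ t)) + β • (x + ρ • unitVec (θ t)) = x := hyx
          rw [show β = 1 - α by linarith] at this ⊢
          rw [← sub_eq_zero] at this ⊢
          rw [← this]
          module
        have e := congrArg norm e
        rw [norm_smul, norm_smul, norm_unitVec, mul_one, Real.norm_of_nonneg (by positivity),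
          Real.norm_of_nonneg hα] at e
        have h3 : β * ρ ≤ 0 := by nlinarith
        have h4 : β = 0 := by nlinarith
        rw [h4, show α = 1 by linarith] at e
        linarith)
  have hxD : x ∈ D := hε₂D (by rw [mem_closedBall, dist_eq_norm]; linarith)
  have hlim := tendsto_integral_circle (U := U) (x := x)
    (by filter_upwards [hD.mem_nhds hxD] with y hy using (hU y hy).1) hk hθ
  have hconst : (fun ρ : ℝ => ∫ t in (0 : ℝ)..1, greenForm (realGreen k x) U
      (x + ρ • unitVec (θ t)) (velocity (fun t => x + ρ • unitVec (θ t)) t)) =ᶠ[𝓝[>] 0]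
      fun _ => ∫ t in (0 : ℝ)..1, greenForm (realGreen k x) U (c t) (velocity c t) := by
    filter_upwards [Ioc_mem_nhdsGT (show (0 : ℝ) < ε - ‖x - a‖ by linarith)] with ρ hρ
    rw [step1, ← step2 ρ hρ.1 (by linarith [hρ.2])]
  rw [tendsto_nhds_unique (tendsto_const_nhds.congr' hconst.symm) hlim, ← Complex.ofReal_sub, hθ01]
  have hpi : (Real.pi : ℂ) ≠ 0 := by exact_mod_cast Real.pi_ne_zero
  push_cast
  field_simp

end Representation

/-! ### Continuous logarithms -/

theorem eqOn_of_exp_eq {A : Type*} [TopologicalSpace A] {V : Set A} (hV : IsPreconnected V)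
    {g₁ g₂ : A → ℂ} (h₁ : ContinuousOn g₁ V) (h₂ : ContinuousOn g₂ V)
    (he : ∀ a ∈ V, Complex.exp (g₁ a) = Complex.exp (g₂ a)) {a₀ : A} (ha₀ : a₀ ∈ V)
    (h₀ : g₁ a₀ = g₂ a₀) : EqOn g₁ g₂ V :=
  eqOn_of_lift Complex.isCoveringMapOn_exp hV h₁ h₂ he (fun _ _ => Complex.exp_ne_zero _) ha₀ h₀

theorem isPreconnected_square : IsPreconnected (Icc (0 : ℝ) 1 ×ˢ Icc (0 : ℝ) 1) :=
  ((convex_Icc 0 1).prod (convex_Icc 0 1)).isPreconnected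

/-- The retraction of the plane onto the unit square. -/
def squareProj (p : ℝ × ℝ) : ℝ × ℝ :=
  (projIcc (0 : ℝ) 1 zero_le_one p.1, projIcc (0 : ℝ) 1 zero_le_one p.2)

theorem continuous_squareProj : Continuous squareProj :=
  (continuous_subtype_val.comp (continuous_projIcc.comp continuous_fst)).prodMk
    (continuous_subtype_val.comp (continuous_projIcc.comp continuous_snd))

theorem squareProj_mem (p : ℝ × ℝ) : squareProj p ∈ Icc (0 : ℝ) 1 ×ˢ Icc (0 : ℝ) 1 :=
  ⟨Subtype.coe_prop _, Subtype.coe_prop _⟩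

theorem squareProj_eq {p : ℝ × ℝ} (hp : p ∈ Icc (0 : ℝ) 1 ×ˢ Icc (0 : ℝ) 1) :
    squareProj p = p := by
  simp only [squareProj, projIcc_of_mem zero_le_one hp.1, projIcc_of_mem zero_le_one hp.2]

/-- Composition with the retraction `squareProj` gives a nonvanishing continuous function on the
whole plane, which is open and simply connected. The constant added to its logarithm has exponential
one. -/
theorem exists_log_on_square {F : ℝ × ℝ → ℂ} (hF : ContinuousOn F (Icc 0 1 ×ˢ Icc 0 1))
    (h0 : ∀ p ∈ Icc (0 : ℝ) 1 ×ˢ Icc (0 : ℝ) 1, F p ≠ 0) {w : ℂ}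
    (hw : Complex.exp w = F (0, 0)) :
    ∃ f : ℝ × ℝ → ℂ, ContinuousOn f (Icc 0 1 ×ˢ Icc 0 1) ∧ f (0, 0) = w ∧
      ∀ p ∈ Icc (0 : ℝ) 1 ×ˢ Icc (0 : ℝ) 1, Complex.exp (f p) = F p := by
  have hsc : IsSimplyConnected (univ : Set (ℝ × ℝ)) := by
    have := (convex_univ (𝕜 := ℝ) (E := ℝ × ℝ)).contractibleSpace univ_nonempty
    exact SimplyConnectedSpace.ofContractible _
  obtain ⟨f, hf, hfe⟩ := Complex.exists_continuousOn_eqOn_exp_comp hsc isOpen_univ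
    (g := F ∘ squareProj)
    (hF.comp_continuous continuous_squareProj squareProj_mem).continuousOn
    (by rintro ⟨p, -, hp⟩; exact h0 _ (squareProj_mem p) hp)
  have h00 : ((0 : ℝ), (0 : ℝ)) ∈ Icc (0 : ℝ) 1 ×ˢ Icc (0 : ℝ) 1 := by simp
  refine ⟨fun p => f p + (w - f (0, 0)), (hf.mono (subset_univ _)).add continuousOn_const,
    by ring, fun p hp => ?_⟩
  have h1 : Complex.exp (f p) = F p := by simpa [squareProj_eq hp] using hfe (mem_univ p)
  have h2 : Complex.exp (f (0, 0)) = F (0, 0) := by simpa [squareProj_eq h00] using hfe (mem_univ (0, 0))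
  rw [Complex.exp_add, Complex.exp_sub, hw, h1, h2, div_self (h0 _ h00), mul_one]

/-! ### Branches of the logarithm of the distance -/

/-- The sum of squares is a product of two linear factors. As `x` is real, the real and imaginary
parts of the vanishing factor determine both coordinates of `x`. -/
theorem eq_realPoint_of_sqDist_eq_zero {r : C2} {x : Plane} (h : sqDist r x = 0) :
    realPoint₁ r = x ∨ realPoint₂ r = x := by
  have e : ((r 0 - (x 0 : ℂ)) + Complex.I * (r 1 - (x 1 : ℂ))) *
      ((r 0 - (x 0 : ℂ)) - Complex.I * (r 1 - (x 1 : ℂ))) = 0 := by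
    rw [← h, sqDist]
    linear_combination (-(r 1 - (x 1 : ℂ)) ^ 2) * Complex.I_sq
  rcases mul_eq_zero.1 e with h | h
  · left
    have h1 := congrArg Complex.re h
    have h2 := congrArg Complex.im h
    simp at h1 h2
    ext i; fin_cases i <;> simp [realPoint₁] <;> linarith
  · right
    have h1 := congrArg Complex.re h
    have h2 := congrArg Complex.im h
    simp at h1 h2
    ext i; fin_cases i <;> simp [realPoint₂] <;> linarith

theorem norm_toC2 (x : Plane) : ‖toC2 x‖ = ‖x‖ := by
  simp [EuclideanSpace.norm_eq, toC2]

theorem toC2_sub (x y : Plane) : toC2 (x - y) = toC2 x - toC2 y := map_sub toC2L x y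

theorem sqDist_toC2 (a x : Plane) : sqDist (toC2 a) x = ((‖x - a‖ ^ 2 : ℝ) : ℂ) := by
  rw [sqDist_eq, sqNorm_toC2_sub]

theorem continuous_sqDist : Continuous fun p : C2 × Plane => sqDist p.1 p.2 := by
  unfold sqDist
  fun_prop

section Branch

variable {S : Type*} [TopologicalSpace S] {ψ : S → Plane} {A : ℝ → C2} {Γ : ℝ → ℝ → S}

theorem continuousOn_sqDist (hψ : Continuous ψ) (hA : ContinuousOn A (Icc 0 1))
    (hΓ : ContinuousOn (fun p : ℝ × ℝ => Γ p.1 p.2) (Icc 0 1 ×ˢ Icc 0 1)) :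
    ContinuousOn (fun p : ℝ × ℝ => sqDist (A p.1) (ψ (Γ p.1 p.2))) (Icc 0 1 ×ˢ Icc 0 1) := by
  have h1 : ContinuousOn (fun p : ℝ × ℝ => A p.1) (Icc 0 1 ×ˢ Icc 0 1) :=
    hA.comp (f := fun p : ℝ × ℝ => p.1) continuousOn_fst fun _ hp => hp.1
  have h2 : ContinuousOn (fun p : ℝ × ℝ => ψ (Γ p.1 p.2)) (Icc 0 1 ×ˢ Icc 0 1) :=
    hψ.comp_continuousOn hΓ
  exact (continuous_sqDist.comp_continuousOn (h1.prodMk h2)).congr fun _ _ => rfl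

theorem exp_two_mul_log {s : ℝ} (hs : 0 < s) :
    Complex.exp (2 * (Real.log s : ℂ)) = ((s ^ 2 : ℝ) : ℂ) := by
  rw [two_mul, Complex.exp_add, ← Complex.ofReal_exp, Real.exp_log hs]
  push_cast
  ring

theorem exists_isLogDistBranch (hψ : Continuous ψ) {a : Plane} (hA : ContinuousOn A (Icc 0 1))
    (hA0 : A 0 = toC2 a)
    (hΓ : ContinuousOn (fun p : ℝ × ℝ => Γ p.1 p.2) (Icc 0 1 ×ˢ Icc 0 1))
    (hne : ∀ τ ∈ Icc (0 : ℝ) 1, ∀ t ∈ Icc (0 : ℝ) 1, sqDist (A τ) (ψ (Γ τ t)) ≠ 0) :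
    ∃ ℓ, IsLogDistBranch ψ A Γ ℓ := by
  have h00 : (0 : ℝ) ∈ Icc (0 : ℝ) 1 := ⟨le_rfl, zero_le_one⟩
  have hpos : ∀ t ∈ Icc (0 : ℝ) 1, 0 < ‖A 0 - toC2 (ψ (Γ 0 t))‖ := fun t ht => by
    rw [norm_pos_iff, sub_ne_zero]
    intro h
    apply hne 0 h00 t ht
    rw [sqDist_eq, h, sub_self]
    simp [sqNorm]
  have hsq : ∀ t ∈ Icc (0 : ℝ) 1, Complex.exp (2 * (Real.log ‖A 0 - toC2 (ψ (Γ 0 t))‖ : ℂ)) =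
      sqDist (A 0) (ψ (Γ 0 t)) := fun t ht => by
    rw [exp_two_mul_log (hpos t ht), hA0, sqDist_toC2, ← toC2_sub, norm_toC2, norm_sub_rev]
  obtain ⟨f, hf, hf0, hfe⟩ := exists_log_on_square (continuousOn_sqDist hψ hA hΓ)
    (fun p hp => hne p.1 hp.1 p.2 hp.2) (hsq 0 h00)
  refine ⟨fun τ t => 1 / 2 * f (τ, t), continuousOn_const.mul hf, fun τ hτ t ht => ?_, ?_⟩
  · rw [← mul_assoc, mul_one_div_cancel two_ne_zero, one_mul, hfe _ ⟨hτ, ht⟩]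
  -- On the edge `τ = 0`, `f` and twice the real logarithm are continuous logarithms of the same
  -- function and agree at `t = 0`.
  · have hc1 : ContinuousOn (fun t => f (0, t)) (Icc 0 1) :=
      hf.comp (by fun_prop) fun t ht => ⟨h00, ht⟩
    have hcΓ : ContinuousOn (fun t => Γ 0 t) (Icc 0 1) :=
      hΓ.comp (f := fun t : ℝ => ((0 : ℝ), t)) (by fun_prop) fun t ht => ⟨h00, ht⟩
    have hc2 : ContinuousOn (fun t => 2 * (Real.log ‖A 0 - toC2 (ψ (Γ 0 t))‖ : ℂ)) (Icc 0 1) :=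
      continuousOn_const.mul (Complex.continuous_ofReal.comp_continuousOn
        (((continuous_sub_toC2 (A 0)).comp_continuousOn (hψ.comp_continuousOn hcΓ)).norm.log
          fun t ht => (hpos t ht).ne'))
    have := eqOn_of_exp_eq isPreconnected_Icc hc1 hc2
      (fun t ht => by rw [hfe _ ⟨h00, ht⟩, hsq t ht]) h00 hf0
    intro t ht
    have ht' : f (0, t) = 2 * (Real.log ‖A 0 - toC2 (ψ (Γ 0 t))‖ : ℂ) := this ht
    rw [ht']
    ring

end Branch

section Uniqueness

variable {S : Type*} {ψ : S → Plane} {A : ℝ → C2} {Γ : ℝ → ℝ → S} {ℓ ℓ' : ℝ → ℝ → ℂ}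

theorem IsLogDistBranch.unique (h : IsLogDistBranch ψ A Γ ℓ) (h' : IsLogDistBranch ψ A Γ ℓ') :
    ∀ τ ∈ Icc (0 : ℝ) 1, ∀ t ∈ Icc (0 : ℝ) 1, ℓ' τ t = ℓ τ t := by
  intro τ hτ t ht
  have h00 : ((0 : ℝ), (0 : ℝ)) ∈ Icc (0 : ℝ) 1 ×ˢ Icc (0 : ℝ) 1 := by simp
  have := eqOn_of_exp_eq (g₁ := fun p : ℝ × ℝ => 2 * ℓ' p.1 p.2)
    (g₂ := fun p : ℝ × ℝ => 2 * ℓ p.1 p.2) isPreconnected_square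
    (continuousOn_const.mul h'.continuousOn) (continuousOn_const.mul h.continuousOn)
    (fun p hp => by simp only [h'.exp_eq _ hp.1 _ hp.2, h.exp_eq _ hp.1 _ hp.2]) h00
    (by simp only [h'.initial 0 h00.1, h.initial 0 h00.1])
  exact mul_left_cancel₀ two_ne_zero (this (show (τ, t) ∈ _ from ⟨hτ, ht⟩))

/-- The values at `t = 0` and `t = 1` continue the same function of `τ` from the same real number,
so no period is picked up around the contour. -/
theorem IsLogDistBranch.closed (h : IsLogDistBranch ψ A Γ ℓ)
    (hΓ : ∀ τ ∈ Icc (0 : ℝ) 1, Γ τ 0 = Γ τ 1) : ∀ τ ∈ Icc (0 : ℝ) 1, ℓ τ 0 = ℓ τ 1 := by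
  intro τ hτ
  have h0 : (0 : ℝ) ∈ Icc (0 : ℝ) 1 := ⟨le_rfl, zero_le_one⟩
  have h1 : (1 : ℝ) ∈ Icc (0 : ℝ) 1 := ⟨zero_le_one, le_rfl⟩
  have hc : ∀ t ∈ Icc (0 : ℝ) 1, ContinuousOn (fun τ => 2 * ℓ τ t) (Icc 0 1) := fun t ht =>
    continuousOn_const.mul (h.continuousOn.comp (f := fun τ : ℝ => (τ, t)) (by fun_prop)
      fun τ hτ => ⟨hτ, ht⟩)
  have := eqOn_of_exp_eq isPreconnected_Icc (hc 0 h0) (hc 1 h1)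
    (fun τ hτ => by rw [h.exp_eq τ hτ 0 h0, h.exp_eq τ hτ 1 h1, hΓ τ hτ]) h0
    (by simp only [h.initial 0 h0, h.initial 1 h1, hΓ 0 h0])
  exact mul_left_cancel₀ two_ne_zero (this hτ)

end Uniqueness

theorem mem_slitPlane_of_norm_sub_one_lt {z : ℂ} (h : ‖z - 1‖ < 1 / 2) :
    z ∈ Complex.slitPlane ∧ |z.arg| < Real.pi / 2 := by
  have h1 : 0 < z.re := by
    have := (Complex.abs_re_le_norm (z - 1)).trans_lt h
    rw [abs_lt, Complex.sub_re, Complex.one_re] at this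
    linarith [this.1]
  exact ⟨Or.inl h1, Complex.abs_arg_lt_pi_div_two_iff.2 (Or.inl h1)⟩

/-- Nearby logarithms of the distance define the same branch. -/
theorem logDist_eq_logDist {ℓ ℓ' Q₀ Q₀' : ℂ} {v : C2} (h : Complex.exp (2 * ℓ) = Q₀)
    (h' : Complex.exp (2 * ℓ') = Q₀') (hv : ‖sqNorm v / Q₀ - 1‖ < 1 / 2)
    (hv' : ‖sqNorm v / Q₀' - 1‖ < 1 / 2) (hℓ : ‖ℓ - ℓ'‖ < 1 / 2) :
    logDist ℓ Q₀ v = logDist ℓ' Q₀' v := by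
  obtain ⟨hs, ha⟩ := mem_slitPlane_of_norm_sub_one_lt hv
  obtain ⟨hs', ha'⟩ := mem_slitPlane_of_norm_sub_one_lt hv'
  have e : Complex.exp (2 * logDist ℓ Q₀ v) = Complex.exp (2 * logDist ℓ' Q₀' v) := by
    rw [exp_logDist h hs, exp_logDist h' hs']
  obtain ⟨n, hn⟩ := Complex.exp_eq_exp_iff_exists_int.1 e
  have him := congrArg Complex.im hn
  have hi := (Complex.abs_im_le_norm (ℓ - ℓ')).trans_lt hℓ
  rw [Complex.sub_im] at hi
  simp [logDist, Complex.log_im] at him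
  rw [abs_lt] at ha ha' hi
  have hpi := Real.pi_gt_three
  -- `2πn` is made up of `2 Im (ℓ - ℓ')`, of modulus below `1`, and a difference of two arguments,
  -- of modulus below `π`; and `1 + π < 2π`.
  have hn0 : n = 0 := by
    have h1 : (n : ℝ) < 1 := by
      by_contra hc
      push Not at hc
      nlinarith [ha.1, ha.2, ha'.1, ha'.2, hi.1, hi.2]
    have h2 : (-1 : ℝ) < n := by
      by_contra hc
      push Not at hc
      nlinarith [ha.1, ha.2, ha'.1, ha'.2, hi.1, hi.2]
    have h1 : n < 1 := by exact_mod_cast h1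
    have h2 : -1 < n := by exact_mod_cast h2
    omega
  rw [hn0] at hn
  exact mul_left_cancel₀ two_ne_zero (by simpa using hn)

/-! ### Linear changes in the Helmholtz equation -/

theorem helmholtz_comp_sub (k : ℂ) (f : C2 → ℂ) (w r : C2) :
    helmholtz ℂ k (fun s => f (s - w)) r = helmholtz ℂ k f (r - w) := by
  have h (g : C2 → ℂ) (i : Fin 2) :
      pderiv ℂ i (fun s => g (s - w)) = fun s => pderiv ℂ i g (s - w) := by
    funext s
    rw [pderiv, fderiv_comp_sub, pderiv]
  simp only [helmholtz, h]

theorem helmholtz_combination {k : ℂ} {f g : C2 → ℂ} {v : C2} (hf : AnalyticAt ℂ f v)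
    (hg : AnalyticAt ℂ g v) (a b : ℂ) :
    helmholtz ℂ k (fun w => f w * a - b * g w) v =
      helmholtz ℂ k f v * a - b * helmholtz ℂ k g v := by
  have h1 {f g : C2 → ℂ} {v : C2} (hf : AnalyticAt ℂ f v) (hg : AnalyticAt ℂ g v) (i : Fin 2) :
      pderiv ℂ i (fun w => f w * a - b * g w) v = pderiv ℂ i f v * a - b * pderiv ℂ i g v := by
    have h := ((hf.differentiableAt.hasFDerivAt.mul_const a).sub
      (hg.differentiableAt.hasFDerivAt.const_mul b)).fderiv
    refine (congrArg (fun T : C2 →L[ℂ] ℂ => T (EuclideanSpace.single i 1)) h).trans ?_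
    simp [pderiv, mul_comm]
  have h2 (i : Fin 2) : pderiv ℂ i (pderiv ℂ i fun w => f w * a - b * g w) v =
      pderiv ℂ i (pderiv ℂ i f) v * a - b * pderiv ℂ i (pderiv ℂ i g) v := by
    have e : pderiv ℂ i (fun w => f w * a - b * g w) =ᶠ[𝓝 v]
        fun w => pderiv ℂ i f w * a - b * pderiv ℂ i g w := by
      filter_upwards [hf.eventually_analyticAt, hg.eventually_analyticAt] with w hw1 hw2
      exact h1 hw1 hw2 i
    rw [(pderiv_congr i e).eq_of_nhds]
    exact h1 (hf.fderiv_apply _) (hg.fderiv_apply _) i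
  simp only [helmholtz, h2]
  ring

/-! ### Sheets and branches along the moving contour -/

section Uniform

variable {S : Type*} [TopologicalSpace S] {ψ : S → Plane} {P : Finset Plane} {A : ℝ → C2}
  {Γ : ℝ → ℝ → S} {ℓ : ℝ → ℝ → ℂ} {sec : S → Plane → S} {δ ρ ν : ℝ}

/-- Uniform constants for the moving contour: `ρ` is a radius on which the sheets and the branches
of the Green's function are defined when the first argument of the latter is `δ`-close to the path,
and `ν` is a distance of parameters for which they are consistent. -/
structure IsUniform (ψ : S → Plane) (P : Finset Plane) (A : ℝ → C2) (Γ : ℝ → ℝ → S)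
    (ℓ : ℝ → ℝ → ℂ) (sec : S → Plane → S) (δ ρ ν : ℝ) : Prop where
  isSection : ∀ τ ∈ Icc (0 : ℝ) 1, ∀ t ∈ Icc (0 : ℝ) 1,
    IsSection ψ P (sec (Γ τ t)) (ball (ψ (Γ τ t)) ρ)
  sec_apply : ∀ τ ∈ Icc (0 : ℝ) 1, ∀ t ∈ Icc (0 : ℝ) 1, sec (Γ τ t) (ψ (Γ τ t)) = Γ τ t
  ratio : ∀ τ ∈ Icc (0 : ℝ) 1, ∀ t ∈ Icc (0 : ℝ) 1, ∀ r ∈ ball (A τ) δ,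
    ∀ x ∈ ball (ψ (Γ τ t)) ρ, ‖sqDist r x / sqDist (A τ) (ψ (Γ τ t)) - 1‖ < 1 / 2
  sec_eqOn : ∀ p ∈ Icc (0 : ℝ) 1 ×ˢ Icc (0 : ℝ) 1, ∀ p' ∈ Icc (0 : ℝ) 1 ×ˢ Icc (0 : ℝ) 1,
    dist p p' < ν → EqOn (sec (Γ p.1 p.2)) (sec (Γ p'.1 p'.2))
      (ball (ψ (Γ p.1 p.2)) ρ ∩ ball (ψ (Γ p'.1 p'.2)) ρ)
  proj_near : ∀ p ∈ Icc (0 : ℝ) 1 ×ˢ Icc (0 : ℝ) 1, ∀ p' ∈ Icc (0 : ℝ) 1 ×ˢ Icc (0 : ℝ) 1,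
    dist p p' < ν → dist (ψ (Γ p.1 p.2)) (ψ (Γ p'.1 p'.2)) < ρ / 2
  log_near : ∀ p ∈ Icc (0 : ℝ) 1 ×ˢ Icc (0 : ℝ) 1, ∀ p' ∈ Icc (0 : ℝ) 1 ×ˢ Icc (0 : ℝ) 1,
    dist p p' < ν → ‖ℓ p.1 p.2 - ℓ p'.1 p'.2‖ < 1 / 2

/-- The ratio is jointly continuous in displacement and parameters and equals `1` at zero
displacement, so compactness yields `ε`. The bound `1 / 2` keeps it in the right half-plane, away
from the cut of the logarithm in `greenBranch`. -/
theorem exists_ratio (hψ : Continuous ψ) (hA : ContinuousOn A (Icc 0 1))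
    (hΓ : ContinuousOn (fun p : ℝ × ℝ => Γ p.1 p.2) (Icc 0 1 ×ˢ Icc 0 1))
    (hne : ∀ τ ∈ Icc (0 : ℝ) 1, ∀ t ∈ Icc (0 : ℝ) 1, sqDist (A τ) (ψ (Γ τ t)) ≠ 0) :
    ∃ ε > 0, ∀ τ ∈ Icc (0 : ℝ) 1, ∀ t ∈ Icc (0 : ℝ) 1, ∀ r ∈ ball (A τ) ε,
      ∀ x ∈ ball (ψ (Γ τ t)) ε, ‖sqDist r x / sqDist (A τ) (ψ (Γ τ t)) - 1‖ < 1 / 2 := by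
  let a : ℝ × ℝ → C2 := fun p => A (squareProj p).1
  let c : ℝ × ℝ → Plane := fun p => ψ (Γ (squareProj p).1 (squareProj p).2)
  have ha : Continuous a := hA.comp_continuous (continuous_fst.comp continuous_squareProj)
    fun p => (squareProj_mem p).1
  have hc : Continuous c := hψ.comp (hΓ.comp_continuous continuous_squareProj squareProj_mem)
  let H : (C2 × Plane) × (ℝ × ℝ) → ℂ := fun z =>
    sqDist (a z.2 + z.1.1) (c z.2 + z.1.2) / sqDist (a z.2) (c z.2)
  have hH : Continuous H := by
    refine Continuous.div ?_ ?_ fun z =>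
      hne _ (squareProj_mem z.2).1 _ (squareProj_mem z.2).2
    · have h : Continuous fun z : (C2 × Plane) × (ℝ × ℝ) => (a z.2 + z.1.1, c z.2 + z.1.2) := by
        fun_prop
      exact (continuous_sqDist.comp h).congr fun _ => rfl
    · have h : Continuous fun z : (C2 × Plane) × (ℝ × ℝ) => (a z.2, c z.2) := by fun_prop
      exact (continuous_sqDist.comp h).congr fun _ => rfl
  have hev : ∀ᶠ z in 𝓝 (0 : C2 × Plane), ∀ p ∈ Icc (0 : ℝ) 1 ×ˢ Icc (0 : ℝ) 1,
      ‖H (z, p) - 1‖ < 1 / 2 := by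
    refine (isCompact_Icc.prod isCompact_Icc).eventually_forall_of_forall_eventually
      fun p hp => ?_
    have hH1 : Continuous fun z => ‖H z - 1‖ := (hH.sub continuous_const).norm
    refine hH1.continuousAt.eventually_lt_const ?_
    have h1 : H ((0 : C2 × Plane), p) = 1 := by
      simp only [H, Prod.fst_zero, Prod.snd_zero, add_zero]
      exact div_self (hne _ (squareProj_mem p).1 _ (squareProj_mem p).2)
    simp [h1]
  obtain ⟨ε, hε, hball⟩ := Metric.eventually_nhds_iff_ball.1 hev
  refine ⟨ε, hε, fun τ hτ t ht r hr x hx => ?_⟩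
  have hp : (τ, t) ∈ Icc (0 : ℝ) 1 ×ˢ Icc (0 : ℝ) 1 := ⟨hτ, ht⟩
  have h := hball (r - A τ, x - ψ (Γ τ t)) (by
    rw [mem_ball, dist_zero_right, Prod.norm_def]
    exact max_lt (by rwa [mem_ball, dist_eq_norm] at hr) (by rwa [mem_ball, dist_eq_norm] at hx))
    (τ, t) hp
  simpa only [H, a, c, squareProj_eq hp, add_sub_cancel] using h

theorem exists_isUniform (hψ : Continuous ψ) (hcov : IsCoveringMapOn ψ {x | x ∉ P})
    (hA : ContinuousOn A (Icc 0 1))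
    (hΓ : ContinuousOn (fun p : ℝ × ℝ => Γ p.1 p.2) (Icc 0 1 ×ˢ Icc 0 1))
    (hΓP : ∀ τ ∈ Icc (0 : ℝ) 1, ∀ t ∈ Icc (0 : ℝ) 1, ψ (Γ τ t) ∉ P)
    (hne : ∀ τ ∈ Icc (0 : ℝ) 1, ∀ t ∈ Icc (0 : ℝ) 1, sqDist (A τ) (ψ (Γ τ t)) ≠ 0)
    (hℓ : IsLogDistBranch ψ A Γ ℓ) :
    ∃ (sec : S → Plane → S) (δ ρ ν : ℝ), 0 < δ ∧ 0 < ρ ∧ 0 < ν ∧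
      IsUniform ψ P A Γ ℓ sec δ ρ ν := by
  have hQ : IsCompact (Icc (0 : ℝ) 1 ×ˢ Icc (0 : ℝ) 1) := isCompact_Icc.prod isCompact_Icc
  obtain ⟨ρ₁, hρ₁, sec, hsec⟩ := exists_uniform_isSection hcov (hQ.image_of_continuousOn hΓ)
    (by rintro _ ⟨p, hp, rfl⟩; exact hΓP _ hp.1 _ hp.2)
  obtain ⟨δ, hδ, hratio⟩ := exists_ratio hψ hA hΓ hne
  set ρ := min ρ₁ δ
  have hρ : 0 < ρ := lt_min hρ₁ hδ
  have hs : ∀ p ∈ Icc (0 : ℝ) 1 ×ˢ Icc (0 : ℝ) 1,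
      IsSection ψ P (sec (Γ p.1 p.2)) (ball (ψ (Γ p.1 p.2)) ρ) ∧
        sec (Γ p.1 p.2) (ψ (Γ p.1 p.2)) = Γ p.1 p.2 := fun p hp =>
    ⟨(hsec _ (mem_image_of_mem _ hp)).1.mono (ball_subset_ball (min_le_left _ _)),
      (hsec _ (mem_image_of_mem _ hp)).2⟩
  have hcΓ : ContinuousOn (fun p : ℝ × ℝ => ψ (Γ p.1 p.2)) (Icc 0 1 ×ˢ Icc 0 1) :=
    hψ.comp_continuousOn hΓ
  obtain ⟨ν₁, hν₁, h₁⟩ := Metric.uniformContinuousOn_iff.1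
    (hQ.uniformContinuousOn_of_continuous hcΓ) (ρ / 2) (half_pos hρ)
  obtain ⟨ν₂, hν₂, h₂⟩ := Metric.uniformContinuousOn_iff.1
    (hQ.uniformContinuousOn_of_continuous hℓ.continuousOn) (1 / 2) (by norm_num)
  refine ⟨sec, δ, ρ, min ν₁ ν₂, hδ, hρ, lt_min hν₁ hν₂, fun τ hτ t ht => (hs (τ, t) ⟨hτ, ht⟩).1,
    fun τ hτ t ht => (hs (τ, t) ⟨hτ, ht⟩).2, fun τ hτ t ht r hr x hx =>
      hratio τ hτ t ht r hr x (ball_subset_ball (min_le_right _ _) hx), ?_,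
    fun p hp p' hp' h => h₁ p hp p' hp' (h.trans_le (min_le_left _ _)),
    fun p hp p' hp' h => by
      rw [← dist_eq_norm]; exact h₂ p hp p' hp' (h.trans_le (min_le_right _ _))⟩
  intro p hp p' hp' hpp'
  obtain ⟨hsp, hspe⟩ := hs p hp
  obtain ⟨hsp', hspe'⟩ := hs p' hp'
  have hclose : ∀ q ∈ Icc (0 : ℝ) 1 ×ˢ Icc (0 : ℝ) 1, dist q p < ν₁ →
      ψ (Γ q.1 q.2) ∈ ball (ψ (Γ p.1 p.2)) ρ := fun q hq h =>
    (h₁ q hq p hp h).trans (half_lt_self hρ)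
  have hpp : dist p' p < ν₁ := by rw [dist_comm]; exact hpp'.trans_le (min_le_left _ _)
  -- Over the convex set `N` both `Γ` and the section through `Γ p` lift the projected contour. They
  -- agree at `p`, hence at `p'`, so the sections through the two points share a value and agree on
  -- the convex intersection of their balls.
  set N : Set (ℝ × ℝ) := (Icc (0 : ℝ) 1 ×ˢ Icc (0 : ℝ) 1) ∩ ball p ν₁
  have hN : IsPreconnected N :=
    (((convex_Icc 0 1).prod (convex_Icc 0 1)).inter (convex_ball p ν₁)).isPreconnected
  have hlift := eqOn_of_lift hcov hN (g₁ := fun q : ℝ × ℝ => sec (Γ p.1 p.2) (ψ (Γ q.1 q.2)))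
    (g₂ := fun q : ℝ × ℝ => Γ q.1 q.2)
    (hsp.continuousOn.comp (hcΓ.mono inter_subset_left) fun q hq => hclose q hq.1 hq.2)
    (hΓ.mono inter_subset_left) (fun q hq => hsp.proj_eq _ (hclose q hq.1 hq.2))
    (fun q hq => by
      simp only [hsp.proj_eq _ (hclose q hq.1 hq.2)]
      exact hΓP _ hq.1.1 _ hq.1.2)
    (a₀ := p) ⟨hp, mem_ball_self hν₁⟩ hspe
  refine IsSection.eqOn hcov (hsp.mono inter_subset_left) (hsp'.mono inter_subset_right)
    ((convex_ball _ _).inter (convex_ball _ _)).isPreconnected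
    (x₀ := ψ (Γ p'.1 p'.2)) ⟨hclose p' hp' hpp, mem_ball_self hρ⟩ ?_
  rw [hspe']
  exact hlift (show p' ∈ N from ⟨hp', hpp⟩)

end Uniform

/-! ### The Green's integral -/

section Integral

variable {S : Type*} [TopologicalSpace S] {ψ : S → Plane} {P : Finset Plane} {A : ℝ → C2}
  {Γ : ℝ → ℝ → S} {ℓ : ℝ → ℝ → ℂ} {sec : S → Plane → S} {δ ρ ν : ℝ} {k : ℂ} {u : S → ℂ}

/-- Green's form near the point of the contour with parameters `τ` and `t`. -/
def contourForm (ψ : S → Plane) (k : ℂ) (u : S → ℂ) (A : ℝ → C2) (Γ : ℝ → ℝ → S)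
    (ℓ : ℝ → ℝ → ℂ) (sec : S → Plane → S) (r : C2) (τ t : ℝ) : Plane → Plane →L[ℝ] ℂ :=
  greenForm (greenBranch k (A τ) (ψ (Γ τ t)) (ℓ τ t) r) (u ∘ sec (Γ τ t))

namespace IsUniform

theorem slitPlane (h : IsUniform ψ P A Γ ℓ sec δ ρ ν) {τ t : ℝ} (hτ : τ ∈ Icc (0 : ℝ) 1)
    (ht : t ∈ Icc (0 : ℝ) 1) {r : C2} (hr : r ∈ ball (A τ) δ) {x : Plane}
    (hx : x ∈ ball (ψ (Γ τ t)) ρ) :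
    sqNorm (r - toC2 x) / sqDist (A τ) (ψ (Γ τ t)) ∈ Complex.slitPlane := by
  rw [← sqDist_eq]
  exact (mem_slitPlane_of_norm_sub_one_lt (h.ratio τ hτ t ht r hr x hx)).1

theorem contDiffAt_greenBranch (h : IsUniform ψ P A Γ ℓ sec δ ρ ν) (hk : k ≠ 0)
    (hℓ : IsLogDistBranch ψ A Γ ℓ) {τ t : ℝ}
    (hτ : τ ∈ Icc (0 : ℝ) 1) (ht : t ∈ Icc (0 : ℝ) 1) {r : C2} (hr : r ∈ ball (A τ) δ) {x : Plane}
    (hx : x ∈ ball (ψ (Γ τ t)) ρ) :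
    ContDiffAt ℝ 2 (greenBranch k (A τ) (ψ (Γ τ t)) (ℓ τ t) r) x ∧
      helmholtz ℝ k (greenBranch k (A τ) (ψ (Γ τ t)) (ℓ τ t) r) x = 0 := by
  have hs := h.slitPlane hτ ht hr hx
  have ha := analyticAt_kern (k := k) (ℓ₀ := ℓ τ t) hs
  have e : greenBranch k (A τ) (ψ (Γ τ t)) (ℓ τ t) r =
      fun y => kern k (ℓ τ t) (sqDist (A τ) (ψ (Γ τ t))) (r - toC2 y) :=
    funext fun y => greenBranch_eq _ _ _ _ _ _
  rw [e]
  exact ⟨contDiffAt_sub_toC2 ha, by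
    rw [helmholtz_sub_toC2 ha, helmholtz_kern hk (hℓ.exp_eq τ hτ t ht) hs]⟩

/-- Only the germs of the branch and of the sheet enter the form, and both are common to nearby
parameters. This gives local constancy along one contour as well as the comparison of two contours.
-/
theorem contourForm_eq (h : IsUniform ψ P A Γ ℓ sec δ ρ ν)
    (hℓ : IsLogDistBranch ψ A Γ ℓ) {p p' : ℝ × ℝ}
    (hp : p ∈ Icc (0 : ℝ) 1 ×ˢ Icc (0 : ℝ) 1) (hp' : p' ∈ Icc (0 : ℝ) 1 ×ˢ Icc (0 : ℝ) 1)
    (hpp' : dist p p' < ν) {r : C2} (hr : r ∈ ball (A p.1) δ) (hr' : r ∈ ball (A p'.1) δ)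
    {x : Plane} (hx : x ∈ ball (ψ (Γ p.1 p.2)) ρ) (hx' : x ∈ ball (ψ (Γ p'.1 p'.2)) ρ) :
    contourForm ψ k u A Γ ℓ sec r p.1 p.2 x = contourForm ψ k u A Γ ℓ sec r p'.1 p'.2 x := by
  have hnhds := (isOpen_ball.inter isOpen_ball).mem_nhds
    (show x ∈ ball (ψ (Γ p.1 p.2)) ρ ∩ ball (ψ (Γ p'.1 p'.2)) ρ from ⟨hx, hx'⟩)
  refine greenForm_congr ?_ ?_
  · filter_upwards [hnhds] with y hy
    rw [greenBranch_eq, greenBranch_eq, kern, kern]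
    have h1 := h.ratio _ hp.1 _ hp.2 r hr y hy.1
    have h2 := h.ratio _ hp'.1 _ hp'.2 r hr' y hy.2
    rw [sqDist_eq r y] at h1 h2
    rw [logDist_eq_logDist (hℓ.exp_eq _ hp.1 _ hp.2) (hℓ.exp_eq _ hp'.1 _ hp'.2) h1 h2
      (h.log_near p hp p' hp' hpp')]
  · filter_upwards [hnhds] with y hy
    simp only [Function.comp, h.sec_eqOn p hp p' hp' hpp' hy]

theorem onSheet_eventuallyEq (h : IsUniform ψ P A Γ ℓ sec δ ρ ν)
    (hcov : IsCoveringMapOn ψ {x | x ∉ P}) (hρ : 0 < ρ) (u : S → ℂ) {τ t : ℝ}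
    (hτ : τ ∈ Icc (0 : ℝ) 1) (ht : t ∈ Icc (0 : ℝ) 1) :
    onSheet ψ u (Γ τ t) =ᶠ[𝓝 (ψ (Γ τ t))] u ∘ sec (Γ τ t) := by
  have := (h.isSection τ hτ t ht).onSheet_eventuallyEq hcov isOpen_ball (mem_ball_self hρ) u
  rwa [h.sec_apply τ hτ t ht] at this

theorem greenIntegral_eq (h : IsUniform ψ P A Γ ℓ sec δ ρ ν)
    (hcov : IsCoveringMapOn ψ {x | x ∉ P}) (hρ : 0 < ρ) {τ : ℝ} (hτ : τ ∈ Icc (0 : ℝ) 1) (r : C2) :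
    greenIntegral ψ k u A Γ ℓ τ r =
      ∫ t in (0 : ℝ)..1, contourForm ψ k u A Γ ℓ sec r τ t (ψ (Γ τ t))
        (velocity (fun t => ψ (Γ τ t)) t) := by
  refine intervalIntegral.integral_congr fun t ht => ?_
  rw [uIcc_of_le zero_le_one] at ht
  simp only [contourForm, greenForm_apply, Function.comp, h.sec_apply τ hτ t ht]
  rw [(h.onSheet_eventuallyEq hcov hρ u hτ ht).fderiv_eq]
  rfl

theorem dist_prodMk_right {τ t t' : ℝ} : dist (τ, t) (τ, t') = dist t t' := by
  simp [Prod.dist_eq]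

theorem dist_prodMk_left {τ τ' t : ℝ} : dist (τ, t) (τ', t) = dist τ τ' := by
  simp [Prod.dist_eq]

/-- The Green's integrals over nearby contours agree. -/
theorem greenIntegral_congr (h : IsUniform ψ P A Γ ℓ sec δ ρ ν)
    (hcov : IsCoveringMapOn ψ {x | x ∉ P}) (hρ : 0 < ρ) (hν : 0 < ν) (hk : k ≠ 0)
    (hu : ObeysHelmholtz ψ P k u) (hℓ : IsLogDistBranch ψ A Γ ℓ)
    (hΓ : ∀ τ ∈ Icc (0 : ℝ) 1, IsContour ψ P (Γ τ)) {τ τ' : ℝ} (hτ : τ ∈ Icc (0 : ℝ) 1)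
    (hτ' : τ' ∈ Icc (0 : ℝ) 1) (hd : |τ - τ'| < ν) :
    EqOn (greenIntegral ψ k u A Γ ℓ τ) (greenIntegral ψ k u A Γ ℓ τ')
      (ball (A τ) δ ∩ ball (A τ') δ) := by
  rintro r ⟨hr, hr'⟩
  have hdist : ∀ t, dist (τ, t) (τ', t) < ν := fun t => by
    rw [dist_prodMk_left, Real.dist_eq]; exact hd
  have hnear : ∀ t ∈ Icc (0 : ℝ) 1, ψ (Γ τ' t) ∈ ball (ψ (Γ τ t)) (ρ / 2) := fun t ht => by
    rw [mem_ball, dist_comm]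
    exact h.proj_near (τ, t) ⟨hτ, ht⟩ (τ', t) ⟨hτ', ht⟩ (hdist t)
  rw [h.greenIntegral_eq hcov hρ hτ, h.greenIntegral_eq hcov hρ hτ']
  have hom : IsSegmentHomotopy (contourForm ψ k u A Γ ℓ sec r τ) (fun t => ψ (Γ τ t))
      (fun t => ψ (Γ τ' t)) := by
    refine ⟨(hΓ τ hτ).smooth, (hΓ τ' hτ').smooth, by simp only [(hΓ τ hτ).closed],
      by simp only [(hΓ τ' hτ').closed], fun t ht => ?_, ?_⟩
    -- The half radius leaves room: this ball contains the matching point of the other contour, and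
    -- it lies inside the balls of radius `ρ` about the points with nearby parameters, so their
    -- forms agree on it.
    · have hsub : ball (ψ (Γ τ t)) (ρ / 2) ⊆ ball (ψ (Γ τ t)) ρ :=
        ball_subset_ball (half_le_self hρ.le)
      have hG := fun x (hx : x ∈ ball (ψ (Γ τ t)) (ρ / 2)) =>
        h.contDiffAt_greenBranch hk hℓ hτ ht hr (hsub hx)
      have hU := fun x (hx : x ∈ ball (ψ (Γ τ t)) (ρ / 2)) =>
        (h.isSection τ hτ t ht).contDiffAt hcov isOpen_ball hu (hsub hx)
      refine ⟨ball (ψ (Γ τ t)) (ρ / 2), isOpen_ball, convex_ball _ _,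
        mem_ball_self (half_pos hρ), hnear t ht,
        continuousOn_greenForm (fun x hx => (hG x hx).1) (fun x hx => (hU x hx).1),
        exists_primitive_greenForm isOpen_ball (convex_ball _ _) hG hU, ?_⟩
      filter_upwards [mem_nhdsWithin_of_mem_nhds (ball_mem_nhds t hν), self_mem_nhdsWithin]
        with t' ht' htI x hx
      have hdt : dist (τ, t') (τ, t) < ν := by rw [dist_prodMk_right]; exact ht'
      have hpn := h.proj_near (τ, t') ⟨hτ, htI⟩ (τ, t) ⟨hτ, ht⟩ hdt
      refine h.contourForm_eq hℓ (p := (τ, t')) (p' := (τ, t)) ⟨hτ, htI⟩ ⟨hτ, ht⟩ hdt hr hr ?_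
        (hsub hx)
      rw [mem_ball] at hx ⊢
      rw [dist_comm] at hpn
      linarith [dist_triangle x (ψ (Γ τ t)) (ψ (Γ τ t'))]
    -- The form returns to itself after the circuit, since the contour and the logarithm both close
    -- up.
    · intro x _
      simp only [contourForm, (hΓ τ hτ).closed, hℓ.closed (fun τ hτ => (hΓ τ hτ).closed) τ hτ]
  rw [hom.integral_eq]
  refine intervalIntegral.integral_congr fun t ht => ?_
  rw [uIcc_of_le zero_le_one] at ht
  have := h.contourForm_eq (k := k) (u := u) hℓ (p := (τ, t)) (p' := (τ', t)) ⟨hτ, ht⟩ ⟨hτ', ht⟩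
    (hdist t) hr hr' (ball_subset_ball (half_le_self hρ.le) (hnear t ht)) (mem_ball_self hρ)
  simp only [this]

end IsUniform

end Integral

/-! ### Analyticity of the integrals in `r`. -/

section Analytic

variable {S : Type*} [TopologicalSpace S] {ψ : S → Plane} {P : Finset Plane} {A : ℝ → C2}
  {Γ : ℝ → ℝ → S} {ℓ : ℝ → ℝ → ℂ} {sec : S → Plane → S} {δ ρ ν : ℝ} {k : ℂ} {u : S → ℂ}

theorem fderiv_greenBranch {r₀ r : C2} {x₀ x : Plane} {ℓ₀ : ℂ}
    (h : sqNorm (r - toC2 x) / sqDist r₀ x₀ ∈ Complex.slitPlane) (w : Plane) :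
    fderiv ℝ (greenBranch k r₀ x₀ ℓ₀ r) x w =
      fderiv ℂ (kern k ℓ₀ (sqDist r₀ x₀)) (r - toC2 x) (-toC2 w) := by
  have e : greenBranch k r₀ x₀ ℓ₀ r = fun y => kern k ℓ₀ (sqDist r₀ x₀) (r - toC2 y) :=
    funext fun y => greenBranch_eq _ _ _ _ _ _
  rw [e, (hasFDerivAt_sub_toC2 (analyticAt_kern h).differentiableAt).fderiv]
  simp

theorem continuous_rightNormal {c : ℝ → Plane} (hc : ContDiffOn ℝ 1 c (Icc 0 1)) :
    ContinuousOn (rightNormal c) (Icc 0 1) :=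
  (rotL.continuous.comp_continuousOn (continuousOn_velocity hc)).congr fun _ _ => rfl

namespace IsUniform

/-- `onSheet` uses a separate chart for every `t`. Near a fixed `t` all of them can be replaced by
the one section `sec (Γ τ t)`, for which the gradient is continuous. -/
theorem continuousOn_normalDeriv (h : IsUniform ψ P A Γ ℓ sec δ ρ ν)
    (hcov : IsCoveringMapOn ψ {x | x ∉ P}) (hρ : 0 < ρ) (hν : 0 < ν)
    (hu : ObeysHelmholtz ψ P k u) {τ : ℝ} (hτ : τ ∈ Icc (0 : ℝ) 1)
    (hΓ : ContDiffOn ℝ 1 (fun t => ψ (Γ τ t)) (Icc 0 1)) :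
    ContinuousOn (fun t => fderiv ℝ (onSheet ψ u (Γ τ t)) (ψ (Γ τ t))
      (rightNormal (fun t => ψ (Γ τ t)) t)) (Icc 0 1) := by
  intro t ht
  have hU := ((h.isSection τ hτ t ht).contDiffAt hcov isOpen_ball hu (mem_ball_self hρ)).1
  have h1 : ContinuousWithinAt (fun t' => fderiv ℝ (u ∘ sec (Γ τ t)) (ψ (Γ τ t'))
      (rightNormal (fun t => ψ (Γ τ t)) t')) (Icc 0 1) t :=
    ((differentiableAt_fderiv hU).continuousAt.comp_continuousWithinAt
      (f := fun t' => ψ (Γ τ t')) (hΓ.continuousOn t ht)).clm_apply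
      (continuous_rightNormal hΓ t ht)
  refine h1.congr_of_eventuallyEq_of_mem ?_ ht
  filter_upwards [mem_nhdsWithin_of_mem_nhds (ball_mem_nhds t hν), self_mem_nhdsWithin]
    with t' ht' htI
  rw [(h.onSheet_eventuallyEq hcov hρ u hτ htI).fderiv_eq]
  have hdt : dist (τ, t') (τ, t) < ν := by rw [dist_prodMk_right]; exact ht'
  have hmem : ψ (Γ τ t') ∈ ball (ψ (Γ τ t')) ρ ∩ ball (ψ (Γ τ t)) ρ :=
    ⟨mem_ball_self hρ, (h.proj_near (τ, t') ⟨hτ, htI⟩ (τ, t) ⟨hτ, ht⟩ hdt).trans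
      (half_lt_self hρ)⟩
  have e : u ∘ sec (Γ τ t') =ᶠ[𝓝 (ψ (Γ τ t'))] u ∘ sec (Γ τ t) := by
    filter_upwards [(isOpen_ball.inter isOpen_ball).mem_nhds hmem] with y hy
    simp only [Function.comp, h.sec_eqOn (τ, t') ⟨hτ, htI⟩ (τ, t) ⟨hτ, ht⟩ hdt hy]
  rw [e.fderiv_eq]

theorem isAnalyticSolution (h : IsUniform ψ P A Γ ℓ sec δ ρ ν)
    (hcov : IsCoveringMapOn ψ {x | x ∉ P}) (hρ : 0 < ρ) (hν : 0 < ν) (hk : k ≠ 0)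
    (hu : ObeysHelmholtz ψ P k u) (hℓ : IsLogDistBranch ψ A Γ ℓ) {τ : ℝ}
    (hτ : τ ∈ Icc (0 : ℝ) 1) (hΓ : IsContour ψ P (Γ τ)) :
    IsAnalyticSolution k (greenIntegral ψ k u A Γ ℓ τ) (ball (A τ) δ) := by
  set c : ℝ → Plane := fun t => ψ (Γ τ t)
  set n : ℝ → Plane := rightNormal c
  set Q : ℝ → ℂ := fun t => sqDist (A τ) (c t)
  set w : ℝ → ℂ := fun t => fderiv ℝ (onSheet ψ u (Γ τ t)) (c t) (n t)
  set f : C2 → ℝ → ℂ := fun r t =>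
    fderiv ℝ (greenBranch k (A τ) (c t) (ℓ τ t) r) (c t) (n t) * u (Γ τ t) -
      w t * greenBranch k (A τ) (c t) (ℓ τ t) r (c t)
  have hslit : ∀ r ∈ ball (A τ) δ, ∀ t ∈ Icc (0 : ℝ) 1,
      sqNorm (r - toC2 (c t)) / Q t ∈ Complex.slitPlane := fun r hr t ht =>
    h.slitPlane hτ ht hr (mem_ball_self hρ)
  have hf : ∀ r ∈ ball (A τ) δ, ∀ t ∈ Icc (0 : ℝ) 1, f r t =
      fderiv ℂ (kern k (ℓ τ t) (Q t)) (r - toC2 (c t)) (-toC2 (n t)) * u (Γ τ t) -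
        w t * kern k (ℓ τ t) (Q t) (r - toC2 (c t)) := fun r hr t ht => by
    simp only [f, fderiv_greenBranch (hslit r hr t ht), greenBranch_eq]
    rfl
  have hcc : ContinuousOn c (Icc 0 1) := hΓ.smooth.continuousOn
  have hnc : ContinuousOn n (Icc 0 1) := continuous_rightNormal hΓ.smooth
  have hcoord {g : ℝ → Plane} (hg : ContinuousOn g (Icc 0 1)) (i : Fin 2) :
      ContinuousOn (fun t => ((g t i : ℝ) : ℂ)) (Icc 0 1) :=
    Complex.continuous_ofReal.comp_continuousOn
      ((EuclideanSpace.proj (𝕜 := ℝ) i).continuous.comp_continuousOn hg)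
  have hQc : ContinuousOn (fun t => (Q t)⁻¹) (Icc 0 1) := by
    refine ContinuousOn.inv₀ ?_ fun t ht => ?_
    · exact ContinuousOn.congr (continuous_sqDist.comp_continuousOn
        (continuousOn_const.prodMk hcc)) fun _ _ => rfl
    · have he : Q t = Complex.exp (2 * ℓ τ t) := (hℓ.exp_eq τ hτ t ht).symm
      exact he ▸ Complex.exp_ne_zero _
  have hℓc : ContinuousOn (ℓ τ) (Icc 0 1) :=
    hℓ.continuousOn.comp (f := fun t : ℝ => (τ, t)) (by fun_prop) fun t ht => ⟨hτ, ht⟩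
  have huc : ContinuousOn (fun t => u (Γ τ t)) (Icc 0 1) :=
    hu.continuous.comp_continuousOn hΓ.continuousOn
  have hwc : ContinuousOn w (Icc 0 1) := h.continuousOn_normalDeriv hcov hρ hν hu hτ hΓ.smooth
  have hconst (r₀ : C2) {g : ℝ → ℂ} (hg : ContinuousOn g (Icc 0 1)) :
      AnalyticFamilyAt (fun _ (t : Icc (0 : ℝ) 1) => g t) r₀ :=
    analyticFamilyAt_const (continuousOn_iff_continuous_domRestrict.1 hg) r₀
  -- The integrand is built from the coordinates of `r` and continuous functions of `t` by
  -- arithmetic and by superposition with `log`, inversion, `greenOfLog` and `greenDeriv`.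
  have hfam : ∀ r₀ ∈ ball (A τ) δ, AnalyticFamilyAt (fun r (t : Icc (0 : ℝ) 1) => f r t) r₀ := by
    intro r₀ hr₀
    have hs := fun t : Icc (0 : ℝ) 1 => hslit r₀ hr₀ t t.2
    have hv (i : Fin 2) : AnalyticFamilyAt
        (fun r (t : Icc (0 : ℝ) 1) => (r - toC2 (c t)) i) r₀ := by
      refine ((analyticFamilyAt_coord i r₀).sub (hconst r₀ (hcoord hcc i))).congr
        (Eventually.of_forall fun r t => ?_)
      fin_cases i <;> simp [toC2]
    have hsq : AnalyticFamilyAt (fun r (t : Icc (0 : ℝ) 1) => sqNorm (r - toC2 (c t))) r₀ :=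
      (((hv 0).mul (hv 0)).add ((hv 1).mul (hv 1))).congr
        (Eventually.of_forall fun r t => by simp only [sqNorm, sq])
    have hlog : AnalyticFamilyAt
        (fun r (t : Icc (0 : ℝ) 1) => logDist (ℓ τ t) (Q t) (r - toC2 (c t))) r₀ :=
      (hconst r₀ hℓc).add ((hconst r₀ continuousOn_const).mul
        ((hsq.mul (hconst r₀ hQc)).comp (Φ := Complex.log) fun t => analyticAt_clog (hs t)))
    have hinv := hsq.comp (Φ := fun z => z⁻¹) fun t => analyticAt_inv (sqNorm_ne_zero (hs t)).1
    have hG := hlog.comp (Φ := greenOfLog k) fun t => (differentiable_greenOfLog k).analyticAt _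
    have hG' := hlog.comp (Φ := greenDeriv k) fun t => (differentiable_greenDeriv hk).analyticAt _
    have hdot := ((hv 0).mul (hconst r₀ (hcoord hnc 0).neg)).add
      ((hv 1).mul (hconst r₀ (hcoord hnc 1).neg))
    refine ((((hG'.mul hinv).mul hdot).mul (hconst r₀ huc)).sub
      ((hconst r₀ hwc).mul hG)).congr ?_
    filter_upwards [isOpen_ball.mem_nhds hr₀] with r hr t
    rw [hf r hr t t.2, (hasFDerivAt_kern (hslit r hr t t.2)).fderiv]
    simp [dotL_apply, toC2, kern, div_eq_mul_inv]
  refine ⟨fun r₀ hr₀ => (hfam r₀ hr₀).analyticAt_integral,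
    fun r₀ hr₀ => (hfam r₀ hr₀).helmholtz_integral fun t ht => ?_⟩
  -- For fixed `t` the integrand combines `kern` and a directional derivative of it, translated by
  -- the contour point, so the equation for `kern` suffices.
  have e : (fun r => f r t) =ᶠ[𝓝 r₀] fun r =>
      (fun v => fderiv ℂ (kern k (ℓ τ t) (Q t)) v (-toC2 (n t)) * u (Γ τ t) -
        w t * kern k (ℓ τ t) (Q t) v) (r - toC2 (c t)) := by
    filter_upwards [isOpen_ball.mem_nhds hr₀] with r hr
    exact hf r hr t ht
  have hs := hslit r₀ hr₀ t ht
  have ha := analyticAt_kern (k := k) (ℓ₀ := ℓ τ t) hs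
  have hexp : Complex.exp (2 * ℓ τ t) = Q t := hℓ.exp_eq τ hτ t ht
  refine (helmholtz_congr e).trans ((helmholtz_comp_sub k
    (fun v => fderiv ℂ (kern k (ℓ τ t) (Q t)) v (-toC2 (n t)) * u (Γ τ t) -
      w t * kern k (ℓ τ t) (Q t) v) (toC2 (c t)) r₀).trans ?_)
  rw [helmholtz_combination (ha.fderiv_apply _) ha,
    helmholtz_kern hk hexp hs, helmholtz_fderiv_eq_zero ha]
  · ring
  · filter_upwards [eventually_slitPlane hs] with v hv using helmholtz_kern hk hexp hv

end IsUniform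

/-! ### The initial value -/

/-- On the loop all sheets come from the single section `s`, and for real `x` near `ψ A₀` the branch
is the real Green's function, so the representation formula applies. -/
theorem IsUniform.exists_initial (h : IsUniform ψ P A Γ ℓ sec δ ρ ν)
    (hcov : IsCoveringMapOn ψ {x | x ∉ P}) (hδ : 0 < δ) (hρ : 0 < ρ) (hk : k ≠ 0)
    (hu : ObeysHelmholtz ψ P k u) (hℓ : IsLogDistBranch ψ A Γ ℓ) {A₀ : S}
    (hA0 : A 0 = toC2 (ψ A₀)) (hΓ : IsSmallLoop ψ P A₀ (Γ 0)) :
    ∃ ε > 0, ∀ x ∈ ball (ψ A₀) ε,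
      greenIntegral ψ k u A Γ ℓ 0 (toC2 x) = onSheet ψ u A₀ x := by
  obtain ⟨D, s, hD, hDstar, hA₀D, hDP, hs, hψs, hsA₀, hsΓ⟩ := hΓ.one_sheet
  have hsec : IsSection ψ P s D := ⟨hs, hψs, hDP⟩
  have hΓs : ∀ t ∈ Icc (0 : ℝ) 1, ψ (Γ 0 t) ∈ D ∧ s (ψ (Γ 0 t)) = Γ 0 t := fun t ht => by
    obtain ⟨y, hy, hye⟩ := hsΓ t ht
    rw [← hye, hψs y hy]
    exact ⟨hy, rfl⟩
  obtain ⟨ε₁, hε₁, hrep⟩ := exists_radius_representation hD hDstar hA₀D hk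
    (fun x hx => hsec.contDiffAt hcov hD hu hx) hΓ.contour.smooth
    (by simp only [hΓ.contour.closed]) (fun t ht => (hΓs t ht).1) hΓ.avoids hΓ.anticlockwise
  have hsheet := hsec.onSheet_eventuallyEq hcov hD hA₀D u
  rw [hsA₀] at hsheet
  obtain ⟨ε₂, hε₂, hsheet⟩ := Metric.eventually_nhds_iff_ball.1 hsheet
  refine ⟨min δ (min ε₁ ε₂), by positivity, fun x hx => ?_⟩
  have h0 : (0 : ℝ) ∈ Icc (0 : ℝ) 1 := ⟨le_rfl, zero_le_one⟩
  have hxδ : toC2 x ∈ ball (A 0) δ := by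
    rw [hA0, mem_ball, dist_eq_norm, ← toC2_sub, norm_toC2, ← dist_eq_norm]
    exact (mem_ball.1 hx).trans_le (min_le_left _ _)
  rw [hsheet x (ball_subset_ball ((min_le_right _ _).trans (min_le_right _ _)) hx), ← hrep x
    (ball_subset_ball ((min_le_right _ _).trans (min_le_left _ _)) hx)]
  refine intervalIntegral.integral_congr fun t ht => ?_
  rw [uIcc_of_le zero_le_one] at ht
  have hsl := h.slitPlane h0 ht hxδ (mem_ball_self hρ)
  have hne : ψ (Γ 0 t) ≠ x := fun he => (sqNorm_ne_zero hsl).1 (by rw [he]; simp [sqNorm])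
  have hU := hsec.onSheet_eventuallyEq hcov hD (hΓs t ht).1 u
  rw [(hΓs t ht).2] at hU
  have hGe : greenBranch k (A 0) (ψ (Γ 0 t)) (ℓ 0 t) (toC2 x) =ᶠ[𝓝 (ψ (Γ 0 t))]
      realGreen k x := by
    filter_upwards [isOpen_ne.mem_nhds hne] with y hy
    have hy' : 0 < ‖y - x‖ := norm_pos_iff.2 (sub_ne_zero.2 hy)
    have hc' : 0 < ‖ψ (Γ 0 t) - ψ A₀‖ := norm_pos_iff.2 (sub_ne_zero.2 (hΓ.avoids t ht))
    -- With `c = ψ (Γ 0 t)` and `a = ψ A₀`: `log ‖c - a‖ + ½ log (‖y - x‖² / ‖c - a‖²) = log ‖y -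
    -- x‖`, all logarithms being real.
    rw [greenBranch_eq, kern, realGreen, logDist, hℓ.initial t ht, hA0, sqDist_toC2,
      sqNorm_toC2_sub, ← toC2_sub, norm_toC2, norm_sub_rev (ψ A₀), ← Complex.ofReal_div,
      ← div_pow, half_log_sq (by positivity), Real.log_div hy'.ne' hc'.ne']
    push_cast
    ring_nf
  simp only [greenForm_apply, Function.comp, (hΓs t ht).2]
  rw [hGe.fderiv_eq, hGe.eq_of_nhds, hU.fderiv_eq]
  rfl

end Analytic

/-! ### Gluing along a simple path -/

/-- The pairs with `η ≤ |τ - τ'|` form a compact set, on which the distance is positive by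
injectivity. -/
theorem exists_separation {A : ℝ → C2} (hA : ContinuousOn A (Icc 0 1)) (hinj : InjOn A (Icc 0 1))
    {η : ℝ} (hη : 0 < η) : ∃ m > 0, ∀ τ ∈ Icc (0 : ℝ) 1, ∀ τ' ∈ Icc (0 : ℝ) 1, η ≤ |τ - τ'| →
      m ≤ dist (A τ) (A τ') := by
  set K : Set (ℝ × ℝ) := (Icc (0 : ℝ) 1 ×ˢ Icc (0 : ℝ) 1) ∩ {p | η ≤ |p.1 - p.2|}
  have hK : IsCompact K := (isCompact_Icc.prod isCompact_Icc).inter_right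
    (isClosed_le continuous_const (by fun_prop))
  have h₁ : ContinuousOn (fun p : ℝ × ℝ => A p.1) K :=
    hA.comp (f := fun p : ℝ × ℝ => p.1) continuousOn_fst fun p hp => hp.1.1
  have h₂ : ContinuousOn (fun p : ℝ × ℝ => A p.2) K :=
    hA.comp (f := fun p : ℝ × ℝ => p.2) continuousOn_snd fun p hp => hp.1.2
  have hc : ContinuousOn (fun p : ℝ × ℝ => dist (A p.1) (A p.2)) K :=
    continuous_dist.comp_continuousOn (h₁.prodMk h₂)
  rcases K.eq_empty_or_nonempty with he | hne
  · refine ⟨1, one_pos, fun τ hτ τ' hτ' h => ?_⟩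
    have : (τ, τ') ∈ K := ⟨⟨hτ, hτ'⟩, h⟩
    simp [he] at this
  · obtain ⟨p, hp, hmin⟩ := hK.exists_isMinOn hne hc
    refine ⟨dist (A p.1) (A p.2), dist_pos.2 fun he => ?_, fun τ hτ τ' hτ' h =>
      isMinOn_iff.1 hmin (τ, τ') ⟨⟨hτ, hτ'⟩, h⟩⟩
    have h1 := hp.2
    rw [mem_ofPred_eq, hinj hp.1.1 hp.1.2 he, sub_self, abs_zero] at h1
    linarith

theorem exists_glued {k : ℂ} {A : ℝ → C2} {I : ℝ → C2 → ℂ} {δ : ℝ}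
    (hI : ∀ τ ∈ Icc (0 : ℝ) 1, IsAnalyticSolution k (I τ) (ball (A τ) δ))
    (hc : ∀ τ ∈ Icc (0 : ℝ) 1, ∀ τ' ∈ Icc (0 : ℝ) 1,
      EqOn (I τ) (I τ') (ball (A τ) δ ∩ ball (A τ') δ)) :
    ∃ uc : C2 → ℂ, IsAnalyticSolution k uc (thickening δ (A '' Icc 0 1)) ∧
      ∀ τ ∈ Icc (0 : ℝ) 1, EqOn uc (I τ) (ball (A τ) δ) := by
  classical
  let uc : C2 → ℂ := fun r => if h : ∃ τ ∈ Icc (0 : ℝ) 1, r ∈ ball (A τ) δ then I h.choose r else 0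
  have huc : ∀ τ ∈ Icc (0 : ℝ) 1, EqOn uc (I τ) (ball (A τ) δ) := fun τ hτ r hr => by
    have h : ∃ τ ∈ Icc (0 : ℝ) 1, r ∈ ball (A τ) δ := ⟨τ, hτ, hr⟩
    simp only [uc, dif_pos h]
    exact hc _ h.choose_spec.1 τ hτ ⟨h.choose_spec.2, hr⟩
  have hloc : ∀ r ∈ thickening δ (A '' Icc 0 1), ∃ τ ∈ Icc (0 : ℝ) 1,
      r ∈ ball (A τ) δ ∧ I τ =ᶠ[𝓝 r] uc := fun r hr => by
    obtain ⟨_, ⟨τ, hτ, rfl⟩, hd⟩ := mem_thickening_iff.1 hr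
    refine ⟨τ, hτ, hd, ?_⟩
    filter_upwards [isOpen_ball.mem_nhds (show r ∈ ball (A τ) δ from hd)] with r' hr'
    exact (huc τ hτ hr').symm
  refine ⟨uc, ⟨fun r hr => ?_, fun r hr => ?_⟩, huc⟩ <;> obtain ⟨τ, hτ, hd, he⟩ := hloc r hr
  · exact ((hI τ hτ).1 r hd).congr he
  · rw [← helmholtz_congr he]
    exact (hI τ hτ).2 r hd

/-- `Γ 0` is known to equal `γ` on `[0, 1]` only. Since `velocity` is a derivative within that
interval, the swept angle is unaffected. -/
theorem IsSmallLoop.congr {S : Type*} [TopologicalSpace S] {ψ : S → Plane} {P : Finset Plane}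
    {A₀ : S} {γ γ' : ℝ → S} (h : IsSmallLoop ψ P A₀ γ) (h' : IsContour ψ P γ')
    (he : ∀ t ∈ Icc (0 : ℝ) 1, γ' t = γ t) : IsSmallLoop ψ P A₀ γ' := by
  obtain ⟨D, s, h1, h2, h3, h4, h5, h6, h7, h8⟩ := h.one_sheet
  refine ⟨h', ⟨D, s, h1, h2, h3, h4, h5, h6, h7, fun t ht => by rw [he t ht]; exact h8 t ht⟩,
    fun t ht => by rw [he t ht]; exact h.avoids t ht, ?_⟩
  rw [← h.anticlockwise]
  refine intervalIntegral.integral_congr fun t ht => ?_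
  rw [uIcc_of_le zero_le_one] at ht
  have hv : velocity (fun t => ψ (γ' t)) t = velocity (fun t => ψ (γ t)) t :=
    derivWithin_congr (fun s hs => by simp only [he s hs]) (by simp only [he t ht])
  simp only [he t ht, hv]

end Sommerfeld

end

theorem mainTheorem4 {S : Type*} [TopologicalSpace S] (ψ : S → Sommerfeld.Plane)
    (P : Finset Sommerfeld.Plane) (M : ℕ) (hS : Sommerfeld.IsSommerfeldSurface ψ P M)
    (k : ℂ) (hk_re : 0 < k.re) (hk_im : 0 ≤ k.im)
    (u : S → ℂ) (hu : Sommerfeld.ObeysHelmholtz ψ P k u)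
    (A₀ : S) (hA₀ : ψ A₀ ∉ P)
    (γ : ℝ → S) (hγ : Sommerfeld.IsSmallLoop ψ P A₀ γ)
    -- the path `σ`
    (A : ℝ → Sommerfeld.C2) (hA : ContinuousOn A (Icc 0 1)) (hA0 : A 0 = Sommerfeld.toC2 (ψ A₀))
    -- the contours
    (Γ : ℝ → ℝ → S)
    (hΓ : ContinuousOn (fun p : ℝ × ℝ => Γ p.1 p.2) (Icc 0 1 ×ˢ Icc 0 1))
    (hΓ_contour : ∀ τ ∈ Icc (0 : ℝ) 1, Sommerfeld.IsContour ψ P (Γ τ))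
    (hΓ_zero : ∀ t ∈ Icc (0 : ℝ) 1, Γ 0 t = γ t)
    (hΓ_avoid₁ : ∀ τ ∈ Icc (0 : ℝ) 1,
      Sommerfeld.realPoint₁ (A τ) ∉ (fun t => ψ (Γ τ t)) '' Icc 0 1)
    (hΓ_avoid₂ : ∀ τ ∈ Icc (0 : ℝ) 1,
      Sommerfeld.realPoint₂ (A τ) ∉ (fun t => ψ (Γ τ t)) '' Icc 0 1) :
    -- the branch of the Green's function on the moving contour is well defined ...
    ∃ ℓ : ℝ → ℝ → ℂ, Sommerfeld.IsLogDistBranch ψ A Γ ℓ ∧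
      (∀ ℓ', Sommerfeld.IsLogDistBranch ψ A Γ ℓ' →
        ∀ τ ∈ Icc (0 : ℝ) 1, ∀ t ∈ Icc (0 : ℝ) 1, ℓ' τ t = ℓ τ t) ∧
      (∀ τ ∈ Icc (0 : ℝ) 1, ℓ τ 0 = ℓ τ 1) ∧
      ∃ δ > 0,
        -- ... the Green's integrals are analytic solutions near the points of the path ...
        (∀ τ ∈ Icc (0 : ℝ) 1, Sommerfeld.IsAnalyticSolution k
          (Sommerfeld.greenIntegral ψ k u A Γ ℓ τ) (ball (A τ) δ)) ∧
        -- ... the first of them extends `u` ...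
        (∀ x ∈ ball (ψ A₀) δ, Sommerfeld.greenIntegral ψ k u A Γ ℓ 0 (Sommerfeld.toC2 x) =
          Sommerfeld.onSheet ψ u A₀ x) ∧
        -- ... each is the direct continuation of the nearby ones ...
        (∃ η > 0, ∀ τ ∈ Icc (0 : ℝ) 1, ∀ τ' ∈ Icc (0 : ℝ) 1, |τ - τ'| < η →
          EqOn (Sommerfeld.greenIntegral ψ k u A Γ ℓ τ) (Sommerfeld.greenIntegral ψ k u A Γ ℓ τ')
            (ball (A τ) δ ∩ ball (A τ') δ)) ∧
        -- ... and for a simple path they form one function in a neighbourhood of the path.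
        (InjOn A (Icc 0 1) → ∃ uc : Sommerfeld.C2 → ℂ,
          Sommerfeld.IsAnalyticSolution k uc (thickening δ (A '' Icc 0 1)) ∧
          ∀ τ ∈ Icc (0 : ℝ) 1,
            EqOn uc (Sommerfeld.greenIntegral ψ k u A Γ ℓ τ) (ball (A τ) δ)) := by
  have hψ := hS.proper.continuous
  have hcov := hS.covering
  have hk : k ≠ 0 := fun h => by simp [h] at hk_re
  have h0 : (0 : ℝ) ∈ Icc (0 : ℝ) 1 := ⟨le_rfl, zero_le_one⟩
  have hne : ∀ τ ∈ Icc (0 : ℝ) 1, ∀ t ∈ Icc (0 : ℝ) 1,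
      Sommerfeld.sqDist (A τ) (ψ (Γ τ t)) ≠ 0 := fun τ hτ t ht he => by
    rcases Sommerfeld.eq_realPoint_of_sqDist_eq_zero he with h | h
    · exact hΓ_avoid₁ τ hτ ⟨t, ht, h.symm⟩
    · exact hΓ_avoid₂ τ hτ ⟨t, ht, h.symm⟩
  obtain ⟨ℓ, hℓ⟩ := Sommerfeld.exists_isLogDistBranch hψ hA hA0 hΓ hne
  refine ⟨ℓ, hℓ, fun ℓ' h' => hℓ.unique h', hℓ.closed fun τ hτ => (hΓ_contour τ hτ).closed, ?_⟩
  obtain ⟨sec, δ, ρ, ν, hδ, hρ, hν, h⟩ := Sommerfeld.exists_isUniform hψ hcov hA hΓ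
    (fun τ hτ => (hΓ_contour τ hτ).avoids) hne hℓ
  obtain ⟨ε, hε, hinit⟩ := h.exists_initial hcov hδ hρ hk hu hℓ hA0
    (hγ.congr (hΓ_contour 0 h0) hΓ_zero)
  -- The radius is fixed before injectivity is assumed, so the separation constant is chosen here
  -- with its property conditional on injectivity.
  obtain ⟨m, hm, hsep⟩ : ∃ m > 0, InjOn A (Icc 0 1) → ∀ τ ∈ Icc (0 : ℝ) 1,
      ∀ τ' ∈ Icc (0 : ℝ) 1, ν ≤ |τ - τ'| → m ≤ dist (A τ) (A τ') := by
    by_cases hinj : InjOn A (Icc 0 1)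
    · obtain ⟨m, hm, hsep⟩ := Sommerfeld.exists_separation hA hinj hν
      exact ⟨m, hm, fun _ => hsep⟩
    · exact ⟨1, one_pos, fun h => absurd h hinj⟩
  -- The bound `m / 2` makes balls about points with parameters at least `ν` apart disjoint on a
  -- simple path; gluing then needs only the comparison of nearby parameters.
  set d := min δ (min ε (m / 2))
  have hd : d ≤ δ := min_le_left _ _
  have hdε : d ≤ ε := (min_le_right _ _).trans (min_le_left _ _)
  have hdm : d ≤ m / 2 := (min_le_right _ _).trans (min_le_right _ _)
  have hsol : ∀ τ ∈ Icc (0 : ℝ) 1, Sommerfeld.IsAnalyticSolution k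
      (Sommerfeld.greenIntegral ψ k u A Γ ℓ τ) (ball (A τ) d) := fun τ hτ => by
    have h' := h.isAnalyticSolution hcov hρ hν hk hu hℓ hτ (hΓ_contour τ hτ)
    exact ⟨h'.1.mono (ball_subset_ball hd), fun r hr => h'.2 r (ball_subset_ball hd hr)⟩
  have hcongr : ∀ τ ∈ Icc (0 : ℝ) 1, ∀ τ' ∈ Icc (0 : ℝ) 1, |τ - τ'| < ν →
      EqOn (Sommerfeld.greenIntegral ψ k u A Γ ℓ τ) (Sommerfeld.greenIntegral ψ k u A Γ ℓ τ')
        (ball (A τ) d ∩ ball (A τ') d) := fun τ hτ τ' hτ' hlt =>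
    (h.greenIntegral_congr hcov hρ hν hk hu hℓ hΓ_contour hτ hτ' hlt).mono
      (inter_subset_inter (ball_subset_ball hd) (ball_subset_ball hd))
  refine ⟨d, by positivity, hsol, fun x hx => hinit x (ball_subset_ball hdε hx),
    ⟨ν, hν, hcongr⟩, fun hinj => Sommerfeld.exists_glued hsol fun τ hτ τ' hτ' => ?_⟩
  rcases lt_or_ge |τ - τ'| ν with hlt | hge
  · exact hcongr τ hτ τ' hτ' hlt
  · rintro r ⟨hr, hr'⟩
    have h1 := dist_triangle_left (A τ) (A τ') r
    have h2 := hsep hinj τ hτ τ' hτ' hge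
    rw [mem_ball] at hr hr'
    linarith
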